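/- **Theorem.** *Notation.* $e(x)=\exp(2\pi i x)$. Integers $r,s\ge 2$ are called dependent, $r\sim s$, if $r^p=s^q$ for some positive integers $p,q$. For a real sequence $(x_n)_{n\ge1}$ let $D_N(x_n)=\sup_{I}\left|\frac1N\#\{1\le n\le N:\{x_n\}\in I\}-|I|\right|$, the supremum being over all intervals $I\subseteq[0,1)$. A real number is normal to base $b\geq 2$ if every block of $k$ base-$b$ digits occurs in its base-$b$ expansion with asymptotic frequency $b^{-k}$ (for all $k\ge 1$), and absolutely normal if it is normal to every base $b\ge 2$. *Constants.* (a) There are constants $0<a(r,s)<\tfrac12$, one for each pair of integers $r,s\ge2$ with $r\not\sim s$, such that $$\sum_{n=0}^{N-1}\ \prod_{k=K+1}^{\infty}\left|\cos(\pi r^n l/s^k)\right|\ \le\ 2N^{1-a(r,s)}\qquad(1)$$ for all integers $K,l\ge 1$ with $l\ge s^K$ and all $N\ge 0$. Fix any such choice of constants below. *Sequences.* Let $r_i=i+1$ $(i\ge 1)$ be the sequence of all bases, and let $(s_j)_{j\ge1}$ be any sequence of integers $s_j>2$ with $s_m\le m s_1$ such that for each $r\ge2$ one has $r\not\sim s_m$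 for all sufficiently large $m$. Put $\beta_k=\min\{a(r_i,s_j):1\le i,j\le k,\ r_i\not\sim s_j\}$ (with $\beta_k=\frac12$ if there is no such pair) and $\gamma_k=\max(r_1,\dots,r_k,s_1,\dots,s_k)$. Let $\kappa>0$. Put $\phi(1)=1$ and, for $k\geq 2$, let $\phi(k)$ be the largest integer $f$ with $1\le f\le\phi(k-1)+1$, $\beta_f\ge\beta_1/k^{\kappa}$ and $\gamma_f\le\gamma_1k$ (Schmidt's original choice is $\kappa=\frac14$). From now on replace $r_i$ and $s_i$ by $r_{\phi(i)}$ and $s_{\phi(i)}$ (that is, repeat terms), write $r_i,s_i,\beta_k$ for the new sequences and the new minima, and for each $r\ge2$ fix any index $m_0(r)$ with $r\not\sim s_m$ for all $m\ge m_0(r)$. *Algorithm.* Let $0<c<1$, $\langle m\rangle=\lfloor e^{m^c}\rfloor$, $\langle m;x\rangle=\lfloor\langle m\rangle/\log x\rfloor$, $a_m=\langle m;s_m\rangle$, $b_m=\langle m+1;s_m\rangle$, and $$A_m'(x)=\sum_{\substack{t=-m\\ t\ne0}}^{m}\ \sum_{\substack{1\le i\le m\\ m_0(r_i)\le m}}\left|\sum_{j=\langle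 m;r_i\rangle+1}^{\langle m+1;r_i\rangle}e(r_i^{\,j}tx)\right|^2 .$$ Put $\xi_0=0$. For $m\ge1$ let $\eta_m$ be the smallest number of the form $g s_m^{-a_m}$, $g\in\mathbb Z$, with $\eta_m\ge\xi_{m-1}$, let $\sigma_m$ be the set of all numbers $\eta_m+\sum_{k=a_m+1}^{b_m-2}d_k s_m^{-k}$ with $d_k\in\{0,1\}$ (so $\sigma_m=\{\eta_m\}$ if $b_m-2<a_m+1$), and let $\xi_m$ be the smallest element of $\sigma_m$ among those at which $A_m'$ attains its minimum on $\sigma_m$. *Claims.* In addition to (a), for every $0<c<1$: (b) The algorithm is well defined: it produces exactly one sequence $(\xi_m)$. This sequence converges to a real number $\xi_c$, and $\xi_m\le\xi_c$ for all $m$. If the original sequence $(s_j)$ is strictly increasing, then also $\xi_c<\xi_m+s_m^{-b_m+2}$ for all sufficiently large $m$. (c) There is a constant $\delta>0$ depending only on $c$ such that, for all $m\ge1$, $$A'_m(\xi_c)\le\delta\, m^2\left(\langle m+1\rangle-\langle m\rangle\right)^{2-\beta_m}.$$ (d) If $\kappa<c$ (in particular for Schmidt's $\kappa=\frac14$ when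 $c>\frac14$), then $\xi_c$ is absolutely normal, and for every base $r\ge2$ $$D_N(\{r^n\xi_c\})\ll\frac{\log\log N}{(\log N)^A},\qquad A=\frac{1-c}{c},$$ where the implied constant and "$N$ large enough" may depend on $r$ and on all data fixed above. -/

import Mathlib

open Filter Topology Asymptotics

noncomputable section

namespace Schmidt

open Classical in
/-- The discrepancy of `x 1, …, x N`; the supremum runs over all intervals `I ⊆ [0, 1)`
(of any type: open, closed, half-open, degenerate). -/
def discrepancy (x : ℕ → ℝ) (N : ℕ) : ℝ :=
  sSup {d : ℝ | ∃ I : Set ℝ, I ⊆ Set.Ico 0 1 ∧ I.OrdConnected ∧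
    d = |(((Finset.Icc 1 N).filter (fun n => Int.fract (x n) ∈ I)).card : ℝ) / N
          - MeasureTheory.volume.real I|}

/-- The `(n+1)`-st digit after the radix point in the base `b` expansion of `x`. -/
def digit (b : ℕ) (x : ℝ) (n : ℕ) : ℤ := ⌊(b : ℝ) ^ (n + 1) * x⌋ % (b : ℤ)

open Classical in
/-- `x` is normal to base `b`: every block of `k ≥ 1` digits occurs in the base `b` expansion
with asymptotic frequency `b ^ (-k)`. -/
def IsNormal (b : ℕ) (x : ℝ) : Prop :=
  ∀ k : ℕ, 1 ≤ k → ∀ w : Fin k → Fin b,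
    Tendsto (fun N : ℕ =>
      (((Finset.range N).filter
        (fun n => ∀ i : Fin k, digit b x (n + i) = ((w i : ℕ) : ℤ))).card : ℝ) / N)
      atTop (𝓝 (1 / (b : ℝ) ^ k))

/-- Normal to every integer base `b ≥ 2`. -/
def IsAbsolutelyNormal (x : ℝ) : Prop := ∀ b : ℕ, 2 ≤ b → IsNormal b x

/-- `r ∼ s`: `r` and `s` are rational powers of each other (used for `r, s ≥ 2`). -/
def MultDep (r s : ℕ) : Prop := ∃ p q : ℕ, 0 < p ∧ 0 < q ∧ r ^ p = s ^ q

/-- `a` is a positive constant for which Schmidt's cosine estimate holds for `r` and `s`.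
The infinite product runs over `k = K + 1 + i`, `i = 0, 1, 2, …`. -/
def IsCosineConstant (r s : ℕ) (a : ℝ) : Prop :=
  0 < a ∧ ∀ K l N : ℕ, 0 < K → 0 < l → s ^ K ≤ l →
    ∑ n ∈ Finset.range N,
        ∏' i : ℕ, |Real.cos (Real.pi * (r : ℝ) ^ n * (l : ℝ) / (s : ℝ) ^ (K + 1 + i))|
      ≤ 2 * (N : ℝ) ^ (1 - a)

/-- A choice, for every multiplicatively independent pair `r, s ≥ 2`, of a constant
`a r s < 1/2` in the cosine estimate. -/
def IsCosineConstants (a : ℕ → ℕ → ℝ) : Prop :=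
  ∀ r s : ℕ, 2 ≤ r → 2 ≤ s → ¬ MultDep r s → IsCosineConstant r s (a r s) ∧ a r s < 1 / 2

/-- The sequence `2, 3, 4, …` of all bases, indexed from `1`. -/
def bases (i : ℕ) : ℕ := i + 1

/-- The conditions on the auxiliary sequence `s 1, s 2, …` (the value `s 0` is not used). -/
structure IsAuxSeq (s : ℕ → ℕ) : Prop where
  two_lt : ∀ m, 1 ≤ m → 2 < s m
  le_mul : ∀ m, 1 ≤ m → s m ≤ m * s 1
  indep : ∀ r, 2 ≤ r → ∃ m₀, ∀ m, 1 ≤ m → m₀ ≤ m → ¬ MultDep r (s m)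

open Classical in
/-- `β_k`: the minimum of the `a (r i) (s j)` over the multiplicatively independent pairs
with `1 ≤ i, j ≤ k` (these are `< 1/2`; the value is `1/2` if there is no such pair). -/
def beta (a : ℕ → ℕ → ℝ) (r s : ℕ → ℕ) (k : ℕ) : ℝ :=
  ((Finset.Icc 1 k ×ˢ Finset.Icc 1 k).filter (fun p => ¬ MultDep (r p.1) (s p.2))).fold
    min (1 / 2) (fun p => a (r p.1) (s p.2))

/-- `γ_k = max (r 1, …, r k, s 1, …, s k)`. -/
def gam (r s : ℕ → ℕ) (k : ℕ) : ℕ := (Finset.Icc 1 k).sup (fun i => max (r i) (s i))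

open Classical in
/-- `φ(1) = 1`, and `φ(k)` is the largest integer `f ≤ φ(k-1) + 1` such that
`β_f ≥ β_1 / k ^ κ` and `γ_f ≤ γ_1 k` (the value `φ(0)` is not used). -/
def phi (κ : ℝ) (a : ℕ → ℕ → ℝ) (r s : ℕ → ℕ) : ℕ → ℕ
  | 0 => 1
  | 1 => 1
  | k + 2 => Nat.findGreatest
      (fun f => 1 ≤ f ∧ beta a r s 1 / ((k + 2 : ℕ) : ℝ) ^ κ ≤ beta a r s f ∧
        gam r s f ≤ gam r s 1 * (k + 2))
      (phi κ a r s (k + 1) + 1)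

/-- The bases after repetition, `r'_i = r_{φ(i)}`. -/
def repBases (κ : ℝ) (a : ℕ → ℕ → ℝ) (s : ℕ → ℕ) (i : ℕ) : ℕ := bases (phi κ a bases s i)

/-- The auxiliary sequence after repetition, `s'_i = s_{φ(i)}`. -/
def repAux (κ : ℝ) (a : ℕ → ℕ → ℝ) (s : ℕ → ℕ) (i : ℕ) : ℕ := s (phi κ a bases s i)

/-- `⟨m⟩ = ⌊exp (m ^ c)⌋`. -/
def bracket (c : ℝ) (m : ℕ) : ℕ := ⌊Real.exp ((m : ℝ) ^ c)⌋₊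

/-- `⟨m; x⟩ = ⌊⟨m⟩ / log x⌋`. -/
def bracketBase (c : ℝ) (m x : ℕ) : ℕ := ⌊(bracket c m : ℝ) / Real.log x⌋₊

/-- `η_m(y)`: the smallest `g s_m ^ (-a_m) ≥ y` with `g` an integer, where `a_m = ⟨m; s_m⟩`. -/
def eta (c : ℝ) (s : ℕ → ℕ) (m : ℕ) (y : ℝ) : ℝ :=
  (⌈y * (s m : ℝ) ^ bracketBase c m (s m)⌉ : ℝ) / (s m : ℝ) ^ bracketBase c m (s m)

/-- `σ_m(y)`: all numbers `η_m(y) + ∑ d_k s_m ^ (-k)`, `a_m + 1 ≤ k ≤ b_m - 2`, with digits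
`d_k ∈ {0, 1}`, where `a_m = ⟨m; s_m⟩` and `b_m = ⟨m+1; s_m⟩`. The sum is empty if
`b_m - 2 < a_m + 1`. -/
def sigma (c : ℝ) (s : ℕ → ℕ) (m : ℕ) (y : ℝ) : Set ℝ :=
  {x | ∃ d : ℕ → ℕ, (∀ k, d k = 0 ∨ d k = 1) ∧
    x = eta c s m y + ∑ k ∈ Finset.Icc (bracketBase c m (s m) + 1)
      (bracketBase c (m + 1) (s m) - 2), (d k : ℝ) / (s m : ℝ) ^ k}

/-- `A'_m(x)`, the sum over `-m ≤ t ≤ m`, `t ≠ 0`, and over `1 ≤ i ≤ m` with `m₀(r_i) ≤ m`, of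
`|∑ e(r_i ^ j t x)|²`, where `⟨m; r_i⟩ < j ≤ ⟨m+1; r_i⟩` and `e(y) = exp (2 π i y)`. -/
def Aprime (c : ℝ) (m₀ : ℕ → ℕ) (r : ℕ → ℕ) (m : ℕ) (x : ℝ) : ℝ :=
  ∑ t ∈ (Finset.Icc (-(m : ℤ)) (m : ℤ)).erase 0,
    ∑ i ∈ (Finset.Icc 1 m).filter (fun i => m₀ (r i) ≤ m),
      ‖∑ j ∈ Finset.Icc (bracketBase c m (r i) + 1) (bracketBase c (m + 1) (r i)),
        Complex.exp (2 * Real.pi * Complex.I * (((r i : ℝ) ^ j * (t : ℝ) * x : ℝ) : ℂ))‖ ^ 2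

/-- `ξ 0, ξ 1, …` is the sequence produced by the algorithm: `ξ 0 = 0`, and `ξ m` is the smallest
of the elements of `σ_m(ξ (m-1))` that minimize `A'_m` on that set. -/
structure IsRun (c : ℝ) (m₀ : ℕ → ℕ) (r s : ℕ → ℕ) (ξ : ℕ → ℝ) : Prop where
  zero : ξ 0 = 0
  step : ∀ m, 1 ≤ m → IsLeast
    {x | x ∈ sigma c s m (ξ (m - 1)) ∧
      ∀ y ∈ sigma c s m (ξ (m - 1)), Aprime c m₀ r m x ≤ Aprime c m₀ r m y} (ξ m)

end Schmidt

end

namespace Schmidt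

/-! ### Infinite products with factors in the unit interval -/

/-! Existence of the cosine constants. In base q = s², a digit of x other than 0 and q - 1 forces a
factor of `cosProd s x` down to cos(π/q), so the mean of the product over a full period of digits is
exponentially small in the number of digits. Powers of r do not run through such a period, but
Dirichlet's theorem gives h, j with r^h/s^j very close to 1 and, by independence, different from 1.
Since removing powers of s from the argument only increases the product, the terms n, n + h, n + 2h,
... are bounded by products along a geometric progression of ratio close to 1, whose integer parts,
after rescaling, are distinct and fill a short window (`exists_sum_cosProd_geometric_le`,
`exists_sum_cosProd_le`). Shrinking the exponent turns the constant into 2.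

Cancellation. Averaging |∑ e(r^j t x)|² over the binary digit choices of one step turns each
correlation into a finite product of cosines (`norm_sum_powerset_ee`). It can be completed to the
infinite product of (1) at the cost of a factor 2, except for logarithmically many j at the top of
the block. The minimizer does at least as well as the mean, and ξ_c is so close to ξ_m that a block
sum changes by a logarithmic amount only. These logarithms involve s_1, whereas δ may depend on c
alone. The way out is that (1) itself forces a(r, s) to be small for large s when r is 2 or 3
(`log_rpow_le_of_isCosineConstant`), so that (log s_1)^β stays bounded (`log_rpow_beta_le`,
`mul_gap_le`).

Discrepancy. By the definition of φ, β_m ≥ β_1/m^κ, while the block length is at least exp(m^c/2)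
for large m. For κ < c the saving therefore beats every power of m (`exists_mul_norm_blockSum_le`).
A power of the Fejér kernel converts the bounds for frequencies up to m into an error of relative
order m^(c-1) on each block (`card_filter_fract_le`, `exists_card_block_le`). The incomplete last
block, counted trivially, has the same order, and m^(c-1) is O((log N)^(-A)). The factor log log N
is not needed for this bound. -/

theorem multipliable_of_mem_unitInterval {f : ℕ → ℝ} (h0 : ∀ i, 0 ≤ f i) (h1 : ∀ i, f i ≤ 1) :
    Multipliable f := by
  -- The finite partial products decrease and are bounded below, so they converge unconditionally to
  -- their infimum, which may be 0.
  have hanti : Antitone (fun t : Finset ℕ => ∏ i ∈ t, f i) := by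
    intro t u htu
    show ∏ i ∈ u, f i ≤ ∏ i ∈ t, f i
    rw [← Finset.prod_sdiff htu]
    exact mul_le_of_le_one_left (Finset.prod_nonneg fun i _ => h0 i)
      (Finset.prod_le_one (fun i _ => h0 i) (fun i _ => h1 i))
  refine ⟨⨅ t : Finset ℕ, ∏ i ∈ t, f i, ?_⟩
  have := tendsto_atTop_ciInf hanti
    ⟨0, by rintro _ ⟨t, rfl⟩; exact Finset.prod_nonneg fun i _ => h0 i⟩
  simpa [HasProd] using this

theorem tprod_le_prod_range {f : ℕ → ℝ} (h0 : ∀ i, 0 ≤ f i) (h1 : ∀ i, f i ≤ 1) (n : ℕ) :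
    ∏' i, f i ≤ ∏ i ∈ Finset.range n, f i := by
  have h := (multipliable_of_mem_unitInterval h0 h1).hasProd.tendsto_prod_nat
  refine le_of_tendsto h ?_
  filter_upwards [eventually_ge_atTop n] with m hm
  rw [← Finset.prod_range_mul_prod_Ico f hm]
  exact mul_le_of_le_one_right (Finset.prod_nonneg fun i _ => h0 i)
    (Finset.prod_le_one (fun i _ => h0 i) (fun i _ => h1 i))

theorem le_tprod_of_le_prod_range {f : ℕ → ℝ} (h0 : ∀ i, 0 ≤ f i) (h1 : ∀ i, f i ≤ 1) {b : ℝ}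
    (n₀ : ℕ) (h : ∀ n, n₀ ≤ n → b ≤ ∏ i ∈ Finset.range n, f i) : b ≤ ∏' i, f i := by
  have h' := (multipliable_of_mem_unitInterval h0 h1).hasProd.tendsto_prod_nat
  refine ge_of_tendsto h' ?_
  filter_upwards [eventually_ge_atTop n₀] with m hm using h m hm

theorem one_sub_sum_le_prod_one_sub {ι : Type*} (t : Finset ι) {u : ι → ℝ} (h0 : ∀ i, 0 ≤ u i)
    (h1 : ∀ i, u i ≤ 1) : 1 - ∑ i ∈ t, u i ≤ ∏ i ∈ t, (1 - u i) := by
  classical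
  induction t using Finset.induction_on with
  | empty => simp
  | insert a t ha ih =>
    rw [Finset.sum_insert ha, Finset.prod_insert ha]
    have hp : ∏ i ∈ t, (1 - u i) ≤ 1 :=
      Finset.prod_le_one (fun i _ => by linarith [h1 i]) (fun i _ => by linarith [h0 i])
    nlinarith [h0 a, h1 a]

/-! ### The cosine product -/

/-- `∏_{k ≥ 1} |cos (π x / s ^ k)|`. -/
noncomputable def cosProd (s : ℕ) (x : ℝ) : ℝ := ∏' i : ℕ, |Real.cos (Real.pi * x / (s : ℝ) ^ (i + 1))|

theorem cosProd_le_prod_range (s : ℕ) (x : ℝ) (n : ℕ) :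
    cosProd s x ≤ ∏ i ∈ Finset.range n, |Real.cos (Real.pi * x / (s : ℝ) ^ (i + 1))| :=
  tprod_le_prod_range (fun _ => abs_nonneg _) (fun _ => Real.abs_cos_le_one _) n

theorem cosProd_nonneg (s : ℕ) (x : ℝ) : 0 ≤ cosProd s x :=
  le_tprod_of_le_prod_range (fun _ => abs_nonneg _) (fun _ => Real.abs_cos_le_one _) 0
    fun _ _ => Finset.prod_nonneg fun _ _ => abs_nonneg _

theorem cosProd_le_one (s : ℕ) (x : ℝ) : cosProd s x ≤ 1 := by
  simpa using cosProd_le_prod_range s x 0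

/-- The factor s^j only puts j further factors, each at most 1, in front of the product for x. This
is how powers of s are stripped from arguments r^n x. -/
theorem cosProd_pow_mul_le {s : ℕ} (hs : 0 < s) (j : ℕ) (x : ℝ) :
    cosProd s ((s : ℝ) ^ j * x) ≤ cosProd s x := by
  refine le_tprod_of_le_prod_range (fun _ => abs_nonneg _) (fun _ => Real.abs_cos_le_one _) 0
    fun n _ => (cosProd_le_prod_range s _ (j + n)).trans ?_
  rw [Finset.prod_range_add]
  have hs' : (s : ℝ) ≠ 0 := by positivity
  refine (mul_le_of_le_one_left (Finset.prod_nonneg fun _ _ => abs_nonneg _)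
    (Finset.prod_le_one (fun _ _ => abs_nonneg _) fun _ _ => Real.abs_cos_le_one _)).trans
      (le_of_eq (Finset.prod_congr rfl fun i _ => ?_))
  congr 2
  rw [add_assoc, pow_add]
  field_simp

/-- If `4 y ≤ s ^ k`, the factors from the `k`-th on have a product of at least `1 / 2`. -/
theorem half_le_prod_abs_cos {s : ℕ} (hs : 2 ≤ s) {y : ℝ} (hy : 0 ≤ y) (k n : ℕ)
    (h : 4 * y ≤ (s : ℝ) ^ k) :
    1 / 2 ≤ ∏ i ∈ Finset.range n, |Real.cos (Real.pi * y / (s : ℝ) ^ (k + i))| := by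
  have hs' : (2 : ℝ) ≤ s := by exact_mod_cast hs
  have hspos : (0 : ℝ) < s := by linarith
  -- The angle is at most (π/4)/2^i and (π/4)² ≤ 5/8, so cos x ≥ 1 - x²/2 gives this. The defects
  -- add up to at most 5/16 · 4/3 = 5/12 < 1/2.
  have key : ∀ i, 1 - (1 / 4 : ℝ) ^ i * (5 / 16) ≤ |Real.cos (Real.pi * y / (s : ℝ) ^ (k + i))| := by
    intro i
    set x := Real.pi * y / (s : ℝ) ^ (k + i) with hx
    have hx0 : 0 ≤ x := by positivity
    have hx1 : x ≤ Real.pi / 4 * (1 / 2) ^ i := by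
      rw [hx, pow_add, div_le_iff₀ (by positivity)]
      have h2 : (2 : ℝ) ^ i ≤ (s : ℝ) ^ i := pow_le_pow_left₀ (by norm_num) hs' i
      have : (1 : ℝ) ≤ (1 / 2) ^ i * (s : ℝ) ^ i := by
        rw [div_pow, one_pow, one_div_mul_eq_div, one_le_div (by positivity)]; exact h2
      have h3 : (4 * y) * 1 ≤ (s : ℝ) ^ k * ((1 / 2) ^ i * (s : ℝ) ^ i) := by gcongr
      nlinarith [Real.pi_pos]
    have hx2 : x ^ 2 ≤ 5 / 8 * (1 / 4) ^ i := by
      have h4 : x ^ 2 ≤ (Real.pi / 4 * (1 / 2) ^ i) ^ 2 := pow_le_pow_left₀ hx0 hx1 2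
      have h5 : (Real.pi / 4 * (1 / 2) ^ i) ^ 2 = (Real.pi / 4) ^ 2 * (1 / 4) ^ i := by
        rw [mul_pow, ← pow_mul, mul_comm i 2, pow_mul]; norm_num
      have h6 : (Real.pi / 4) ^ 2 ≤ 5 / 8 := by nlinarith [Real.pi_lt_d2, Real.pi_pos]
      rw [h5] at h4
      exact h4.trans (by gcongr)
    have := Real.one_sub_sq_div_two_le_cos (x := x)
    refine le_trans ?_ (le_abs_self _)
    linarith
  have hq : ∀ i : ℕ, (1 / 4 : ℝ) ^ i * (5 / 16) ≤ 1 := fun i => by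
    have : (1 / 4 : ℝ) ^ i ≤ 1 := pow_le_one₀ (by norm_num) (by norm_num)
    linarith
  calc (1 / 2 : ℝ) ≤ 1 - ∑ i ∈ Finset.range n, (1 / 4 : ℝ) ^ i * (5 / 16) := by
        rw [← Finset.sum_mul, geom_sum_eq (by norm_num)]
        have : (0 : ℝ) < (1 / 4) ^ n := by positivity
        have e : ((1 / 4 : ℝ) ^ n - 1) / (1 / 4 - 1) = (1 - (1 / 4) ^ n) * (4 / 3) := by
          norm_num; ring
        rw [e]; linarith
    _ ≤ ∏ i ∈ Finset.range n, (1 - (1 / 4 : ℝ) ^ i * (5 / 16)) :=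
        one_sub_sum_le_prod_one_sub _ (fun i => by positivity) hq
    _ ≤ _ := Finset.prod_le_prod (fun i _ => by linarith [hq i]) fun i _ => key i

/-! ### Digit weights -/

/-- Weight of a digit `d` in base `q`. -/
noncomputable def digitWeight (q d : ℕ) : ℝ := if 1 ≤ d ∧ d + 2 ≤ q then Real.cos (Real.pi / q) else 1

/-- Product of the weights of the last `I` digits of `v` in base `q`. -/
noncomputable def blockWeight (q I v : ℕ) : ℝ := ∏ i ∈ Finset.range I, digitWeight q (v / q ^ i % q)

theorem cos_pi_div_nonneg {q : ℕ} (hq : 4 ≤ q) : 0 ≤ Real.cos (Real.pi / q) := by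
  have hq' : (4 : ℝ) ≤ q := by exact_mod_cast hq
  have hp := Real.pi_pos
  have : Real.pi / q ≤ Real.pi / 4 := by gcongr
  exact Real.cos_nonneg_of_mem_Icc ⟨by have : 0 ≤ Real.pi / q := by positivity
                                       linarith, by linarith⟩

theorem cos_pi_div_lt_one {q : ℕ} (hq : 4 ≤ q) : Real.cos (Real.pi / q) < 1 := by
  have hq' : (4 : ℝ) ≤ q := by exact_mod_cast hq
  have hp := Real.pi_pos
  rw [← Real.cos_zero]
  refine Real.cos_lt_cos_of_nonneg_of_le_pi le_rfl ?_ (by positivity)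
  rw [div_le_iff₀ (by positivity)]
  nlinarith

theorem digitWeight_nonneg {q : ℕ} (hq : 4 ≤ q) (d : ℕ) : 0 ≤ digitWeight q d := by
  unfold digitWeight; split_ifs
  · exact cos_pi_div_nonneg hq
  · norm_num

theorem blockWeight_nonneg {q : ℕ} (hq : 4 ≤ q) (I v : ℕ) : 0 ≤ blockWeight q I v :=
  Finset.prod_nonneg fun _ _ => digitWeight_nonneg hq _

/-- If the digit d of ⌊y⌋ at place i satisfies 1 ≤ d ≤ q - 2, the fractional part of y/q^(i+1) lies
in [1/q, 1 - 1/q], away from the maxima of |cos πx|. -/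
theorem abs_cos_le_digitWeight {q : ℕ} (hq : 4 ≤ q) {y : ℝ} (hy : 0 ≤ y) (i : ℕ) :
    |Real.cos (Real.pi * y / (q : ℝ) ^ (i + 1))| ≤ digitWeight q (⌊y⌋₊ / q ^ i % q) := by
  unfold digitWeight
  split_ifs with hd
  swap
  · exact Real.abs_cos_le_one _
  have hq0 : (0 : ℝ) < q := by positivity
  set u := ⌊y⌋₊ / q ^ i with hu
  set d := u % q with hdd
  have hud : q * (u / q) + d = u := Nat.div_add_mod u q
  have hqi : 0 < q ^ i := by positivity
  have h1 : (u : ℝ) * (q : ℝ) ^ i ≤ y := by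
    have : u * q ^ i ≤ ⌊y⌋₊ := Nat.div_mul_le_self _ _
    calc (u : ℝ) * (q : ℝ) ^ i = ((u * q ^ i : ℕ) : ℝ) := by push_cast; ring
      _ ≤ (⌊y⌋₊ : ℝ) := by exact_mod_cast this
      _ ≤ y := Nat.floor_le hy
  have h2 : y < ((u : ℝ) + 1) * (q : ℝ) ^ i := by
    have : ⌊y⌋₊ + 1 ≤ (u + 1) * q ^ i := by
      have := Nat.lt_div_mul_add (a := ⌊y⌋₊) hqi
      rw [← hu] at this; nlinarith
    calc y < (⌊y⌋₊ : ℝ) + 1 := Nat.lt_floor_add_one y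
      _ ≤ (((u + 1) * q ^ i : ℕ) : ℝ) := by exact_mod_cast this
      _ = _ := by push_cast; ring
  set f := y / (q : ℝ) ^ (i + 1) - (u / q : ℕ) with hf
  have hqi' : (0 : ℝ) < (q : ℝ) ^ i := by positivity
  have hudR : (q : ℝ) * ((u / q : ℕ) : ℝ) + d = u := by exact_mod_cast hud
  have hqf : (q : ℝ) * f = y / (q : ℝ) ^ i - q * ((u / q : ℕ) : ℝ) := by
    rw [hf, pow_succ]; field_simp
  have h1' : (u : ℝ) ≤ y / (q : ℝ) ^ i := by rw [le_div_iff₀ hqi']; exact h1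
  have h2' : y / (q : ℝ) ^ i < u + 1 := by rw [div_lt_iff₀ hqi']; exact h2
  have hd1 : (1 : ℝ) ≤ d := by exact_mod_cast hd.1
  have hd2 : (d : ℝ) + 2 ≤ q := by exact_mod_cast hd.2
  have hf1 : 1 ≤ q * f := by linarith
  have hf2 : q * f ≤ q - 1 := by linarith
  have heq : Real.pi * y / (q : ℝ) ^ (i + 1) = Real.pi * f + ((u / q : ℕ) : ℝ) * Real.pi := by
    rw [hf]; ring
  have hpi := Real.pi_pos
  have hl : Real.pi / q ≤ Real.pi * f := by rw [div_le_iff₀ hq0]; nlinarith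
  have hr : Real.pi * f ≤ Real.pi - Real.pi / q := by
    rw [le_sub_iff_add_le, ← le_sub_iff_add_le', div_le_iff₀ hq0]; nlinarith
  have hpq : 0 ≤ Real.pi / q := by positivity
  rw [heq, Real.cos_add_nat_mul_pi, abs_mul, abs_pow, abs_neg, abs_one, one_pow, one_mul, abs_le]
  constructor
  · rw [← Real.cos_pi_sub]
    exact Real.cos_le_cos_of_nonneg_of_le_pi (by linarith) (by linarith) hr
  · exact Real.cos_le_cos_of_nonneg_of_le_pi hpq (by linarith) hl

/-- Keeping every second factor passes to base s², which has digits besides the two extreme ones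
even for s = 2. Dividing by its k-th power drops the first k of the factors kept. -/
theorem cosProd_le_blockWeight {s : ℕ} (hs : 2 ≤ s) {x : ℝ} (hx : 0 ≤ x) (k I : ℕ) :
    cosProd s x ≤ blockWeight (s ^ 2) I ⌊x / ((s ^ 2 : ℕ) : ℝ) ^ k⌋₊ := by
  have hq : 4 ≤ s ^ 2 := by nlinarith
  have hs0 : (s : ℝ) ≠ 0 := by positivity
  have hpair : ∀ n, ∏ i ∈ Finset.range (2 * n), |Real.cos (Real.pi * x / (s : ℝ) ^ (i + 1))| ≤
      ∏ i ∈ Finset.range n, |Real.cos (Real.pi * x / (s : ℝ) ^ (2 * (i + 1)))| := by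
    intro n
    induction n with
    | zero => simp
    | succ n ih =>
      rw [mul_add, mul_one, Finset.prod_range_succ, Finset.prod_range_succ,
        Finset.prod_range_succ _ n]
      refine mul_le_mul ?_ (le_of_eq (by ring_nf)) (abs_nonneg _)
        (Finset.prod_nonneg fun _ _ => abs_nonneg _)
      exact (mul_le_of_le_one_right (Finset.prod_nonneg fun _ _ => abs_nonneg _)
        (Real.abs_cos_le_one _)).trans ih
  refine (cosProd_le_prod_range s x (2 * (k + I))).trans ((hpair _).trans ?_)
  rw [Finset.prod_range_add]
  refine (mul_le_of_le_one_left (Finset.prod_nonneg fun _ _ => abs_nonneg _)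
    (Finset.prod_le_one (fun _ _ => abs_nonneg _) fun _ _ => Real.abs_cos_le_one _)).trans ?_
  refine Finset.prod_le_prod (fun _ _ => abs_nonneg _) fun i _ => ?_
  have := abs_cos_le_digitWeight hq (y := x / ((s ^ 2 : ℕ) : ℝ) ^ k) (by positivity) i
  refine le_trans (le_of_eq ?_) this
  congr 2
  push_cast
  rw [← pow_mul, ← pow_mul, show 2 * (k + i + 1) = 2 * k + 2 * (i + 1) by ring, pow_add]
  field_simp

theorem sum_digitWeight {q : ℕ} (hq : 4 ≤ q) :
    ∑ d ∈ Finset.range q, digitWeight q d = 2 + (q - 2) * Real.cos (Real.pi / q) := by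
  obtain ⟨p, rfl⟩ : ∃ p, q = p + 2 := ⟨q - 2, by omega⟩
  rw [Finset.sum_range_succ, Finset.sum_range_succ']
  have h : ∀ i ∈ Finset.range p, digitWeight (p + 2) (i + 1) = Real.cos (Real.pi / ((p + 2 : ℕ) : ℝ)) := by
    intro i hi
    rw [Finset.mem_range] at hi
    rw [digitWeight, if_pos (by omega)]
  rw [Finset.sum_congr rfl h, Finset.sum_const, digitWeight, digitWeight, if_neg (by omega),
    if_neg (by omega), Finset.card_range, nsmul_eq_mul]
  push_cast; ring

/-- Over a full period the I digits run independently through all values, so the sum factors. -/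
theorem sum_blockWeight {q : ℕ} (I : ℕ) :
    ∑ v ∈ Finset.range (q ^ I), blockWeight q I v =
      (∑ d ∈ Finset.range q, digitWeight q d) ^ I := by
  rw [Finset.sum_range, Finset.sum_range, Fintype.sum_pow]
  refine Fintype.sum_equiv finFunctionFinEquiv.symm _ _ fun v => ?_
  rw [blockWeight, Finset.prod_range]
  rfl

theorem blockWeight_add_pow {q : ℕ} (hq : 0 < q) (I v : ℕ) :
    blockWeight q I (v + q ^ I) = blockWeight q I v := by
  refine Finset.prod_congr rfl fun i hi => ?_
  rw [Finset.mem_range] at hi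
  obtain ⟨t, rfl⟩ : ∃ t, I = i + 1 + t := ⟨I - i - 1, by omega⟩
  congr 1
  rw [show v + q ^ (i + 1 + t) = v + q ^ i * (q * q ^ t) by ring,
    Nat.add_mul_div_left _ _ (by positivity), Nat.add_mul_mod_self_left]

theorem sum_Ico_of_periodic {W : ℕ → ℝ} {P : ℕ} (hW : ∀ v, W (v + P) = W v) (v₀ B : ℕ) :
    ∑ v ∈ Finset.Ico v₀ (v₀ + B * P), W v = B * ∑ v ∈ Finset.range P, W v := by
  have h1 : ∀ a, ∑ v ∈ Finset.range P, W (a + v) = ∑ v ∈ Finset.range P, W v := by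
    intro a
    induction a with
    | zero => simp
    | succ a ih =>
      have h := Finset.sum_range_succ' (fun v => W (a + v)) P
      rw [Finset.sum_range_succ] at h
      rw [← ih]
      have e : ∀ v, W (a + 1 + v) = W (a + (v + 1)) := fun v => by congr 1; ring
      simp only [e]
      simp only [hW, add_zero] at h
      linarith
  induction B with
  | zero => simp
  | succ B ih =>
    rw [← Finset.sum_Ico_consecutive _ (Nat.le_add_right v₀ (B * P)) (by nlinarith), ih,
      Finset.sum_Ico_eq_sum_range, show v₀ + (B + 1) * P - (v₀ + B * P) = P by
        rw [Nat.sub_eq_iff_eq_add (by nlinarith)]; ring, h1]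
    push_cast; ring

/-! ### Cosine products along a geometric progression of small ratio -/

/-- After division by a suitable q^k the points z l^a have consecutive gaps between 1 and 2q. Their
integer parts are then distinct and lie in boundedly many periods of the last I digits, where q^I ≤
A < q^(I+1). The sum is at most the sum of the weights over these periods, which saves ρ^I, with ρ <
1 the mean digit weight. -/
theorem exists_sum_cosProd_geometric_le {s : ℕ} (hs : 2 ≤ s) :
    ∃ C η : ℝ, 0 < C ∧ 0 < η ∧ η ≤ 1 ∧ ∀ (A : ℕ) (z l : ℝ), 1 ≤ A → 0 < z → 1 < l →
      1 ≤ z * (l - 1) → (∀ a, a ≤ A → l ^ a ≤ 2) →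
      ∑ a ∈ Finset.range A, cosProd s (z * l ^ a) ≤ C * A * (A : ℝ) ^ (-η) := by
  set q := s ^ 2 with hqdef
  have hq : 4 ≤ q := by rw [hqdef]; nlinarith
  have hqR : (4 : ℝ) ≤ q := by exact_mod_cast hq
  have hq0 : (0 : ℝ) < q := by linarith
  set T := ∑ d ∈ Finset.range q, digitWeight q d with hT
  set ρ := T / q with hρ
  have hTpos : 2 ≤ T := by
    rw [hT, sum_digitWeight hq]
    have := cos_pi_div_nonneg hq
    nlinarith
  have hTlt : T < q := by
    rw [hT, sum_digitWeight hq]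
    have := cos_pi_div_lt_one hq
    nlinarith
  have hρ0 : 0 < ρ := by positivity
  have hρ1 : ρ < 1 := by rw [hρ, div_lt_one hq0]; exact hTlt
  have hlq : 0 < Real.log q := Real.log_pos (by linarith)
  -- Chosen so that q^(-η) = ρ: a factor ρ per digit becomes the power A^(-η).
  set η := - Real.log ρ / Real.log q with hη
  have hηpos : 0 < η := div_pos (by have := Real.log_neg hρ0 hρ1; linarith) hlq
  have hqη : (q : ℝ) ^ (-η) = ρ := by
    rw [Real.rpow_def_of_pos hq0, hη]
    rw [show Real.log q * -(-Real.log ρ / Real.log q) = Real.log ρ by field_simp]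
    exact Real.exp_log hρ0
  have hη1 : η ≤ 1 := by
    by_contra! hcon
    have h1 : (q : ℝ) ^ (-η) < (q : ℝ) ^ (-1 : ℝ) :=
      Real.rpow_lt_rpow_of_exponent_lt (by linarith) (by linarith)
    rw [hqη, Real.rpow_neg_one, hρ, div_eq_mul_inv] at h1
    have : 0 < (q : ℝ)⁻¹ := by positivity
    nlinarith
  refine ⟨(2 * q ^ 2 + 1) / ρ, η, by positivity, hηpos, hη1, ?_⟩
  intro A z l hA hz hl hzl hlA
  set Δ := z * (l - 1) with hΔ
  -- q^k is the size of the first gap Δ = z(l - 1); since l^a ≤ 2, every later gap lies between Δ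
  -- and 2Δ.
  obtain ⟨k, hk1, hk2⟩ := exists_nat_pow_near hzl (show (1 : ℝ) < q by linarith)
  obtain ⟨I, hI1, hI2⟩ := exists_nat_pow_near hA (show 1 < q by omega)
  have hqk : (0 : ℝ) < (q : ℝ) ^ k := by positivity
  set y : ℕ → ℝ := fun a => z * l ^ a / (q : ℝ) ^ k with hy
  have hy0 : ∀ a, 0 ≤ y a := fun a => by have : 0 < l := by linarith
                                         positivity
  have hstep : ∀ a, y a + 1 ≤ y (a + 1) := by
    intro a
    have h1 : (1 : ℝ) ≤ l ^ a := one_le_pow₀ hl.le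
    have h2 : z * l ^ a + (q : ℝ) ^ k ≤ z * l ^ (a + 1) := by
      have : z * l ^ (a + 1) = z * l ^ a + Δ * l ^ a := by rw [hΔ]; ring
      rw [this]; nlinarith
    show z * l ^ a / (q : ℝ) ^ k + 1 ≤ z * l ^ (a + 1) / (q : ℝ) ^ k
    rw [div_add_one hqk.ne']; gcongr
  have hfloor : StrictMono (fun a => ⌊y a⌋₊) := by
    refine strictMono_nat_of_lt_succ fun a => ?_
    have := Nat.floor_mono (hstep a)
    rw [Nat.floor_add_one (hy0 a)] at this
    exact this
  have hupper : ∀ a, a < A → y a ≤ y 0 + 2 * q * a := by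
    intro a
    induction a with
    | zero => simp
    | succ a ih =>
      intro ha
      have h1 := ih (by omega)
      have h2 : y (a + 1) ≤ y a + 2 * q := by
        have h3 : l ^ a ≤ 2 := hlA a (by omega)
        have : z * l ^ (a + 1) = z * l ^ a + Δ * l ^ a := by rw [hΔ]; ring
        show z * l ^ (a + 1) / (q : ℝ) ^ k ≤ z * l ^ a / (q : ℝ) ^ k + 2 * q
        rw [this, add_div]
        gcongr
        rw [div_le_iff₀ hqk]
        have h4 : Δ ≤ q * q ^ k := by rw [mul_comm, ← pow_succ]; exact hk2.le
        have h5 : 0 ≤ Δ := by linarith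
        nlinarith
      push_cast; linarith
  have hmem : ∀ a ∈ Finset.range A,
      ⌊y a⌋₊ ∈ Finset.Ico ⌊y 0⌋₊ (⌊y 0⌋₊ + (2 * q ^ 2 + 1) * q ^ I) := by
    intro a ha
    rw [Finset.mem_range] at ha
    rw [Finset.mem_Ico]
    refine ⟨hfloor.monotone (Nat.zero_le a), ?_⟩
    have h1 : (⌊y a⌋₊ : ℝ) ≤ y a := Nat.floor_le (hy0 a)
    have h2 := hupper a ha
    have h3 := Nat.lt_floor_add_one (y 0)
    have h4 : (⌊y a⌋₊ : ℝ) < ((⌊y 0⌋₊ + 1 + 2 * q * a : ℕ) : ℝ) := by push_cast; linarith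
    have h5 : ⌊y a⌋₊ < ⌊y 0⌋₊ + 1 + 2 * q * a := by exact_mod_cast h4
    have h6 : q * a ≤ q * (q ^ (I + 1)) := Nat.mul_le_mul_left _ (by omega)
    have h7 : 1 ≤ q ^ I := Nat.one_le_pow _ _ (by omega)
    have h8 : q * q ^ (I + 1) = q ^ 2 * q ^ I := by ring
    nlinarith
  have hsum : ∑ a ∈ Finset.range A, cosProd s (z * l ^ a) ≤ ((2 * q ^ 2 + 1 : ℕ) : ℝ) * T ^ I := by
    calc ∑ a ∈ Finset.range A, cosProd s (z * l ^ a)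
        ≤ ∑ a ∈ Finset.range A, blockWeight q I ⌊y a⌋₊ :=
          Finset.sum_le_sum fun a _ => cosProd_le_blockWeight hs
            (by have : 0 < l := by linarith
                positivity) k I
      _ = ∑ v ∈ (Finset.range A).image (fun a => ⌊y a⌋₊), blockWeight q I v :=
          (Finset.sum_image fun a _ b _ h => hfloor.injective h).symm
      _ ≤ ∑ v ∈ Finset.Ico ⌊y 0⌋₊ (⌊y 0⌋₊ + (2 * q ^ 2 + 1) * q ^ I), blockWeight q I v :=
          Finset.sum_le_sum_of_subset_of_nonneg (Finset.image_subset_iff.2 hmem)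
            fun _ _ _ => blockWeight_nonneg hq _ _
      _ = _ := by
          rw [sum_Ico_of_periodic (fun v => blockWeight_add_pow (by omega) I v), sum_blockWeight]
  refine hsum.trans ?_
  have hA0 : (0 : ℝ) < A := by exact_mod_cast hA
  have h1 : T ^ I = ρ ^ (I + 1) * q ^ I / ρ := by
    have e : T = ρ * q := by rw [hρ]; field_simp
    rw [e, mul_pow, pow_succ]; field_simp
  have h2 : ρ ^ (I + 1) ≤ (A : ℝ) ^ (-η) := by
    rw [← hqη, ← Real.rpow_natCast, ← Real.rpow_mul hq0.le, mul_comm, Real.rpow_mul hq0.le,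
      Real.rpow_natCast]
    refine Real.rpow_le_rpow_of_nonpos hA0 ?_ (by linarith)
    exact_mod_cast hI2.le
  have h3 : (q : ℝ) ^ I ≤ A := by exact_mod_cast hI1
  rw [h1]
  push_cast
  have h4 : ρ ^ (I + 1) * q ^ I ≤ (A : ℝ) ^ (-η) * A := by gcongr
  calc (2 * (q : ℝ) ^ 2 + 1) * (ρ ^ (I + 1) * q ^ I / ρ)
      = (2 * (q : ℝ) ^ 2 + 1) / ρ * (ρ ^ (I + 1) * q ^ I) := by ring
    _ ≤ (2 * (q : ℝ) ^ 2 + 1) / ρ * ((A : ℝ) ^ (-η) * A) := by gcongr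
    _ = _ := by ring

/-! ### Sums over blocks of arithmetic progressions -/

theorem sum_range_mul_eq {f : ℕ → ℝ} (A h : ℕ) :
    ∑ n ∈ Finset.range (A * h), f n =
      ∑ b ∈ Finset.range h, ∑ a ∈ Finset.range A, f (a * h + b) := by
  induction A with
  | zero => simp
  | succ A ih =>
    rw [add_mul, one_mul, Finset.sum_range_add, ih, ← Finset.sum_add_distrib]
    exact Finset.sum_congr rfl fun b _ => (Finset.sum_range_succ _ _).symm

/-- Beyond n₀ the range is tiled by blocks of length A h, each a union of h progressions of
difference h and length A; the terms before n₀ are bounded by 1. -/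
theorem sum_range_le_of_progressions {f : ℕ → ℝ} (h0 : ∀ n, 0 ≤ f n) (h1 : ∀ n, f n ≤ 1)
    {A h n₀ : ℕ} (hA : 1 ≤ A) (hh : 1 ≤ h) {T : ℝ}
    (hT : ∀ n, n₀ ≤ n → ∑ a ∈ Finset.range A, f (n + a * h) ≤ T) (N : ℕ) :
    ∑ n ∈ Finset.range N, f n ≤ n₀ + (N / (A * h : ℝ) + 1) * (h * T) := by
  have hT0 : 0 ≤ T := (Finset.sum_nonneg fun a _ => h0 _).trans (hT n₀ le_rfl)
  have hblock : ∀ m, n₀ ≤ m → ∑ n ∈ Finset.range (A * h), f (m + n) ≤ h * T := by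
    intro m hm
    rw [sum_range_mul_eq (f := fun n => f (m + n))]
    calc _ ≤ ∑ b ∈ Finset.range h, T := Finset.sum_le_sum fun b _ => by
          have := hT (m + b) (by omega)
          refine le_trans (le_of_eq (Finset.sum_congr rfl fun a _ => ?_)) this
          congr 1; ring
      _ = h * T := by simp
  have hU : ∀ U : ℕ, ∑ n ∈ Finset.range (n₀ + U * (A * h)), f n ≤ n₀ + U * (h * T) := by
    intro U
    induction U with
    | zero =>
      simp only [zero_mul, add_zero, Nat.cast_zero]
      calc _ ≤ ∑ n ∈ Finset.range n₀, (1 : ℝ) := Finset.sum_le_sum fun n _ => h1 n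
        _ = n₀ := by simp
    | succ U ih =>
      rw [add_mul, one_mul, ← add_assoc, Finset.sum_range_add]
      have := hblock (n₀ + U * (A * h)) (by omega)
      push_cast; linarith
  have hAh : 0 < A * h := by positivity
  have hAhR : (0 : ℝ) < (A * h : ℝ) := by exact_mod_cast hAh
  calc ∑ n ∈ Finset.range N, f n
      ≤ ∑ n ∈ Finset.range (n₀ + (N / (A * h) + 1) * (A * h)), f n := by
        refine Finset.sum_le_sum_of_subset_of_nonneg (Finset.range_subset_range.2 ?_)
          fun n _ _ => h0 n
        have := Nat.lt_div_mul_add (a := N) hAh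
        nlinarith
    _ ≤ n₀ + ((N / (A * h) + 1 : ℕ) : ℝ) * (h * T) := hU _
    _ ≤ _ := by
        have : ((N / (A * h) : ℕ) : ℝ) ≤ N / (A * h : ℝ) := by
          refine (Nat.cast_div_le).trans (le_of_eq (by push_cast; rfl))
        push_cast
        gcongr

/-! ### Existence of the constants in the cosine estimate -/

/-- Dirichlet approximation to log r / log s with denominators up to 2As gives |h log r - j log s| ≤
1/(2A), so A-th powers of the ratio stay below e^(1/2) < 2. Independence excludes ratio 1. -/
theorem exists_pow_near_pow {r s : ℕ} (hr : 2 ≤ r) (hs : 2 ≤ s) (hrs : ¬ MultDep r s) {A : ℕ}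
    (hA : 1 ≤ A) : ∃ h j : ℕ, 1 ≤ h ∧ h ≤ 2 * A * s ∧ r ^ h ≠ s ^ j ∧
      ∀ a ≤ A, ((r : ℝ) ^ h / (s : ℝ) ^ j) ^ a ≤ 2 ∧ ((s : ℝ) ^ j / (r : ℝ) ^ h) ^ a ≤ 2 := by
  have hrR : (1 : ℝ) < r := by exact_mod_cast (by omega : 1 < r)
  have hsR : (1 : ℝ) < s := by exact_mod_cast (by omega : 1 < s)
  have hlr := Real.log_pos hrR
  have hls := Real.log_pos hsR
  obtain ⟨h, hh0, hh1, hh2⟩ := Real.exists_nat_abs_mul_sub_round_le (Real.log r / Real.log s)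
    (n := 2 * A * s) (by positivity)
  set R := round ((h : ℝ) * (Real.log r / Real.log s)) with hR
  have hR0 : 0 ≤ R := by
    rw [hR, round_eq]
    exact Int.floor_nonneg.2 (by positivity)
  obtain ⟨j, hj⟩ := Int.eq_ofNat_of_zero_le hR0
  have hjR : (R : ℝ) = j := by rw [hj]; simp
  rw [hjR] at hh2
  have hAR : (1 : ℝ) ≤ A := by exact_mod_cast hA
  have hkey : |h * Real.log r - j * Real.log s| ≤ 1 / (2 * A) := by
    have h3 : h * Real.log r - j * Real.log s =
        (h * (Real.log r / Real.log s) - j) * Real.log s := by field_simp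
    rw [h3, abs_mul, abs_of_pos hls]
    have h4 : Real.log s ≤ s := (Real.log_le_sub_one_of_pos (by linarith)).trans (by linarith)
    calc _ ≤ 1 / (((2 * A * s : ℕ) : ℝ) + 1) * s := by gcongr
      _ ≤ 1 / (2 * A) := by
        rw [div_mul_eq_mul_div, div_le_div_iff₀ (by positivity) (by positivity)]
        push_cast; nlinarith
  have hbound : ∀ u : ℝ, |u| ≤ 1 / (2 * A) → ∀ a ≤ A, Real.exp u ^ a ≤ 2 := by
    intro u hu a ha
    have haR : (a : ℝ) ≤ A := by exact_mod_cast ha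
    rw [← Real.exp_nat_mul]
    have h5 : a * u ≤ 1 / 2 := by
      calc a * u ≤ A * (1 / (2 * A)) :=
            by nlinarith [le_abs_self u, neg_abs_le u, (Nat.cast_nonneg a : (0:ℝ) ≤ a), (by positivity : (0:ℝ) ≤ 1 / (2 * A))]
        _ = 1 / 2 := by field_simp
    calc Real.exp (a * u) ≤ Real.exp (1 / 2) := Real.exp_le_exp.2 h5
      _ ≤ 2 := by
        have := Real.exp_one_lt_d9
        have h6 : Real.exp (1 / 2) ^ 2 = Real.exp 1 := by rw [← Real.exp_nat_mul]; norm_num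
        nlinarith [Real.exp_pos (1 / 2)]
  have hexp1 : (r : ℝ) ^ h / (s : ℝ) ^ j = Real.exp (h * Real.log r - j * Real.log s) := by
    rw [Real.exp_sub, Real.exp_nat_mul, Real.exp_nat_mul, Real.exp_log (by linarith),
      Real.exp_log (by linarith)]
  have hexp2 : (s : ℝ) ^ j / (r : ℝ) ^ h = Real.exp (-(h * Real.log r - j * Real.log s)) := by
    rw [Real.exp_neg, ← hexp1, inv_div]
  refine ⟨h, j, hh0, hh1, fun heq => ?_, fun a ha => ⟨?_, ?_⟩⟩
  · refine hrs ⟨h, j, hh0, Nat.pos_of_ne_zero fun hj0 => ?_, heq⟩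
    rw [hj0, pow_zero] at heq
    have : 1 < r ^ h := Nat.one_lt_pow (by omega) (by omega)
    omega
  · rw [hexp1]; exact hbound _ hkey a ha
  · rw [hexp2]; exact hbound _ (by rwa [abs_neg]) a ha

theorem exists_sum_cosProd_le {r s : ℕ} (hr : 2 ≤ r) (hs : 2 ≤ s) (hrs : ¬ MultDep r s) :
    ∃ C η : ℝ, 0 < C ∧ 0 < η ∧ η ≤ 1 ∧ ∀ (N : ℕ) (x : ℝ), 1 ≤ N → 1 ≤ x →
      ∑ n ∈ Finset.range N, cosProd s ((r : ℝ) ^ n * x) ≤ C * (N : ℝ) ^ (1 - η) := by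
  obtain ⟨C, η, hC, hη, hη1, hgeo⟩ := exists_sum_cosProd_geometric_le hs
  have hrR : (2 : ℝ) ≤ r := by exact_mod_cast hr
  have hsR : (2 : ℝ) ≤ s := by exact_mod_cast hs
  refine ⟨(4 * s + C + 2 * s * C) * 8, η / 3, by positivity, by positivity, by linarith, ?_⟩
  intro N x hN hx
  -- With A about N^(1/3), a block has length A h ≤ 2sA², which is at most of order N^(2/3), while
  -- the saving A^(-η) is N^(-η/3) up to a constant.
  obtain ⟨A, hA1, hA2⟩ : ∃ A : ℕ, A ^ 3 ≤ N ∧ N < (A + 1) ^ 3 := by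
    refine ⟨Nat.nthRoot 3 N, Nat.pow_nthRoot_le (by norm_num), Nat.lt_pow_nthRoot_add_one (by norm_num) N⟩
  have hA : 1 ≤ A := by
    by_contra! h
    have : A = 0 := by omega
    subst this; simp at hA2; omega
  have hAR : (1 : ℝ) ≤ A := by exact_mod_cast hA
  obtain ⟨h, j, hh1, hh2, hne, hpow⟩ := exists_pow_near_pow hr hs hrs hA
  have hrh : (0 : ℝ) < (r : ℝ) ^ h := by positivity
  have hsj : (0 : ℝ) < (s : ℝ) ^ j := by positivity
  -- From n = h + 1 on, z ≥ 2 r^h. As r^h and s^j are distinct integers, l - 1 is at least the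
  -- reciprocal of the smaller one, which secures the first gap of at least 1.
  have hprog : ∀ n, h + 1 ≤ n →
      ∑ a ∈ Finset.range A, cosProd s ((r : ℝ) ^ (n + a * h) * x) ≤ C * A * (A : ℝ) ^ (-η) := by
    intro n hn
    set z := (r : ℝ) ^ n * x with hz
    have hz2 : 2 * (r : ℝ) ^ h ≤ z := by
      calc 2 * (r : ℝ) ^ h ≤ r * (r : ℝ) ^ h := by gcongr
        _ = (r : ℝ) ^ (h + 1) * 1 := by ring
        _ ≤ z := by rw [hz]; gcongr; linarith
    rcases lt_or_gt_of_ne hne with hlt | hgt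
    -- Here r^h < s^j, so stripping powers of s gives a decreasing progression; it is read
    -- backwards, starting from its smallest term z'.
    · set l := (s : ℝ) ^ j / (r : ℝ) ^ h with hl
      have hltR : (r : ℝ) ^ h + 1 ≤ (s : ℝ) ^ j := by exact_mod_cast hlt
      have hl1 : 1 < l := by rw [hl, one_lt_div hrh]; linarith
      have hl0 : 0 < l := by linarith
      have hlA : ∀ a ≤ A, l ^ a ≤ 2 := fun a ha => (hpow a ha).2
      set z' := z / l ^ (A - 1) with hz'
      have hz'1 : (r : ℝ) ^ h ≤ z' := by
        rw [hz', le_div_iff₀ (by positivity)]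
        have := hlA (A - 1) (by omega)
        nlinarith
      have h1 : 1 ≤ z' * (l - 1) := by
        have : l - 1 = ((s : ℝ) ^ j - (r : ℝ) ^ h) / (r : ℝ) ^ h := by rw [hl]; field_simp
        rw [this, mul_div_assoc', le_div_iff₀ hrh]
        nlinarith
      refine le_trans ?_ (hgeo A z' l hA (by linarith) hl1 h1 hlA)
      rw [← Finset.sum_range_reflect]
      refine Finset.sum_le_sum fun a ha => ?_
      rw [Finset.mem_range] at ha
      refine le_trans (le_of_eq ?_) (cosProd_pow_mul_le (by omega) (j * (A - 1 - a)) _)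
      congr 1
      rw [hz', hz, hl]
      have e : A - 1 = a + (A - 1 - a) := by omega
      set b := A - 1 - a with hb
      rw [e, div_pow, div_pow, pow_mul, pow_add, pow_mul', pow_add, pow_add]
      field_simp
    · set l := (r : ℝ) ^ h / (s : ℝ) ^ j with hl
      have hltR : (s : ℝ) ^ j + 1 ≤ (r : ℝ) ^ h := by exact_mod_cast hgt
      have hl1 : 1 < l := by rw [hl, one_lt_div hsj]; linarith
      have hlA : ∀ a ≤ A, l ^ a ≤ 2 := fun a ha => (hpow a ha).1
      have h1 : 1 ≤ z * (l - 1) := by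
        have : l - 1 = ((r : ℝ) ^ h - (s : ℝ) ^ j) / (s : ℝ) ^ j := by rw [hl]; field_simp
        rw [this, mul_div_assoc', le_div_iff₀ hsj]
        nlinarith
      refine le_trans ?_ (hgeo A z l hA (by linarith) hl1 h1 hlA)
      refine Finset.sum_le_sum fun a _ => ?_
      refine le_trans (le_of_eq ?_) (cosProd_pow_mul_le (by omega) (j * a) _)
      congr 1
      rw [hz, hl, div_pow, pow_mul, pow_add, pow_mul']
      field_simp
  have hmain := sum_range_le_of_progressions (f := fun n => cosProd s ((r : ℝ) ^ n * x))
    (fun n => cosProd_nonneg _ _) (fun n => cosProd_le_one _ _) hA hh1 hprog N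
  refine hmain.trans ?_
  set E := (A : ℝ) ^ (-η) with hE
  have hA0 : (0 : ℝ) < A := by linarith
  have hE0 : 0 < E := by positivity
  have hAE : 1 ≤ A * E := by
    have : (A : ℝ) * E = (A : ℝ) ^ (1 - η) := by
      rw [hE, sub_eq_add_neg, Real.rpow_add hA0, Real.rpow_one]
    rw [this]; exact Real.one_le_rpow hAR (by linarith)
  have hN0 : (0 : ℝ) < N := by exact_mod_cast hN
  have hA3 : (A : ℝ) ^ 3 ≤ N := by exact_mod_cast hA1
  have hh2R : (h : ℝ) ≤ 2 * A * s := by exact_mod_cast hh2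
  have hh1R : (1 : ℝ) ≤ h := by exact_mod_cast hh1
  have hEN : E ≤ 8 * (N : ℝ) ^ (-(η / 3)) := by
    have h2 : (N : ℝ) ≤ 8 * (A : ℝ) ^ 3 := by
      have h3 : (N : ℝ) ≤ ((A : ℝ) + 1) ^ 3 := by exact_mod_cast hA2.le
      have h4 : ((A : ℝ) + 1) ^ 3 ≤ (2 * A) ^ 3 := by gcongr; linarith
      nlinarith
    have h5 : (8 * (A : ℝ) ^ 3) ^ (-(η / 3)) ≤ (N : ℝ) ^ (-(η / 3)) :=
      Real.rpow_le_rpow_of_nonpos hN0 h2 (by linarith)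
    have h6 : (8 * (A : ℝ) ^ 3) ^ (-(η / 3)) = 8 ^ (-(η / 3)) * E := by
      rw [Real.mul_rpow (by norm_num) (by positivity), ← Real.rpow_natCast, ← Real.rpow_mul hA0.le,
        hE]
      congr 2; push_cast; ring
    have h7 : (8 : ℝ) ^ (-1 : ℝ) ≤ 8 ^ (-(η / 3)) :=
      Real.rpow_le_rpow_of_exponent_le (by norm_num) (by linarith)
    rw [Real.rpow_neg_one] at h7
    rw [h6] at h5
    nlinarith
  have hpowN : (N : ℝ) ^ (1 - η / 3) = N * (N : ℝ) ^ (-(η / 3)) := by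
    rw [sub_eq_add_neg, Real.rpow_add hN0, Real.rpow_one]
  have step : ((h + 1 : ℕ) : ℝ) + (N / (A * h : ℝ) + 1) * (h * (C * A * E)) ≤
      (4 * s + C + 2 * s * C) * (N * E) := by
    have e1 : (N / (A * h : ℝ)) * (h * (C * A * E)) = C * (N * E) := by
      field_simp
    have hNA : (A : ℝ) ^ 2 ≤ N := by nlinarith [sq_nonneg ((A : ℝ))]
    have e2 : (h : ℝ) * (C * A * E) ≤ 2 * s * C * (N * E) := by
      calc (h : ℝ) * (C * A * E) ≤ (2 * A * s) * (C * A * E) := by gcongr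
        _ = 2 * s * C * ((A : ℝ) ^ 2 * E) := by ring
        _ ≤ _ := by gcongr
    have e3 : ((h + 1 : ℕ) : ℝ) ≤ 4 * s * (N * E) := by
      have : (A : ℝ) ≤ N * E := by
        calc (A : ℝ) = A * 1 := by ring
          _ ≤ A * (A * E) := by gcongr
          _ = (A : ℝ) ^ 2 * E := by ring
          _ ≤ _ := by gcongr
      push_cast
      calc (h : ℝ) + 1 ≤ 4 * s * A := by nlinarith
        _ ≤ _ := by gcongr
    rw [add_mul, one_mul, e1]; linarith
  refine step.trans ?_
  rw [hpowN]
  calc (4 * s + C + 2 * s * C) * (N * E) ≤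
      (4 * s + C + 2 * s * C) * (N * (8 * (N : ℝ) ^ (-(η / 3)))) := by gcongr
    _ = _ := by ring

theorem cosine_sum_eq {r s K l N : ℕ} (hs : 2 ≤ s) :
    ∑ n ∈ Finset.range N,
        ∏' i : ℕ, |Real.cos (Real.pi * (r : ℝ) ^ n * (l : ℝ) / (s : ℝ) ^ (K + 1 + i))| =
      ∑ n ∈ Finset.range N, cosProd s ((r : ℝ) ^ n * ((l : ℝ) / (s : ℝ) ^ K)) := by
  have hs0 : (s : ℝ) ≠ 0 := by positivity
  refine Finset.sum_congr rfl fun n _ => tprod_congr fun i => ?_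
  congr 2
  rw [show K + 1 + i = K + (i + 1) by ring, pow_add]
  field_simp

/-- Half of the exponent η absorbs C once N ≥ N₀. For N ≤ N₀ the trivial bound N suffices, since a ≤
log 2 / log N₀ makes N^a ≤ 2. -/
theorem exists_isCosineConstant {r s : ℕ} (hr : 2 ≤ r) (hs : 2 ≤ s) (hrs : ¬ MultDep r s) :
    ∃ a : ℝ, IsCosineConstant r s a ∧ a < 1 / 2 := by
  obtain ⟨C, η, hC, hη, hη1, hsum⟩ := exists_sum_cosProd_le hr hs hrs
  obtain ⟨N₀, hN₀⟩ := exists_nat_ge (max 2 (C ^ (2 / η)))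
  have hN₀2 : (2 : ℝ) ≤ N₀ := (le_max_left _ _).trans hN₀
  have hN₀C : C ^ (2 / η) ≤ N₀ := (le_max_right _ _).trans hN₀
  have hlog : 0 < Real.log N₀ := Real.log_pos (by linarith)
  set a := min (min (1 / 4) (η / 2)) (Real.log 2 / Real.log N₀) with ha
  have hapos : 0 < a := lt_min (lt_min (by norm_num) (by linarith))
    (div_pos (Real.log_pos (by norm_num)) hlog)
  have ha4 : a ≤ 1 / 4 := (min_le_left _ _).trans (min_le_left _ _)
  have haη : a ≤ η / 2 := (min_le_left _ _).trans (min_le_right _ _)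
  have haN : a ≤ Real.log 2 / Real.log N₀ := min_le_right _ _
  refine ⟨a, ⟨hapos, fun K l N hK hl hsl => ?_⟩, by linarith⟩
  rw [cosine_sum_eq hs]
  rcases Nat.eq_zero_or_pos N with rfl | hN
  · simp only [Finset.range_zero, Finset.sum_empty]; positivity
  have hN1 : (1 : ℝ) ≤ N := by exact_mod_cast hN
  have hN0 : (0 : ℝ) < N := by linarith
  have hx : 1 ≤ (l : ℝ) / (s : ℝ) ^ K := by
    rw [one_le_div (by positivity)]; exact_mod_cast hsl
  rcases le_total (N₀ : ℝ) N with hNN | hNN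
  · refine (hsum N _ hN hx).trans ?_
    have h1 : C ≤ (N : ℝ) ^ (η / 2) := by
      calc C = (C ^ (2 / η)) ^ (η / 2) := by
            rw [← Real.rpow_mul hC.le]; field_simp; simp
        _ ≤ _ := Real.rpow_le_rpow (by positivity) (hN₀C.trans hNN) (by linarith)
    calc C * (N : ℝ) ^ (1 - η) ≤ (N : ℝ) ^ (η / 2) * (N : ℝ) ^ (1 - η) := by gcongr
      _ = (N : ℝ) ^ (1 - η / 2) := by rw [← Real.rpow_add hN0]; congr 1; ring
      _ ≤ (N : ℝ) ^ (1 - a) := Real.rpow_le_rpow_of_exponent_le hN1 (by linarith)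
      _ ≤ 2 * (N : ℝ) ^ (1 - a) := by
        have : 0 < (N : ℝ) ^ (1 - a) := by positivity
        linarith
  · have h1 : (N : ℝ) ^ a ≤ 2 := by
      calc (N : ℝ) ^ a ≤ (N₀ : ℝ) ^ a := Real.rpow_le_rpow hN0.le hNN hapos.le
        _ = Real.exp (Real.log N₀ * a) := Real.rpow_def_of_pos (by linarith) _
        _ ≤ Real.exp (Real.log 2) := by
          refine Real.exp_le_exp.2 ?_
          rw [le_div_iff₀ hlog] at haN; linarith
        _ = 2 := Real.exp_log (by norm_num)
    calc _ ≤ ∑ n ∈ Finset.range N, (1 : ℝ) := Finset.sum_le_sum fun n _ => cosProd_le_one _ _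
      _ = (N : ℝ) ^ a * (N : ℝ) ^ (1 - a) := by rw [← Real.rpow_add hN0]; simp
      _ ≤ _ := by gcongr

theorem exists_isCosineConstants : ∃ a : ℕ → ℕ → ℝ, IsCosineConstants a := by
  classical
  refine ⟨fun r s => if h : 2 ≤ r ∧ 2 ≤ s ∧ ¬ MultDep r s then
    (exists_isCosineConstant h.1 h.2.1 h.2.2).choose else 0, fun r s hr hs hrs => ?_⟩
  simp only [dif_pos (⟨hr, hs, hrs⟩ : 2 ≤ r ∧ 2 ≤ s ∧ ¬ MultDep r s)]
  exact (exists_isCosineConstant hr hs hrs).choose_spec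

/-! ### The repetition function and the minima of the constants -/

theorem beta_pos {a : ℕ → ℕ → ℝ} (ha : IsCosineConstants a) {r s : ℕ → ℕ}
    (hr : ∀ i, 1 ≤ i → 2 ≤ r i) (hs : ∀ i, 1 ≤ i → 2 ≤ s i) (k : ℕ) : 0 < beta a r s k := by
  unfold beta
  rw [Finset.lt_fold_min]
  refine ⟨by norm_num, fun p hp => ?_⟩
  simp only [Finset.mem_filter, Finset.mem_product, Finset.mem_Icc] at hp
  exact (ha _ _ (hr _ hp.1.1.1) (hs _ hp.1.2.1) hp.2).1.1

theorem beta_le_half (a : ℕ → ℕ → ℝ) (r s : ℕ → ℕ) (k : ℕ) : beta a r s k ≤ 1 / 2 := by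
  unfold beta
  rw [Finset.fold_min_le]
  exact Or.inl le_rfl

theorem beta_le {a : ℕ → ℕ → ℝ} {r s : ℕ → ℕ} {k i j : ℕ} (hi : 1 ≤ i) (hik : i ≤ k) (hj : 1 ≤ j)
    (hjk : j ≤ k) (h : ¬ MultDep (r i) (s j)) : beta a r s k ≤ a (r i) (s j) := by
  unfold beta
  rw [Finset.fold_min_le]
  refine Or.inr ⟨(i, j), ?_, le_rfl⟩
  simp only [Finset.mem_filter, Finset.mem_product, Finset.mem_Icc]
  exact ⟨⟨⟨hi, hik⟩, hj, hjk⟩, h⟩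

section

variable {κ : ℝ} {a : ℕ → ℕ → ℝ} {s : ℕ → ℕ}

theorem two_le_bases {i : ℕ} (hi : 1 ≤ i) : 2 ≤ bases i := by unfold bases; omega

theorem phi_spec (hκ : 0 < κ) (ha : IsCosineConstants a) (hs : IsAuxSeq s) (k : ℕ) :
    1 ≤ phi κ a bases s (k + 1) ∧
    beta a bases s 1 / ((k + 1 : ℕ) : ℝ) ^ κ ≤ beta a bases s (phi κ a bases s (k + 1)) ∧
      gam bases s (phi κ a bases s (k + 1)) ≤ gam bases s 1 * (k + 1) := by
  have hb : 0 < beta a bases s 1 := beta_pos ha (fun i => two_le_bases)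
    (fun i hi => (hs.two_lt i hi).le) 1
  rcases k with _ | k
  · simp [phi]
  · rw [phi]
    -- The value f = 1 always qualifies, so `Nat.findGreatest` never falls back on 0.
    refine Nat.findGreatest_spec (P := fun f => 1 ≤ f ∧
      beta a bases s 1 / ((k + 2 : ℕ) : ℝ) ^ κ ≤ beta a bases s f ∧
        gam bases s f ≤ gam bases s 1 * (k + 2)) (m := 1) (by omega) ⟨le_rfl, ?_, ?_⟩
    · refine div_le_self hb.le (Real.one_le_rpow ?_ hκ.le)
      push_cast; linarith [(Nat.cast_nonneg k : (0 : ℝ) ≤ k)]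
    · exact Nat.le_mul_of_pos_right _ (by omega)

theorem phi_succ_le (κ : ℝ) (a : ℕ → ℕ → ℝ) (s : ℕ → ℕ) (k : ℕ) :
    phi κ a bases s (k + 1) ≤ phi κ a bases s k + 1 := by
  rcases k with _ | k
  · simp [phi]
  · rw [phi]; exact Nat.findGreatest_le _

theorem phi_le (κ : ℝ) (a : ℕ → ℕ → ℝ) (s : ℕ → ℕ) {k : ℕ} (hk : 1 ≤ k) :
    phi κ a bases s k ≤ k := by
  induction k, hk using Nat.le_induction with
  | base => simp [phi]
  | succ k _ ih => exact (phi_succ_le κ a s k).trans (by omega)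

theorem le_phi_succ {k f : ℕ} (hf : 1 ≤ f)
    (hfk : f ≤ phi κ a bases s (k + 1) + 1)
    (h1 : beta a bases s 1 / ((k + 2 : ℕ) : ℝ) ^ κ ≤ beta a bases s f)
    (h2 : gam bases s f ≤ gam bases s 1 * (k + 2)) : f ≤ phi κ a bases s (k + 2) := by
  rw [phi]
  exact Nat.le_findGreatest hfk ⟨hf, h1, h2⟩

theorem phi_le_succ (hκ : 0 < κ) (ha : IsCosineConstants a) (hs : IsAuxSeq s) (k : ℕ) :
    phi κ a bases s (k + 1) ≤ phi κ a bases s (k + 2) := by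
  have hb : 0 < beta a bases s 1 := beta_pos ha (fun i => two_le_bases)
    (fun i hi => (hs.two_lt i hi).le) 1
  obtain ⟨h1, h2, h3⟩ := phi_spec hκ ha hs k
  refine le_phi_succ h1 (by omega) (le_trans ?_ h2) (h3.trans (by gcongr; omega))
  have : (0 : ℝ) < ((k + 1 : ℕ) : ℝ) := by positivity
  gcongr
  omega

theorem phi_mono (hκ : 0 < κ) (ha : IsCosineConstants a) (hs : IsAuxSeq s) {i j : ℕ} (hi : 1 ≤ i)
    (hij : i ≤ j) : phi κ a bases s i ≤ phi κ a bases s j := by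
  induction j, hij using Nat.le_induction with
  | base => exact le_rfl
  | succ j hj ih =>
    obtain ⟨k, rfl⟩ : ∃ k, j = k + 1 := ⟨j - 1, by omega⟩
    exact ih.trans (phi_le_succ hκ ha hs k)

theorem one_le_phi_of_one_le (hκ : 0 < κ) (ha : IsCosineConstants a) (hs : IsAuxSeq s) {k : ℕ}
    (hk : 1 ≤ k) : 1 ≤ phi κ a bases s k := by
  obtain ⟨k, rfl⟩ : ∃ j, k = j + 1 := ⟨k - 1, by omega⟩
  exact (phi_spec hκ ha hs k).1

/-- `φ` takes every value between `1` and `φ(m)` on `[1, m]`. -/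
theorem exists_phi_eq (κ : ℝ) (a : ℕ → ℕ → ℝ) (s : ℕ → ℕ) {m f : ℕ} (hm : 1 ≤ m) (hf : 1 ≤ f)
    (hfm : f ≤ phi κ a bases s m) : ∃ i, 1 ≤ i ∧ i ≤ m ∧ phi κ a bases s i = f := by
  induction m, hm using Nat.le_induction with
  | base =>
    have : phi κ a bases s 1 = 1 := by simp [phi]
    exact ⟨1, le_rfl, le_rfl, by omega⟩
  | succ m hm ih =>
    by_cases h : f ≤ phi κ a bases s m
    · obtain ⟨i, h1, h2, h3⟩ := ih h
      exact ⟨i, h1, by omega, h3⟩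
    · have := phi_succ_le κ a s m
      exact ⟨m + 1, by omega, le_rfl, by omega⟩

/-- For fixed f both constraints hold for all large k, because β_1/k^κ tends to 0 and γ_1 k to
infinity. As φ rises by at most 1 at a time, it takes every positive value, so no base is lost by
the repetition. -/
theorem exists_le_phi (hκ : 0 < κ) (ha : IsCosineConstants a) (hs : IsAuxSeq s) (f : ℕ) :
    ∃ m, 1 ≤ m ∧ f ≤ phi κ a bases s m := by
  have hβ := fun k => beta_pos ha (r := bases) (s := s) (fun i => two_le_bases)
    (fun i hi => (hs.two_lt i hi).le) k
  induction f with
  | zero => exact ⟨1, le_rfl, Nat.zero_le _⟩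
  | succ f ih =>
    obtain ⟨m, hm, hfm⟩ := ih
    have hlim : Tendsto (fun k : ℕ => beta a bases s 1 / ((k : ℕ) : ℝ) ^ κ) atTop (𝓝 0) :=
      Tendsto.const_div_atTop ((tendsto_rpow_atTop hκ).comp tendsto_natCast_atTop_atTop) _
    obtain ⟨k, hk1, hk2, hk3⟩ := ((hlim.eventually_le_const (hβ (f + 1))).and
      ((eventually_ge_atTop (m + 2)).and (eventually_ge_atTop (gam bases s (f + 1))))).exists
    obtain ⟨k, rfl⟩ : ∃ j, k = j + 2 := ⟨k - 2, by omega⟩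
    refine ⟨k + 2, by omega, le_phi_succ (by omega) ?_ hk1 ?_⟩
    · have := phi_mono (κ := κ) hκ ha hs hm (show m ≤ k + 1 by omega)
      omega
    · refine hk3.trans (Nat.le_mul_of_pos_left _ ?_)
      have : bases 1 ≤ gam bases s 1 := by simp [gam]
      have : bases 1 = 2 := rfl
      omega

theorem exists_phi_eq_of_one_le (hκ : 0 < κ) (ha : IsCosineConstants a) (hs : IsAuxSeq s) {f : ℕ}
    (hf : 1 ≤ f) : ∃ i, 1 ≤ i ∧ phi κ a bases s i = f := by
  obtain ⟨m, hm, hfm⟩ := exists_le_phi hκ ha hs f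
  obtain ⟨i, h1, _, h3⟩ := exists_phi_eq κ a s hm hf hfm
  exact ⟨i, h1, h3⟩

theorem two_le_repBases (hκ : 0 < κ) (ha : IsCosineConstants a) (hs : IsAuxSeq s) {i : ℕ}
    (hi : 1 ≤ i) : 2 ≤ repBases κ a s i :=
  two_le_bases (one_le_phi_of_one_le hκ ha hs hi)

theorem three_le_repAux (hκ : 0 < κ) (ha : IsCosineConstants a) (hs : IsAuxSeq s) {i : ℕ}
    (hi : 1 ≤ i) : 3 ≤ repAux κ a s i :=
  hs.two_lt _ (one_le_phi_of_one_le hκ ha hs hi)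

theorem repAux_le_phi_mul (hκ : 0 < κ) (ha : IsCosineConstants a) (hs : IsAuxSeq s) {i : ℕ}
    (hi : 1 ≤ i) : repAux κ a s i ≤ phi κ a bases s i * s 1 :=
  hs.le_mul _ (one_le_phi_of_one_le hκ ha hs hi)

theorem repAux_le_mul (hκ : 0 < κ) (ha : IsCosineConstants a) (hs : IsAuxSeq s) {i : ℕ}
    (hi : 1 ≤ i) : repAux κ a s i ≤ i * s 1 :=
  (repAux_le_phi_mul hκ ha hs hi).trans (Nat.mul_le_mul_right _ (phi_le κ a s hi))

/-- Repeated terms with index at most m come from original indices at most φ(m), so the new minimum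
is at least the original β at φ(m), which the definition of φ controls. -/
theorem le_beta_rep (hκ : 0 < κ) (ha : IsCosineConstants a) (hs : IsAuxSeq s) {m : ℕ}
    (hm : 1 ≤ m) :
    beta a bases s 1 / (m : ℝ) ^ κ ≤ beta a (repBases κ a s) (repAux κ a s) m := by
  obtain ⟨k, rfl⟩ : ∃ j, m = j + 1 := ⟨m - 1, by omega⟩
  refine (phi_spec hκ ha hs k).2.1.trans ?_
  conv_rhs => unfold beta
  rw [Finset.le_fold_min]
  refine ⟨beta_le_half _ _ _ _, fun p hp => ?_⟩
  simp only [Finset.mem_filter, Finset.mem_product, Finset.mem_Icc] at hp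
  exact beta_le (one_le_phi_of_one_le hκ ha hs hp.1.1.1) (phi_mono hκ ha hs hp.1.1.1 hp.1.1.2)
    (one_le_phi_of_one_le hκ ha hs hp.1.2.1) (phi_mono hκ ha hs hp.1.2.1 hp.1.2.2) hp.2

end

/-! ### The cosine constants of a large base are small -/

theorem not_multDep_two_and_three {s : ℕ} (h2 : MultDep 2 s) (h3 : MultDep 3 s) : False := by
  obtain ⟨p, q, hp, hq, h⟩ := h2
  obtain ⟨p', q', hp', hq', h'⟩ := h3
  have h1 : 2 ^ (p * q') = 3 ^ (p' * q) := by
    rw [pow_mul, h, pow_mul, h', ← pow_mul, ← pow_mul, mul_comm]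
  have h4 : Even (3 ^ (p' * q)) := by
    rw [← h1]; exact (even_two).pow_of_ne_zero (by positivity) 
  exact absurd h4 (by rw [Nat.not_even_iff_odd]; exact Odd.pow (by decide))

theorem half_le_cosProd {s : ℕ} (hs : 2 ≤ s) {y : ℝ} (hy : 0 ≤ y) (h : 4 * y ≤ (s : ℝ)) :
    1 / 2 ≤ cosProd s y := by
  refine le_tprod_of_le_prod_range (fun _ => abs_nonneg _) (fun _ => Real.abs_cos_le_one _) 0
    fun n _ => ?_
  have := half_le_prod_abs_cos hs hy 1 n (by simpa using h)
  simpa only [add_comm 1] using this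

/-- In (1) with K = 1 and l = s, the terms with 4·3^n ≤ s are at least 1/2, and there are about log
s of them: too many to allow a saving (log s)^a that is not bounded. -/
theorem log_rpow_le_of_isCosineConstant {r s : ℕ} (hr : r = 2 ∨ r = 3) (hs : 3 ≤ s) {a : ℝ}
    (h : IsCosineConstant r s a) (ha : a < 1 / 2) : Real.log s ^ a ≤ 10 := by
  obtain ⟨h0, h⟩ := h
  have hsR : (3 : ℝ) ≤ s := by exact_mod_cast hs
  have hlog1 : 0 < Real.log s := Real.log_pos (by linarith)
  set N := Nat.log 3 s with hN
  have hN1 : 3 ^ N ≤ s := Nat.pow_log_le_self 3 (by omega)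
  have hN2 : s < 3 ^ (N + 1) := Nat.lt_pow_succ_log_self (by norm_num) s
  have hNpos : 1 ≤ N := by
    by_contra! hc
    have : N = 0 := by omega
    rw [this] at hN2; omega
  have hlog : Real.log s ≤ 4 * N := by
    have h1 : Real.log s ≤ (N + 1) * Real.log 3 := by
      have : Real.log s ≤ Real.log ((3 : ℝ) ^ (N + 1)) :=
        Real.log_le_log (by linarith) (by exact_mod_cast hN2.le)
      rw [Real.log_pow] at this; exact_mod_cast this
    have h2 : Real.log 3 ≤ 2 := (Real.log_le_sub_one_of_pos (by norm_num)).trans (by norm_num)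
    have h3 : (1 : ℝ) ≤ N := by exact_mod_cast hNpos
    nlinarith
  have hNR : (1 : ℝ) ≤ N := by exact_mod_cast hNpos
  have key : (N : ℝ) ^ a ≤ 5 := by
    have hr2 : (1 : ℝ) ≤ r := by rcases hr with rfl | rfl <;> norm_num
    have hr3 : (r : ℝ) ≤ 3 := by rcases hr with rfl | rfl <;> norm_num
    have h1 := h 1 s (N - 1) one_pos (by omega) (by simp)
    rw [cosine_sum_eq (by omega)] at h1
    have h2 : ∀ n ∈ Finset.range (N - 1),
        (1 / 2 : ℝ) ≤ cosProd s ((r : ℝ) ^ n * ((s : ℝ) / (s : ℝ) ^ 1)) := by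
      intro n hn
      rw [Finset.mem_range] at hn
      rw [pow_one, div_self (by positivity), mul_one]
      refine half_le_cosProd (by omega) (by positivity) ?_
      have h3 : (r : ℝ) ^ n ≤ (3 : ℝ) ^ n := by gcongr
      have h4 : (3 : ℝ) ^ (n + 2) ≤ s := by
        have : 3 ^ (n + 2) ≤ s := (Nat.pow_le_pow_right (by norm_num) (by omega)).trans hN1
        exact_mod_cast this
      rw [pow_add] at h4
      have : (0 : ℝ) < 3 ^ n := by positivity
      linarith
    have h5 := Finset.sum_le_sum h2
    rw [Finset.sum_const, Finset.card_range, nsmul_eq_mul, Nat.cast_sub hNpos] at h5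
    have h6 : ((N - 1 : ℕ) : ℝ) ^ (1 - a) ≤ (N : ℝ) ^ (1 - a) :=
      Real.rpow_le_rpow (by positivity) (by push_cast [hNpos]; linarith) (by linarith)
    have h7 : (1 : ℝ) ≤ (N : ℝ) ^ (1 - a) := Real.one_le_rpow hNR (by linarith)
    have h8 : (N : ℝ) ^ a * (N : ℝ) ^ (1 - a) = N := by
      rw [← Real.rpow_add (by linarith)]; simp
    have h9 : (N : ℝ) ^ a * (N : ℝ) ^ (1 - a) ≤ 5 * (N : ℝ) ^ (1 - a) := by
      push_cast at h5
      linarith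
    exact le_of_mul_le_mul_right h9 (by linarith)
  calc Real.log s ^ a ≤ (4 * N) ^ a := Real.rpow_le_rpow hlog1.le hlog h0.le
    _ = 4 ^ a * (N : ℝ) ^ a := Real.mul_rpow (by norm_num) (by linarith)
    _ ≤ 2 * 5 := by
      gcongr
      calc (4 : ℝ) ^ a ≤ 4 ^ (1 / 2 : ℝ) := Real.rpow_le_rpow_of_exponent_le (by norm_num) ha.le
        _ = 2 := by rw [show (4 : ℝ) = 2 ^ (2 : ℝ) by norm_num, ← Real.rpow_mul (by norm_num)]; norm_num
    _ = 10 := by norm_num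

/-- At least one of 2 and 3 is independent of s_1. If it occurs among the first m bases, then β_m is
at most its constant with s_1 and the previous bound applies. -/
theorem log_rpow_beta_le {κ : ℝ} {a : ℕ → ℕ → ℝ} {s : ℕ → ℕ} (hκ : 0 < κ)
    (ha : IsCosineConstants a) (hs : IsAuxSeq s) {m i : ℕ} (hi : 1 ≤ i) (him : i ≤ m)
    (h : ¬ MultDep (repBases κ a s i) (repAux κ a s m)) :
    Real.log (s 1) ^ beta a (repBases κ a s) (repAux κ a s) m ≤ 10 := by
  have hs1 : 3 ≤ s 1 := hs.two_lt 1 le_rfl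
  have hsR : (3 : ℝ) ≤ s 1 := by exact_mod_cast hs1
  have hlog : 1 ≤ Real.log (s 1) := by
    rw [Real.le_log_iff_exp_le (by linarith)]
    linarith [Real.exp_one_lt_d9]
  have hphi1 : phi κ a bases s 1 = 1 := by simp [phi]
  have hAux1 : repAux κ a s 1 = s 1 := by rw [repAux, hphi1]
  have hm : 1 ≤ m := hi.trans him
  obtain ⟨f, hf, hf1, hfm, hfs⟩ : ∃ f, (f = 1 ∨ f = 2) ∧ 1 ≤ f ∧ f ≤ phi κ a bases s m ∧
      ¬ MultDep (bases f) (s 1) := by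
    by_cases h2 : MultDep 2 (s 1)
    · have h3 : ¬ MultDep 3 (s 1) := fun h3 => not_multDep_two_and_three h2 h3
      refine ⟨2, Or.inr rfl, by norm_num, ?_, h3⟩
      -- If 3 has not yet occurred, φ is 1 up to m, and the only pair available is (2, s_1),
      -- contrary to the independent pair assumed.
      by_contra! hc
      have e1 : phi κ a bases s m = 1 := by
        have := one_le_phi_of_one_le (κ := κ) hκ ha hs hm
        omega
      have e2 : phi κ a bases s i = 1 := by
        have h4 := one_le_phi_of_one_le (κ := κ) hκ ha hs hi
        have h5 := phi_mono (κ := κ) hκ ha hs hi him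
        omega
      rw [repBases, repAux, e1, e2] at h
      exact h h2
    · exact ⟨1, Or.inl rfl, le_rfl, one_le_phi_of_one_le hκ ha hs hm, h2⟩
  obtain ⟨k, hk1, hkm, hk⟩ := exists_phi_eq κ a s hm hf1 hfm
  have hb : beta a (repBases κ a s) (repAux κ a s) m ≤ a (bases f) (s 1) := by
    have := beta_le (a := a) (r := repBases κ a s) (s := repAux κ a s) hk1 hkm le_rfl hm
      (by rw [repBases, hk, hAux1]; exact hfs)
    rwa [repBases, hk, hAux1] at this
  have hc := ha (bases f) (s 1) (two_le_bases hf1) (by omega) hfs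
  refine (Real.rpow_le_rpow_of_exponent_le hlog hb).trans
    (log_rpow_le_of_isCosineConstant ?_ hs1 hc.1 hc.2)
  rcases hf with rfl | rfl
  · exact Or.inl rfl
  · exact Or.inr rfl

/-! ### Growth of `⟨m⟩` -/

theorem exists_rpow_le_exp {c ε : ℝ} (hc : 0 < c) (hε : 0 < ε) (p : ℝ) :
    ∃ C : ℝ, 0 < C ∧ ∀ x : ℝ, 1 ≤ x → x ^ p ≤ C * Real.exp (ε * x ^ c) := by
  obtain ⟨k, hk⟩ := exists_nat_ge (p / c)
  refine ⟨k.factorial / ε ^ k, by positivity, fun x hx => ?_⟩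
  have hx0 : 0 < x := by linarith
  have h1 := Real.pow_div_factorial_le_exp (ε * x ^ c) (by positivity) k
  have h2 : x ^ p ≤ (x ^ c) ^ k := by
    rw [← Real.rpow_natCast, ← Real.rpow_mul hx0.le]
    refine Real.rpow_le_rpow_of_exponent_le hx ?_
    rw [div_le_iff₀ hc] at hk; linarith
  rw [mul_pow, div_le_iff₀ (by positivity)] at h1
  rw [div_mul_eq_mul_div, le_div_iff₀ (by positivity)]
  nlinarith [show 0 < ε ^ k by positivity]

section

variable {c : ℝ}

theorem bracket_le_exp (c : ℝ) (m : ℕ) : (bracket c m : ℝ) ≤ Real.exp ((m : ℝ) ^ c) :=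
  Nat.floor_le (Real.exp_pos _).le

theorem exp_lt_bracket_add_one (c : ℝ) (m : ℕ) : Real.exp ((m : ℝ) ^ c) < bracket c m + 1 :=
  Nat.lt_floor_add_one _

theorem one_le_bracket (c : ℝ) (m : ℕ) : 1 ≤ bracket c m := by
  rw [bracket, Nat.one_le_floor_iff]
  exact Real.one_le_exp (by positivity)

theorem exp_le_two_mul_bracket (c : ℝ) (m : ℕ) : Real.exp ((m : ℝ) ^ c) ≤ 2 * bracket c m := by
  have h1 := exp_lt_bracket_add_one c m
  have h2 : (1 : ℝ) ≤ bracket c m := by exact_mod_cast one_le_bracket c m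
  linarith

theorem bracket_mono (hc : 0 < c) : Monotone (bracket c) := fun m n h =>
  Nat.floor_mono (Real.exp_le_exp.2 (Real.rpow_le_rpow (by positivity) (by exact_mod_cast h) hc.le))

/-- The length `⟨m + 1⟩ - ⟨m⟩` of a block. -/
noncomputable def gap (c : ℝ) (m : ℕ) : ℝ := (bracket c (m + 1) : ℝ) - bracket c m

theorem gap_nonneg (hc : 0 < c) (m : ℕ) : 0 ≤ gap c m := by
  have : (bracket c m : ℝ) ≤ bracket c (m + 1) := by exact_mod_cast bracket_mono hc (Nat.le_succ m)
  unfold gap; linarith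

theorem gap_eq_zero_or_one_le (hc : 0 < c) (m : ℕ) : gap c m = 0 ∨ 1 ≤ gap c m := by
  rcases (bracket_mono hc (Nat.le_succ m)).eq_or_lt with h | h
  · left; rw [gap, ← Nat.succ_eq_add_one, ← h, sub_self]
  · right
    have : (bracket c m : ℝ) + 1 ≤ bracket c (m + 1) := by exact_mod_cast h
    unfold gap; linarith

theorem rpow_succ_sub_le (hc : 0 < c) (hc1 : c < 1) {m : ℕ} (hm : 1 ≤ m) :
    ((m + 1 : ℕ) : ℝ) ^ c - (m : ℝ) ^ c ≤ (m : ℝ) ^ (c - 1) := by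
  have hm0 : (0 : ℝ) < m := by exact_mod_cast hm
  have h1 : ((m + 1 : ℕ) : ℝ) = m * (1 + 1 / m) := by push_cast; field_simp
  have h2 := rpow_one_add_le_one_add_mul_self (s := 1 / (m : ℝ))
    (by have : 0 < 1 / (m : ℝ) := by positivity
        linarith) hc.le hc1.le
  rw [h1, Real.mul_rpow hm0.le (by positivity), Real.rpow_sub_one hm0.ne']
  have h3 : 0 < (m : ℝ) ^ c := by positivity
  have h4 : (m : ℝ) ^ c * (1 + 1 / m) ^ c ≤ (m : ℝ) ^ c * (1 + c * (1 / m)) := by gcongr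
  have h5 : (m : ℝ) ^ c * (c * (1 / m)) ≤ (m : ℝ) ^ c / m := by
    rw [div_eq_mul_one_div ((m : ℝ) ^ c)]
    have : c * (1 / (m : ℝ)) ≤ 1 / m := mul_le_of_le_one_left (by positivity) hc1.le
    gcongr
  linarith

theorem le_rpow_succ_sub (hc : 0 < c) (hc1 : c < 1) (m : ℕ) :
    c / (m + 1) ≤ ((m + 1 : ℕ) : ℝ) ^ c - (m : ℝ) ^ c := by
  have hm0 : (0 : ℝ) < (m : ℝ) + 1 := by positivity
  have h1 : (m : ℝ) = ((m + 1 : ℕ) : ℝ) * (1 + -(1 / (m + 1))) := by push_cast; field_simp; ring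
  have hle : 1 / ((m : ℝ) + 1) ≤ 1 := by rw [div_le_one hm0]; linarith [(Nat.cast_nonneg m : (0:ℝ) ≤ m)]
  have h2 := rpow_one_add_le_one_add_mul_self (s := -(1 / ((m : ℝ) + 1))) (by linarith) hc.le hc1.le
  have h3 : (m : ℝ) ^ c = ((m + 1 : ℕ) : ℝ) ^ c * (1 + -(1 / ((m : ℝ) + 1))) ^ c := by
    rw [← Real.mul_rpow (by positivity) (by linarith), ← h1]
  have h4 : (1 : ℝ) ≤ ((m + 1 : ℕ) : ℝ) ^ c := Real.one_le_rpow (by push_cast; linarith [(Nat.cast_nonneg m : (0:ℝ) ≤ m)]) hc.le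
  have h5 : 0 ≤ c / ((m : ℝ) + 1) := by positivity
  have h6 : c * -(1 / ((m : ℝ) + 1)) = - (c / ((m : ℝ) + 1)) := by ring
  rw [h6] at h2
  rw [h3]
  nlinarith

/-- The increment of m^c is at most m^(c-1) ≤ 1, so exp(m^c) grows by a relative amount O(m^(c-1)).
The rounding error 1 is absorbed because m^(c-1)⟨m⟩ is bounded away from 0. -/
theorem exists_gap_le (hc : 0 < c) (hc1 : c < 1) :
    ∃ C : ℝ, 0 < C ∧ ∀ m : ℕ, 1 ≤ m → gap c m ≤ C * ((m : ℝ) ^ (c - 1) * bracket c m) := by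
  obtain ⟨C, hC, h⟩ := exists_rpow_le_exp hc one_pos (1 - c)
  refine ⟨4 + 2 * C, by positivity, fun m hm => ?_⟩
  have hm1 : (1 : ℝ) ≤ m := by exact_mod_cast hm
  have hm0 : (0 : ℝ) < m := by linarith
  set u := ((m + 1 : ℕ) : ℝ) ^ c - (m : ℝ) ^ c with hu
  have hu1 : u ≤ (m : ℝ) ^ (c - 1) := rpow_succ_sub_le hc hc1 hm
  have hw1 : (m : ℝ) ^ (c - 1) ≤ 1 := Real.rpow_le_one_of_one_le_of_nonpos hm1 (by linarith)
  have hw0 : 0 < (m : ℝ) ^ (c - 1) := by positivity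
  have hexp : Real.exp u ≤ 1 + 2 * (m : ℝ) ^ (c - 1) := by
    refine (Real.exp_le_exp.2 hu1).trans ?_
    have h8 := Real.norm_exp_sub_one_sub_id_le (x := (m : ℝ) ^ (c - 1))
      (by rwa [Real.norm_of_nonneg hw0.le])
    rw [Real.norm_of_nonneg hw0.le] at h8
    have h9 := (le_abs_self _).trans h8
    nlinarith
  have h1 : (bracket c (m + 1) : ℝ) ≤ Real.exp ((m : ℝ) ^ c) * Real.exp u := by
    rw [← Real.exp_add, hu, add_sub_cancel]; exact bracket_le_exp c (m + 1)
  have h2 := exp_le_two_mul_bracket c m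
  have h3 := exp_lt_bracket_add_one c m
  have h4 : 1 ≤ C * ((m : ℝ) ^ (c - 1) * (2 * bracket c m)) := by
    have h5 := h m hm1
    rw [one_mul] at h5
    have h6 : (m : ℝ) ^ (1 - c) * (m : ℝ) ^ (c - 1) = 1 := by
      rw [← Real.rpow_add hm0]; simp
    calc (1 : ℝ) = (m : ℝ) ^ (1 - c) * (m : ℝ) ^ (c - 1) := h6.symm
      _ ≤ (C * (2 * bracket c m)) * (m : ℝ) ^ (c - 1) := by
        gcongr
        exact h5.trans (by gcongr)
      _ = _ := by ring
  have h7 : Real.exp ((m : ℝ) ^ c) * Real.exp u ≤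
      Real.exp ((m : ℝ) ^ c) + 2 * ((m : ℝ) ^ (c - 1) * (2 * bracket c m)) := by
    calc _ ≤ Real.exp ((m : ℝ) ^ c) * (1 + 2 * (m : ℝ) ^ (c - 1)) := by gcongr
      _ = Real.exp ((m : ℝ) ^ c) + 2 * ((m : ℝ) ^ (c - 1) * Real.exp ((m : ℝ) ^ c)) := by ring
      _ ≤ _ := by gcongr
  unfold gap
  nlinarith

/-- The relative growth of exp(m^c) is at least c/(m+1), which loses far less than the factor
exp(-m^c/2) given away here. -/
theorem exists_exp_le_gap (hc : 0 < c) (hc1 : c < 1) :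
    ∃ m₀ : ℕ, 1 ≤ m₀ ∧ ∀ m : ℕ, m₀ ≤ m → Real.exp ((m : ℝ) ^ c / 2) ≤ gap c m := by
  obtain ⟨C, hC, h⟩ := exists_rpow_le_exp hc (show (0 : ℝ) < 1 / 4 by norm_num) 1
  have hlim : Tendsto (fun m : ℕ => Real.exp (1 / 4 * (m : ℝ) ^ c)) atTop atTop :=
    Real.tendsto_exp_atTop.comp (((tendsto_rpow_atTop hc).comp
      tendsto_natCast_atTop_atTop).const_mul_atTop (by norm_num))
  obtain ⟨m₀, hm₀⟩ := eventually_atTop.1 (hlim.eventually_ge_atTop (4 * C / c))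
  refine ⟨m₀ + 1, by omega, fun m hm => ?_⟩
  have hm1 : (1 : ℝ) ≤ m := by exact_mod_cast (by omega : 1 ≤ m)
  have h1 := hm₀ m (by omega)
  have h2 := h m hm1
  rw [Real.rpow_one] at h2
  have h3 := le_rpow_succ_sub hc hc1 m
  set y := (m : ℝ) ^ c with hy
  set X := Real.exp (1 / 4 * y) with hX
  have hX0 : 0 < X := Real.exp_pos _
  have hX1 : 1 ≤ X := Real.one_le_exp (by positivity)
  have e2 : Real.exp (y / 2) = X ^ 2 := by rw [hX, ← Real.exp_nat_mul]; congr 1; push_cast; ring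
  have e4 : Real.exp y = X ^ 4 := by rw [hX, ← Real.exp_nat_mul]; congr 1; push_cast; ring
  have h4 : Real.exp y * (1 + c / (m + 1)) ≤ Real.exp (((m + 1 : ℕ) : ℝ) ^ c) := by
    have : ((m + 1 : ℕ) : ℝ) ^ c = y + (((m + 1 : ℕ) : ℝ) ^ c - y) := by ring
    rw [this, Real.exp_add]
    gcongr
    have := Real.add_one_le_exp (((m + 1 : ℕ) : ℝ) ^ c - y)
    linarith
  have h5 := exp_lt_bracket_add_one c (m + 1)
  have h6 := bracket_le_exp c m
  have h7 : X ^ 2 + 1 ≤ X ^ 4 * (c / (m + 1)) := by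
    have h8 : c / (2 * C * X) ≤ c / (m + 1) := by gcongr; linarith
    have h9 : 4 * C ≤ X * c := by rwa [div_le_iff₀ hc] at h1
    calc X ^ 2 + 1 ≤ 2 * X ^ 2 := by nlinarith
      _ ≤ X ^ 4 * (c / (2 * C * X)) := by
        rw [mul_div_assoc', le_div_iff₀ (by positivity)]
        have : 0 < X ^ 3 := by positivity
        nlinarith
      _ ≤ _ := by gcongr
  rw [e2]
  rw [e4] at h4
  rw [← hy, e4] at h6
  unfold gap
  nlinarith

theorem exists_one_add_log_le (hc : 0 < c) (hc1 : c < 1) :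
    ∃ C : ℝ, 0 < C ∧ ∀ m : ℕ, 1 ≤ m → 1 ≤ gap c m → 1 + Real.log m ≤ C * Real.sqrt (gap c m) := by
  obtain ⟨m₀, _, h₀⟩ := exists_exp_le_gap hc hc1
  obtain ⟨C, hC, h⟩ := exists_rpow_le_exp hc (show (0 : ℝ) < 1 / 4 by norm_num) 1
  refine ⟨C + m₀, by positivity, fun m hm hg => ?_⟩
  have hm1 : (1 : ℝ) ≤ m := by exact_mod_cast hm
  have hlog : 1 + Real.log m ≤ m := by linarith [Real.log_le_sub_one_of_pos (show (0 : ℝ) < m by linarith)]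
  have hsq : 1 ≤ Real.sqrt (gap c m) := by rwa [Real.one_le_sqrt]
  rcases le_total m₀ m with hmm | hmm
  · have h1 := h m hm1
    rw [Real.rpow_one] at h1
    have h2 : Real.exp (1 / 4 * (m : ℝ) ^ c) ≤ Real.sqrt (gap c m) := by
      refine Real.le_sqrt_of_sq_le ?_
      rw [← Real.exp_nat_mul]
      refine le_trans (le_of_eq ?_) (h₀ m hmm)
      congr 1; push_cast; ring
    calc 1 + Real.log m ≤ C * Real.sqrt (gap c m) := hlog.trans (h1.trans (by gcongr))
      _ ≤ _ := by gcongr; linarith [(Nat.cast_nonneg m₀ : (0:ℝ) ≤ m₀)]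
  · have h3 : (m : ℝ) ≤ m₀ := by exact_mod_cast hmm
    calc 1 + Real.log m ≤ m₀ * 1 := by linarith
      _ ≤ (C + m₀) * Real.sqrt (gap c m) := by gcongr; linarith

theorem sum_add_one_mul_half_pow_le (n : ℕ) :
    ∑ u ∈ Finset.range n, ((u : ℝ) + 1) * (1 / 2) ^ u ≤ 4 := by
  have : ∑ u ∈ Finset.range n, ((u : ℝ) + 1) * (1 / 2) ^ u = 4 - (2 * n + 4) * (1 / 2) ^ n := by
    induction n with
    | zero => norm_num
    | succ n ih => rw [Finset.sum_range_succ, ih]; push_cast; ring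
  rw [this]
  have : 0 ≤ (2 * (n : ℝ) + 4) * (1 / 2) ^ n := by positivity
  linarith

/-- The tails of `∑ j e^{-⟨j⟩}` are dominated by their first term. -/
theorem exists_sum_mul_exp_neg_bracket_le (hc : 0 < c) (hc1 : c < 1) :
    ∃ C : ℝ, 0 < C ∧ ∀ m n : ℕ, 1 ≤ m →
      ∑ u ∈ Finset.range n, ((m + u : ℕ) : ℝ) * Real.exp (-(bracket c (m + u) : ℝ)) ≤
        C * (m * Real.exp (-(bracket c m : ℝ))) := by
  obtain ⟨m₀, _, h₀⟩ := exists_exp_le_gap hc hc1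
  refine ⟨4 * Real.exp m₀, by positivity, fun m n hm => ?_⟩
  -- From m₀ on, ⟨m⟩ increases by at least 1 per step; the initial steps, possibly stationary, cost
  -- at most m₀ in total.
  have hgrow : ∀ u, bracket c m + u ≤ bracket c (m + u) + m₀ := by
    intro u
    induction u with
    | zero => simp
    | succ u ih =>
      rcases le_or_gt m₀ (m + u) with h | h
      · have h1 := h₀ _ h
        have h2 : (1 : ℝ) ≤ Real.exp (((m + u : ℕ) : ℝ) ^ c / 2) := Real.one_le_exp (by positivity)
        have h3 : ((bracket c (m + u) + 1 : ℕ) : ℝ) ≤ bracket c (m + u + 1) := by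
          unfold gap at h1; push_cast; linarith
        have h4 : bracket c (m + u) + 1 ≤ bracket c (m + u + 1) := by exact_mod_cast h3
        have e : m + (u + 1) = m + u + 1 := rfl
        rw [e]; omega
      · have := bracket_mono hc (show m ≤ m + (u + 1) by omega)
        omega
  have hterm : ∀ u ∈ Finset.range n, ((m + u : ℕ) : ℝ) * Real.exp (-(bracket c (m + u) : ℝ)) ≤
      (Real.exp m₀ * (m * Real.exp (-(bracket c m : ℝ)))) * (((u : ℝ) + 1) * (1 / 2) ^ u) := by
    intro u _
    have h1 : ((bracket c m : ℝ) + u) ≤ bracket c (m + u) + m₀ := by exact_mod_cast hgrow u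
    have h2 : Real.exp (-(bracket c (m + u) : ℝ)) ≤
        Real.exp m₀ * Real.exp (-(bracket c m : ℝ)) * Real.exp (-(u : ℝ)) := by
      rw [← Real.exp_add, ← Real.exp_add]
      exact Real.exp_le_exp.2 (by linarith)
    have h3 : Real.exp (-(u : ℝ)) ≤ (1 / 2) ^ u := by
      have : Real.exp (-(u : ℝ)) = Real.exp (-1) ^ u := by rw [← Real.exp_nat_mul]; congr 1; ring
      rw [this]
      refine pow_le_pow_left₀ (Real.exp_pos _).le ?_ u
      rw [Real.exp_neg, one_div]
      gcongr
      linarith [Real.add_one_le_exp (1 : ℝ)]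
    have hm1 : (1 : ℝ) ≤ m := by exact_mod_cast hm
    have h4 : ((m + u : ℕ) : ℝ) ≤ m * (u + 1) := by
      push_cast; nlinarith [(Nat.cast_nonneg u : (0:ℝ) ≤ u)]
    calc _ ≤ (m * ((u : ℝ) + 1)) *
          (Real.exp m₀ * Real.exp (-(bracket c m : ℝ)) * (1 / 2) ^ u) := by
          gcongr
          exact h2.trans (by gcongr)
      _ = _ := by ring
  refine (Finset.sum_le_sum hterm).trans ?_
  rw [← Finset.mul_sum]
  calc _ ≤ (Real.exp m₀ * (m * Real.exp (-(bracket c m : ℝ)))) * 4 := by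
        gcongr; exact sum_add_one_mul_half_pow_le n
    _ = _ := by ring

/-! ### The integers `⟨m; R⟩` -/

theorem bracketBase_mono (hc : 0 < c) {R : ℕ} (hR : 2 ≤ R) {m n : ℕ} (h : m ≤ n) :
    bracketBase c m R ≤ bracketBase c n R := by
  have hlog : 0 < Real.log R := Real.log_pos (by exact_mod_cast (by omega : 1 < R))
  refine Nat.floor_mono ?_
  have : (bracket c m : ℝ) ≤ bracket c n := by exact_mod_cast bracket_mono hc h
  gcongr

/-- Together with `exp_lt_pow_bracketBase_succ` this puts the cut-offs of all bases at the common
scale e^⟨m⟩, so that digits in base s_m can control exponential sums in every base r_i. -/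
theorem pow_bracketBase_le {R : ℕ} (hR : 2 ≤ R) (m : ℕ) :
    (R : ℝ) ^ bracketBase c m R ≤ Real.exp (bracket c m) := by
  have hR0 : (0 : ℝ) < R := by positivity
  have hlog : 0 < Real.log R := Real.log_pos (by exact_mod_cast (by omega : 1 < R))
  have h1 : (bracketBase c m R : ℝ) ≤ bracket c m / Real.log R := Nat.floor_le (by positivity)
  rw [le_div_iff₀ hlog] at h1
  calc (R : ℝ) ^ bracketBase c m R = Real.exp (bracketBase c m R * Real.log R) := by
        rw [Real.exp_nat_mul, Real.exp_log hR0]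
    _ ≤ _ := Real.exp_le_exp.2 h1

theorem exp_lt_pow_bracketBase_succ {R : ℕ} (hR : 2 ≤ R) (m : ℕ) :
    Real.exp (bracket c m) < (R : ℝ) ^ (bracketBase c m R + 1) := by
  have hR0 : (0 : ℝ) < R := by positivity
  have hlog : 0 < Real.log R := Real.log_pos (by exact_mod_cast (by omega : 1 < R))
  have h1 : bracket c m / Real.log R < (bracketBase c m R : ℝ) + 1 := Nat.lt_floor_add_one _
  rw [div_lt_iff₀ hlog] at h1
  calc Real.exp (bracket c m) < Real.exp ((bracketBase c m R + 1 : ℕ) * Real.log R) :=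
        Real.exp_lt_exp.2 (by push_cast; linarith)
    _ = _ := by rw [Real.exp_nat_mul, Real.exp_log hR0]

/-- Uniform in R: 1/log R ≤ 2, and the rounding error 1 is at most the gap unless the gap is 0, when
the two cut-offs coincide. -/
theorem bracketBase_sub_le (hc : 0 < c) {R : ℕ} (hR : 2 ≤ R) (m : ℕ) :
    ((bracketBase c (m + 1) R - bracketBase c m R : ℕ) : ℝ) ≤ 3 * gap c m := by
  have hlog2 : Real.log 2 ≤ Real.log R := Real.log_le_log (by norm_num) (by exact_mod_cast hR)
  have hlog : 0 < Real.log R := (Real.log_pos (by norm_num)).trans_le hlog2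
  have hl2 := Real.log_two_gt_d9
  have hmono := bracketBase_mono hc hR (Nat.le_succ m)
  rw [Nat.cast_sub hmono]
  rcases gap_eq_zero_or_one_le hc m with h | h
  · have : bracketBase c (m + 1) R = bracketBase c m R := by
      unfold gap at h
      unfold bracketBase
      rw [show (bracket c (m + 1) : ℝ) = bracket c m by linarith]
    rw [Nat.succ_eq_add_one, this, h]; simp
  · have h1 : (bracketBase c (m + 1) R : ℝ) ≤ bracket c (m + 1) / Real.log R :=
      Nat.floor_le (by positivity)
    have h2 : bracket c m / Real.log R < (bracketBase c m R : ℝ) + 1 := Nat.lt_floor_add_one _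
    have h3 : (bracket c (m + 1) : ℝ) / Real.log R - bracket c m / Real.log R = gap c m / Real.log R := by
      rw [gap, sub_div]
    have h4 : gap c m / Real.log R ≤ 2 * gap c m := by
      rw [div_le_iff₀ hlog]
      nlinarith
    rw [Nat.succ_eq_add_one]
    linarith

end

/-! ### The candidate sets -/

/-- The positions of the free digits in step `m`. -/
noncomputable def digitRange (c : ℝ) (s : ℕ → ℕ) (m : ℕ) : Finset ℕ :=
  Finset.Icc (bracketBase c m (s m) + 1) (bracketBase c (m + 1) (s m) - 2)

/-- The candidate whose nonzero free digits are at the positions in `T`. -/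
noncomputable def candidate (c : ℝ) (s : ℕ → ℕ) (m : ℕ) (y : ℝ) (T : Finset ℕ) : ℝ :=
  eta c s m y + ∑ k ∈ T, 1 / (s m : ℝ) ^ k

theorem sigma_eq_image (c : ℝ) (s : ℕ → ℕ) (m : ℕ) (y : ℝ) :
    sigma c s m y = ((digitRange c s m).powerset.image (candidate c s m y) : Finset ℝ) := by
  ext x
  simp only [Finset.coe_image, Set.mem_image, Finset.mem_coe, Finset.mem_powerset]
  constructor
  · rintro ⟨d, hd, rfl⟩
    refine ⟨(digitRange c s m).filter (fun k => d k = 1), Finset.filter_subset _ _, ?_⟩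
    rw [candidate, Finset.sum_filter]
    congr 1
    refine Finset.sum_congr rfl fun k _ => ?_
    rcases hd k with h | h <;> simp [h]
  · rintro ⟨T, hT, rfl⟩
    refine ⟨fun k => if k ∈ T then 1 else 0, fun k => ?_, ?_⟩
    · by_cases h : k ∈ T <;> simp [h]
    · rw [candidate]
      congr 1
      have : ∀ k, (((if k ∈ T then 1 else 0 : ℕ) : ℝ) / (s m : ℝ) ^ k) =
          if k ∈ T then 1 / (s m : ℝ) ^ k else 0 := fun k => by split_ifs <;> simp
      simp only [this]
      rw [← Finset.sum_filter]
      congr 1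
      ext k
      simp only [Finset.mem_filter]
      exact ⟨fun h => ⟨hT h, h⟩, fun h => h.2⟩

theorem candidate_mem_sigma {c : ℝ} {s : ℕ → ℕ} {m : ℕ} (y : ℝ) {T : Finset ℕ}
    (hT : T ∈ (digitRange c s m).powerset) : candidate c s m y T ∈ sigma c s m y := by
  rw [sigma_eq_image]
  exact_mod_cast Finset.mem_image_of_mem _ hT

theorem sigma_finite (c : ℝ) (s : ℕ → ℕ) (m : ℕ) (y : ℝ) : (sigma c s m y).Finite := by
  rw [sigma_eq_image]; exact Finset.finite_toSet _

theorem sigma_nonempty (c : ℝ) (s : ℕ → ℕ) (m : ℕ) (y : ℝ) : (sigma c s m y).Nonempty :=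
  ⟨_, candidate_mem_sigma y (Finset.empty_mem_powerset _)⟩

theorem exists_isLeast_minimizers {S : Set ℝ} (hS : S.Finite) (hne : S.Nonempty) (f : ℝ → ℝ) :
    ∃ x, IsLeast {x | x ∈ S ∧ ∀ y ∈ S, f x ≤ f y} x := by
  obtain ⟨z, hz, hmin⟩ := Set.exists_min_image S f hS hne
  have hfin : {x | x ∈ S ∧ ∀ y ∈ S, f x ≤ f y}.Finite := hS.subset fun x hx => hx.1
  obtain ⟨x, hx, hle⟩ := Set.exists_min_image _ id hfin ⟨z, hz, hmin⟩
  exact ⟨x, hx, fun y hy => hle y hy⟩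

theorem exists_isRun (c : ℝ) (m₀ : ℕ → ℕ) (r s : ℕ → ℕ) : ∃ ξ, IsRun c m₀ r s ξ := by
  choose g hg using fun (m : ℕ) (y : ℝ) => exists_isLeast_minimizers (sigma_finite c s m y)
    (sigma_nonempty c s m y) (Aprime c m₀ r m)
  refine ⟨fun n => Nat.rec 0 (fun k y => g (k + 1) y) n, rfl, fun m hm => ?_⟩
  obtain ⟨k, rfl⟩ : ∃ k, m = k + 1 := ⟨m - 1, by omega⟩
  exact hg (k + 1) _

theorem IsRun.unique {c : ℝ} {m₀ : ℕ → ℕ} {r s : ℕ → ℕ} {ξ ξ' : ℕ → ℝ} (h : IsRun c m₀ r s ξ)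
    (h' : IsRun c m₀ r s ξ') : ξ' = ξ := by
  funext n
  induction n with
  | zero => rw [h.zero, h'.zero]
  | succ n ih =>
    have h1 := h.step (n + 1) (by omega)
    have h2 := h'.step (n + 1) (by omega)
    rw [Nat.add_sub_cancel] at h1 h2
    rw [ih] at h2
    exact h2.unique h1

/-! ### Convergence of the algorithm -/

theorem sum_one_div_pow_le {q : ℝ} (hq : 3 ≤ q) (a b : ℕ) :
    ∑ k ∈ Finset.Icc (a + 1) b, 1 / q ^ k ≤ 1 / 2 * (1 / q ^ a) := by
  have hq0 : 0 < q := by linarith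
  have key : ∀ n, ∑ k ∈ Finset.range n, 1 / q ^ (a + 1 + k) ≤
      1 / 2 * (1 / q ^ a) - 1 / 2 * (1 / q ^ (a + n)) := by
    intro n
    induction n with
    | zero => simp
    | succ n ih =>
      rw [Finset.sum_range_succ]
      have h1 : 1 / q ^ (a + n) = q * (1 / q ^ (a + 1 + n)) := by
        rw [show a + 1 + n = a + n + 1 by ring, pow_succ]; field_simp
      have h2 : 0 < 1 / q ^ (a + 1 + n) := by positivity
      rw [show a + (n + 1) = a + 1 + n by ring]
      nlinarith
  rw [← Finset.Ico_succ_right_eq_Icc, Finset.sum_Ico_eq_sum_range]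
  refine (key _).trans ?_
  have : 0 < 1 / q ^ (a + (Order.succ b - (a + 1))) := by positivity
  linarith

theorem le_eta {c : ℝ} {s : ℕ → ℕ} {m : ℕ} (hs : 3 ≤ s m) (y : ℝ) : y ≤ eta c s m y := by
  have : (0 : ℝ) < (s m : ℝ) ^ bracketBase c m (s m) := by positivity
  rw [eta, le_div_iff₀ this]
  exact Int.le_ceil _

theorem eta_le {c : ℝ} {s : ℕ → ℕ} {m : ℕ} (hs : 3 ≤ s m) (y : ℝ) :
    eta c s m y ≤ y + 1 / (s m : ℝ) ^ bracketBase c m (s m) := by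
  have : (0 : ℝ) < (s m : ℝ) ^ bracketBase c m (s m) := by positivity
  rw [eta, div_le_iff₀ this, add_mul, one_div_mul_cancel this.ne']
  exact (Int.ceil_lt_add_one _).le

theorem one_div_pow_bracketBase_le {c : ℝ} {R : ℕ} (hR : 2 ≤ R) (m : ℕ) :
    1 / (R : ℝ) ^ bracketBase c m R ≤ R * Real.exp (-(bracket c m : ℝ)) := by
  have h := exp_lt_pow_bracketBase_succ (c := c) hR m
  have hR0 : (0 : ℝ) < R := by positivity
  rw [Real.exp_neg, div_le_iff₀ (by positivity), mul_right_comm, ← pow_succ', ← div_eq_mul_inv,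
    one_le_div (Real.exp_pos _)]
  exact h.le

/-- Rounding up costs at most s^(-a), and the digits add at most half of that since s ≥ 3; finally
s^(-a) ≤ s e^(-⟨m⟩). -/
theorem mem_sigma_bounds {c : ℝ} {s : ℕ → ℕ} {m : ℕ} (hs : 3 ≤ s m) {x y : ℝ}
    (hx : x ∈ sigma c s m y) :
    y ≤ x ∧ x ≤ y + 3 / 2 * (s m * Real.exp (-(bracket c m : ℝ))) := by
  rw [sigma_eq_image] at hx
  simp only [Finset.coe_image, Set.mem_image, Finset.mem_coe, Finset.mem_powerset] at hx
  obtain ⟨T, hT, rfl⟩ := hx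
  have hsR : (3 : ℝ) ≤ s m := by exact_mod_cast hs
  have h1 := le_eta (c := c) hs y
  have h2 := eta_le (c := c) hs y
  have h3 := one_div_pow_bracketBase_le (c := c) (show 2 ≤ s m by omega) m
  have h4 : 0 ≤ ∑ k ∈ T, 1 / (s m : ℝ) ^ k := Finset.sum_nonneg fun k _ => by positivity
  have h5 : ∑ k ∈ T, 1 / (s m : ℝ) ^ k ≤ ∑ k ∈ digitRange c s m, 1 / (s m : ℝ) ^ k :=
    Finset.sum_le_sum_of_subset_of_nonneg hT fun k _ _ => by positivity
  have h6 := sum_one_div_pow_le hsR (bracketBase c m (s m)) (bracketBase c (m + 1) (s m) - 2)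
  rw [digitRange] at h5
  unfold candidate
  constructor <;> linarith

theorem IsRun.step_bounds {c : ℝ} {m₀ : ℕ → ℕ} {r s : ℕ → ℕ} {ξ : ℕ → ℝ} (h : IsRun c m₀ r s ξ)
    {m : ℕ} (hs : 3 ≤ s (m + 1)) : ξ m ≤ ξ (m + 1) ∧
      ξ (m + 1) ≤ ξ m + 3 / 2 * (s (m + 1) * Real.exp (-(bracket c (m + 1) : ℝ))) :=
  mem_sigma_bounds hs (h.step (m + 1) (by omega)).1.1

/-- The run increases by summable steps, and the tail is dominated by its first term. C is fixed
before s and the run, as needed for a δ depending only on c. -/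
theorem exists_run_limit {c : ℝ} (hc : 0 < c) (hc1 : c < 1) :
    ∃ C : ℝ, 0 < C ∧ ∀ (m₀ r s : ℕ → ℕ) (s₁ : ℕ) (ξ : ℕ → ℝ), IsRun c m₀ r s ξ →
      (∀ m, 1 ≤ m → 3 ≤ s m) → (∀ m, 1 ≤ m → s m ≤ m * s₁) →
      ∃ ξc : ℝ, Tendsto ξ atTop (𝓝 ξc) ∧ (∀ m, ξ m ≤ ξc) ∧
        ∀ m, ξc - ξ m ≤ C * s₁ * (((m + 1 : ℕ) : ℝ) * Real.exp (-(bracket c (m + 1) : ℝ))) := by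
  obtain ⟨C, hC, hsum⟩ := exists_sum_mul_exp_neg_bracket_le hc hc1
  refine ⟨3 / 2 * C, by positivity, fun m₀ r s s₁ ξ hξ h3 hs₁ => ?_⟩
  have hmono : Monotone ξ := monotone_nat_of_le_succ fun m => (hξ.step_bounds (h3 _ (by omega))).1
  have hdiff : ∀ m n, ξ (m + n) - ξ m ≤
      3 / 2 * C * s₁ * (((m + 1 : ℕ) : ℝ) * Real.exp (-(bracket c (m + 1) : ℝ))) := by
    intro m n
    have h1 : ξ (m + n) - ξ m ≤ 3 / 2 * s₁ * ∑ u ∈ Finset.range n,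
        ((m + 1 + u : ℕ) : ℝ) * Real.exp (-(bracket c (m + 1 + u) : ℝ)) := by
      induction n with
      | zero => simp
      | succ n ih =>
        rw [Finset.sum_range_succ]
        have h2 := (hξ.step_bounds (m := m + n) (h3 _ (by omega))).2
        have h4 : (s (m + n + 1) : ℝ) ≤ ((m + 1 + n : ℕ) : ℝ) * s₁ := by
          have := hs₁ (m + n + 1) (by omega)
          rw [show m + 1 + n = m + n + 1 by ring]
          exact_mod_cast this
        rw [show m + 1 + n = m + n + 1 by ring] at h4 ⊢
        have h5 : (s (m + n + 1) : ℝ) * Real.exp (-(bracket c (m + n + 1) : ℝ)) ≤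
            (((m + n + 1 : ℕ) : ℝ) * s₁) * Real.exp (-(bracket c (m + n + 1) : ℝ)) := by gcongr
        rw [← add_assoc]
        nlinarith
    refine h1.trans ?_
    calc _ ≤ 3 / 2 * s₁ * (C * (((m + 1 : ℕ) : ℝ) * Real.exp (-(bracket c (m + 1) : ℝ)))) := by
          gcongr
          exact hsum (m + 1) n (by omega)
      _ = _ := by ring
  have hbdd : BddAbove (Set.range ξ) := by
    refine ⟨ξ 0 + 3 / 2 * C * s₁ * (((0 + 1 : ℕ) : ℝ) * Real.exp (-(bracket c (0 + 1) : ℝ))), ?_⟩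
    rintro _ ⟨n, rfl⟩
    have := hdiff 0 n
    rw [zero_add] at this
    linarith
  have hlim := tendsto_atTop_ciSup hmono hbdd
  refine ⟨_, hlim, fun m => le_ciSup hbdd m, fun m => ?_⟩
  rw [sub_le_iff_le_add]
  refine ciSup_le fun n => ?_
  have h1 := hdiff m n
  have h2 := hmono (show n ≤ m + n by omega)
  linarith

theorem exists_mul_exp_neg_gap_lt {c : ℝ} (hc : 0 < c) (hc1 : c < 1) (X : ℝ) :
    ∃ M : ℕ, ∀ m, M ≤ m → X * (((m + 1 : ℕ) : ℝ) * Real.exp (-gap c m)) < 1 := by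
  obtain ⟨m₀, hm₀, h₀⟩ := exists_exp_le_gap hc hc1
  obtain ⟨C, hC, h⟩ := exists_rpow_le_exp hc (show (0 : ℝ) < 1 / 2 by norm_num) 2
  obtain ⟨M, hM⟩ := exists_nat_gt (2 * |X| * C)
  refine ⟨max m₀ M, fun m hm => ?_⟩
  have hm0 : m₀ ≤ m := (le_max_left _ _).trans hm
  have hmM : (M : ℝ) ≤ m := by exact_mod_cast (le_max_right _ _).trans hm
  have hm1 : (1 : ℝ) ≤ m := by exact_mod_cast hm₀.trans hm0
  have h1 := h m hm1
  have h2 := h₀ m hm0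
  rw [show (1 / 2 : ℝ) * (m : ℝ) ^ c = (m : ℝ) ^ c / 2 by ring] at h1
  have h3 : (m : ℝ) ^ (2 : ℝ) = (m : ℝ) ^ 2 := by norm_cast
  rw [h3] at h1
  have h4 : (m : ℝ) ^ 2 ≤ C * gap c m := h1.trans (by gcongr)
  have hg : 0 < gap c m := (Real.exp_pos _).trans_le h2
  have h5 : Real.exp (-gap c m) ≤ C / m ^ 2 := by
    rw [Real.exp_neg, inv_eq_one_div, div_le_div_iff₀ (Real.exp_pos _) (by positivity)]
    have := Real.add_one_le_exp (gap c m)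
    nlinarith
  calc X * (((m + 1 : ℕ) : ℝ) * Real.exp (-gap c m))
      ≤ |X| * ((2 * m) * (C / m ^ 2)) := by
        gcongr
        · exact le_abs_self X
        · push_cast; linarith
    _ = 2 * |X| * C / m := by field_simp
    _ < 1 := by rw [div_lt_one (by linarith)]; linarith

/-- Step m + 1 adds at most (3/2) s_{m+1} e^(-⟨m+1⟩) and all later steps less than e^(-⟨m+1⟩), while
the allowance is at least s_m² e^(-⟨m+1⟩). Strict increase gives s_m ≥ φ(m) + 2, and s_{m+1} ≤
(φ(m)+1) s_1, so s_m² wins as soon as φ(m) ≥ 2 s_1. -/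
theorem eventually_limit_lt {c κ : ℝ} (hc : 0 < c) (hc1 : c < 1) (hκ : 0 < κ) {a : ℕ → ℕ → ℝ}
    {s : ℕ → ℕ} (ha : IsCosineConstants a) (hs : IsAuxSeq s) {m₀ : ℕ → ℕ} {ξ : ℕ → ℝ} {ξc C : ℝ}
    (hξ : IsRun c m₀ (repBases κ a s) (repAux κ a s) ξ)
    (hC : ∀ m, ξc - ξ m ≤ C * s 1 * (((m + 1 : ℕ) : ℝ) * Real.exp (-(bracket c (m + 1) : ℝ))))
    (hmono : StrictMonoOn s (Set.Ici 1)) :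
    ∀ᶠ m : ℕ in atTop, ξc < ξ m + (repAux κ a s m : ℝ) ^
      (-(bracketBase c (m + 1) (repAux κ a s m) : ℤ) + 2) := by
  obtain ⟨M, hM⟩ := exists_mul_exp_neg_gap_lt hc hc1 (C * s 1)
  obtain ⟨M', hM'1, hM'⟩ := exists_le_phi hκ ha hs (2 * s 1)
  have hsf : ∀ f, 1 ≤ f → f + 2 ≤ s f := by
    intro f hf
    induction f, hf using Nat.le_induction with
    | base => exact hs.two_lt 1 le_rfl
    | succ f hf ih =>
      have : s f < s (f + 1) := hmono (Set.mem_Ici.2 hf) (Set.mem_Ici.2 (by omega)) (by omega)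
      omega
  filter_upwards [eventually_ge_atTop (max M M')] with m hm
  have hmM' : M' ≤ m := (le_max_right _ _).trans hm
  have hm1 : 1 ≤ m := hM'1.trans hmM'
  set f := phi κ a bases s m with hf
  have hf1 : 2 * s 1 ≤ f := hM'.trans (phi_mono hκ ha hs hM'1 hmM')
  have hS1 : f + 2 ≤ repAux κ a s m := hsf _ (one_le_phi_of_one_le hκ ha hs hm1)
  have hS2 : repAux κ a s (m + 1) ≤ (f + 1) * s 1 :=
    (repAux_le_phi_mul hκ ha hs (by omega)).trans
      (Nat.mul_le_mul_right _ (phi_succ_le κ a s m))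
  have h1 := (hξ.step_bounds (m := m) (three_le_repAux hκ ha hs (by omega))).2
  have h2 := hC (m + 1)
  have h3 := hM (m + 1) (by have := (le_max_left _ _).trans hm; omega)
  set E := Real.exp (-(bracket c (m + 1) : ℝ)) with hE
  have hE0 : 0 < E := Real.exp_pos _
  have h4 : Real.exp (-(bracket c (m + 1 + 1) : ℝ)) = Real.exp (-gap c (m + 1)) * E := by
    rw [hE, ← Real.exp_add]; congr 1; rw [gap]; ring
  rw [h4] at h2
  have hSpos : (0 : ℝ) < repAux κ a s m := by
    have : 0 < repAux κ a s m := by omega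
    exact_mod_cast this
  have h5 : E * (repAux κ a s m : ℝ) ^ 2 ≤ (repAux κ a s m : ℝ) ^
      (-(bracketBase c (m + 1) (repAux κ a s m) : ℤ) + 2) := by
    rw [zpow_add₀ hSpos.ne', zpow_neg, zpow_natCast]
    have h6 := pow_bracketBase_le (c := c) (show 2 ≤ repAux κ a s m by omega) (m + 1)
    have h7 : E ≤ ((repAux κ a s m : ℝ) ^ bracketBase c (m + 1) (repAux κ a s m))⁻¹ := by
      rw [hE, Real.exp_neg]
      exact inv_anti₀ (by positivity) h6
    exact mul_le_mul_of_nonneg_right h7 (by positivity)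
  have hS1R : (f : ℝ) + 2 ≤ repAux κ a s m := by exact_mod_cast hS1
  have hS2R : (repAux κ a s (m + 1) : ℝ) ≤ (f + 1) * s 1 := by exact_mod_cast hS2
  have hf1R : 2 * (s 1 : ℝ) ≤ f := by exact_mod_cast hf1
  have hs1R : (0 : ℝ) ≤ s 1 := Nat.cast_nonneg _
  have h8 : 3 / 2 * (repAux κ a s (m + 1) : ℝ) + 1 < (repAux κ a s m : ℝ) ^ 2 := by nlinarith
  have h9 : C * s 1 * (((m + 1 + 1 : ℕ) : ℝ) * (Real.exp (-gap c (m + 1)) * E)) < 1 * E := by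
    calc _ = (C * s 1 * (((m + 1 + 1 : ℕ) : ℝ) * Real.exp (-gap c (m + 1)))) * E := by ring
      _ < _ := by gcongr
  have h10 : (3 / 2 * (repAux κ a s (m + 1) : ℝ) + 1) * E < (repAux κ a s m : ℝ) ^ 2 * E := by gcongr
  linarith

/-! ### The additive character -/

/-- `e(y) = exp (2 π i y)`. -/
noncomputable def ee (y : ℝ) : ℂ := Complex.exp (2 * Real.pi * Complex.I * (y : ℂ))

theorem ee_eq (y : ℝ) : ee y = Complex.exp (((2 * Real.pi * y : ℝ) : ℂ) * Complex.I) := by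
  unfold ee; congr 1; push_cast; ring

theorem ee_add (x y : ℝ) : ee (x + y) = ee x * ee y := by
  unfold ee; rw [← Complex.exp_add]; congr 1; push_cast; ring

theorem ee_zero : ee 0 = 1 := by simp [ee]

theorem norm_ee (y : ℝ) : ‖ee y‖ = 1 := by rw [ee_eq]; exact Complex.norm_exp_ofReal_mul_I _

theorem conj_ee (y : ℝ) : (starRingEnd ℂ) (ee y) = ee (-y) := by
  rw [ee_eq, ee_eq, ← Complex.exp_conj, map_mul, Complex.conj_ofReal, Complex.conj_I]
  congr 1; push_cast; ring

theorem ee_sub (x y : ℝ) : ee (x - y) = ee x * (starRingEnd ℂ) (ee y) := by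
  rw [conj_ee, ← ee_add, sub_eq_add_neg]

theorem ee_nat_mul (n : ℕ) (y : ℝ) : ee (n * y) = ee y ^ n := by
  unfold ee; rw [← Complex.exp_nat_mul]; congr 1; push_cast; ring

theorem ee_int (n : ℤ) : ee n = 1 := by
  rw [ee, mul_comm]; push_cast
  rw [Complex.exp_eq_one_iff]
  exact ⟨n, by ring⟩

theorem ee_sum {ι : Type*} (T : Finset ι) (f : ι → ℝ) : ee (∑ i ∈ T, f i) = ∏ i ∈ T, ee (f i) := by
  classical
  induction T using Finset.induction_on with
  | empty => simp [ee_zero]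
  | insert a T ha ih => rw [Finset.sum_insert ha, Finset.prod_insert ha, ee_add, ih]

theorem norm_one_add_ee (y : ℝ) : ‖1 + ee y‖ = 2 * |Real.cos (Real.pi * y)| := by
  have h : 1 + ee y = ee (y / 2) * ((2 * Real.cos (Real.pi * y) : ℝ) : ℂ) := by
    have h2 : ee y = ee (y / 2) * ee (y / 2) := by rw [← ee_add]; congr 1; ring
    have h3 : ((2 * Real.cos (Real.pi * y) : ℝ) : ℂ) = ee (y / 2) + ee (-(y / 2)) := by
      push_cast
      rw [Complex.two_cos, ee, ee]
      congr 2 <;> (push_cast; ring)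
    rw [h3, mul_add, ← h2, ← ee_add, add_neg_cancel, ee_zero, add_comm]
  rw [h, norm_mul, norm_ee, one_mul, Complex.norm_real, Real.norm_eq_abs, abs_mul, abs_two]

theorem norm_ee_sub_ee_le_two (x y : ℝ) : ‖ee x - ee y‖ ≤ 2 := by
  refine (norm_sub_le _ _).trans ?_
  rw [norm_ee, norm_ee]; norm_num

theorem norm_ee_sub_ee_le (x y : ℝ) : ‖ee x - ee y‖ ≤ 2 * Real.pi * |x - y| := by
  have h : ee x - ee y = ee y * (ee (x - y) - 1) := by
    rw [mul_sub, ← ee_add, mul_one]; congr 2; ring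
  rw [h, norm_mul, norm_ee, one_mul, ee_eq, mul_comm _ Complex.I]
  refine (Real.norm_exp_I_mul_ofReal_sub_one_le).trans (le_of_eq ?_)
  rw [Real.norm_eq_abs, abs_mul, abs_of_pos (by positivity : 0 < 2 * Real.pi)]

/-! ### Mean squares over digit choices -/

theorem norm_sq_sum_ee {ι : Type*} (J : Finset ι) (w : ι → ℝ) :
    ((‖∑ j ∈ J, ee (w j)‖ ^ 2 : ℝ) : ℂ) = ∑ j ∈ J, ∑ j' ∈ J, ee (w j - w j') := by
  rw [← Complex.normSq_eq_norm_sq, ← Complex.mul_conj, map_sum, Finset.sum_mul_sum]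
  exact Finset.sum_congr rfl fun j _ => Finset.sum_congr rfl fun j' _ => (ee_sub _ _).symm

/-- The sum over digit sets is the expansion of ∏ (1 + e(θ u_k)), and |1 + e(v)| = 2|cos πv|. -/
theorem norm_sum_powerset_ee (F : Finset ℕ) (θ y : ℝ) (u : ℕ → ℝ) :
    ‖∑ T ∈ F.powerset, ee (θ * (y + ∑ k ∈ T, u k))‖ =
      2 ^ F.card * ∏ k ∈ F, |Real.cos (Real.pi * (θ * u k))| := by
  have h : ∑ T ∈ F.powerset, ee (θ * (y + ∑ k ∈ T, u k)) =
      ee (θ * y) * ∏ k ∈ F, (1 + ee (θ * u k)) := by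
    rw [Finset.prod_one_add, Finset.mul_sum]
    refine Finset.sum_congr rfl fun T _ => ?_
    rw [mul_add, ee_add, Finset.mul_sum, ee_sum]
  rw [h, norm_mul, norm_ee, one_mul, norm_prod]
  simp only [norm_one_add_ee]
  rw [Finset.prod_mul_distrib, Finset.prod_const]

theorem sum_powerset_norm_sq_le {ι : Type*} (F : Finset ℕ) (J : Finset ι) (w : ι → ℝ) (y : ℝ)
    (u : ℕ → ℝ) :
    ∑ T ∈ F.powerset, ‖∑ j ∈ J, ee (w j * (y + ∑ k ∈ T, u k))‖ ^ 2 ≤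
      2 ^ F.card * ∑ j ∈ J, ∑ j' ∈ J, ∏ k ∈ F, |Real.cos (Real.pi * ((w j - w j') * u k))| := by
  have h : ((∑ T ∈ F.powerset, ‖∑ j ∈ J, ee (w j * (y + ∑ k ∈ T, u k))‖ ^ 2 : ℝ) : ℂ) =
      ∑ j ∈ J, ∑ j' ∈ J, ∑ T ∈ F.powerset, ee ((w j - w j') * (y + ∑ k ∈ T, u k)) := by
    rw [Complex.ofReal_sum]
    simp only [norm_sq_sum_ee]
    rw [Finset.sum_comm]
    refine Finset.sum_congr rfl fun j _ => ?_
    rw [Finset.sum_comm]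
    simp only [sub_mul]
  have h0 : 0 ≤ ∑ T ∈ F.powerset, ‖∑ j ∈ J, ee (w j * (y + ∑ k ∈ T, u k))‖ ^ 2 :=
    Finset.sum_nonneg fun _ _ => by positivity
  rw [← Real.norm_of_nonneg h0, ← Complex.norm_real, h, Finset.mul_sum]
  refine (norm_sum_le _ _).trans (Finset.sum_le_sum fun j _ => ?_)
  rw [Finset.mul_sum]
  refine (norm_sum_le _ _).trans (Finset.sum_le_sum fun j' _ => ?_)
  rw [norm_sum_powerset_ee]

/-- Groups the pairs by their difference g. The diagonal is counted twice, hence an inequality. -/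
theorem sum_sum_le_of_symm {f : ℕ → ℕ → ℝ} (h0 : ∀ a b, 0 ≤ f a b) (hsymm : ∀ a b, f a b = f b a)
    (D : ℕ) : ∑ a ∈ Finset.range D, ∑ b ∈ Finset.range D, f a b ≤
      2 * ∑ g ∈ Finset.range D, ∑ n ∈ Finset.range (D - g), f (n + g) n := by
  induction D with
  | zero => simp
  | succ D ih =>
    have h1 : ∑ a ∈ Finset.range (D + 1), ∑ b ∈ Finset.range (D + 1), f a b =
        ∑ a ∈ Finset.range D, ∑ b ∈ Finset.range D, f a b +
          2 * ∑ b ∈ Finset.range D, f D b + f D D := by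
      rw [Finset.sum_range_succ]
      simp only [Finset.sum_range_succ (fun b => f _ b)]
      rw [Finset.sum_add_distrib, two_mul, Finset.sum_congr rfl fun a _ => hsymm a D]
      ring
    have h2 : ∑ g ∈ Finset.range (D + 1), ∑ n ∈ Finset.range (D + 1 - g), f (n + g) n =
        ∑ g ∈ Finset.range D, ∑ n ∈ Finset.range (D - g), f (n + g) n +
          ∑ g ∈ Finset.range (D + 1), f D (D - g) := by
      have : ∀ g ∈ Finset.range (D + 1), ∑ n ∈ Finset.range (D + 1 - g), f (n + g) n =
          ∑ n ∈ Finset.range (D - g), f (n + g) n + f D (D - g) := by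
        intro g hg
        rw [Finset.mem_range] at hg
        rw [show D + 1 - g = D - g + 1 by omega, Finset.sum_range_succ,
          show D - g + g = D by omega]
      rw [Finset.sum_congr rfl this, Finset.sum_add_distrib, Finset.sum_range_succ]
      simp
    have h3 : ∑ g ∈ Finset.range (D + 1), f D (D - g) = ∑ b ∈ Finset.range D, f D b + f D D := by
      have := Finset.sum_range_reflect (fun b => f D b) (D + 1)
      rw [← Finset.sum_range_succ, ← this]
      exact Finset.sum_congr rfl fun g _ => by simp
    rw [h1, h2, h3]
    have := h0 D D
    linarith

/-! ### Correlations of the exponentials -/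

/-- Estimate (1) requires K ≥ 1, but a_m may be 0; replacing (K, l) by (K + 1, l s) leaves l/s^K
unchanged. -/
theorem IsCosineConstant.sum_cosProd_le {r s : ℕ} (hs : 2 ≤ s) {a : ℝ} (h : IsCosineConstant r s a)
    {K l : ℕ} (hl : 0 < l) (hsl : s ^ K ≤ l) (N : ℕ) :
    ∑ n ∈ Finset.range N, cosProd s ((r : ℝ) ^ n * ((l : ℝ) / (s : ℝ) ^ K)) ≤
      2 * (N : ℝ) ^ (1 - a) := by
  have h1 := h.2 (K + 1) (l * s) N (by omega) (by positivity)
    (by rw [pow_succ]; exact Nat.mul_le_mul_right _ hsl)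
  rw [cosine_sum_eq hs] at h1
  have hs0 : (s : ℝ) ≠ 0 := by positivity
  have e : ((l * s : ℕ) : ℝ) / (s : ℝ) ^ (K + 1) = (l : ℝ) / (s : ℝ) ^ K := by
    push_cast; rw [pow_succ]; field_simp
  rwa [e] at h1

/-- The digits stop at position b - 2. The missing factors have arguments so small that their
product is at least 1/2. -/
theorem prod_abs_cos_le {s : ℕ} (hs : 2 ≤ s) {x : ℝ} (hx : 0 ≤ x) (K b : ℕ)
    (h : 4 * x ≤ (s : ℝ) ^ (b - 1)) :
    ∏ k ∈ Finset.Icc (K + 1) (b - 2), |Real.cos (Real.pi * x / (s : ℝ) ^ k)| ≤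
      2 * cosProd s (x / (s : ℝ) ^ K) := by
  have hs0 : (s : ℝ) ≠ 0 := by positivity
  have hs1 : (1 : ℝ) ≤ s := by exact_mod_cast (by omega : 1 ≤ s)
  have e : ∀ i, |Real.cos (Real.pi * (x / (s : ℝ) ^ K) / (s : ℝ) ^ (i + 1))| =
      |Real.cos (Real.pi * x / (s : ℝ) ^ (K + 1 + i))| := by
    intro i
    rw [show K + 1 + i = K + (i + 1) by ring, pow_add (s : ℝ) K]
    congr 2; field_simp
  have hprod : ∏ k ∈ Finset.Icc (K + 1) (b - 2), |Real.cos (Real.pi * x / (s : ℝ) ^ k)| =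
      ∏ i ∈ Finset.range (b - 2 - K), |Real.cos (Real.pi * x / (s : ℝ) ^ (K + 1 + i))| := by
    rw [← Finset.Ico_succ_right_eq_Icc, Finset.prod_Ico_eq_prod_range, Nat.succ_eq_succ,
      show (b - 2).succ - (K + 1) = b - 2 - K by omega]
  rw [hprod, ← div_le_iff₀' (by norm_num)]
  refine le_tprod_of_le_prod_range (fun _ => abs_nonneg _) (fun _ => Real.abs_cos_le_one _)
    (b - 2 - K) fun n hn => ?_
  obtain ⟨t, rfl⟩ := Nat.exists_eq_add_of_le hn
  simp only [e]
  rw [Finset.prod_range_add, div_eq_mul_inv]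
  refine mul_le_mul_of_nonneg_left ?_ (Finset.prod_nonneg fun _ _ => abs_nonneg _)
  have := half_le_prod_abs_cos hs hx (K + 1 + (b - 2 - K)) t
    (h.trans (pow_le_pow_right₀ hs1 (by omega)))
  simp only [← add_assoc]
  linarith

/-- The mean square of an exponential sum over the digit choices of one step. -/
theorem sum_sum_prod_abs_cos_le {R S : ℕ} (hR : 2 ≤ R) (hS : 2 ≤ S) {α : ℝ}
    (hα : IsCosineConstant R S α) (hα1 : α < 1 / 2) {t : ℤ} (ht : t ≠ 0) {p P K b : ℕ}
    (hK : S ^ K ≤ R ^ (p + 1)) :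
    ∑ j ∈ Finset.Icc (p + 1) P, ∑ j' ∈ Finset.Icc (p + 1) P,
      ∏ k ∈ Finset.Icc (K + 1) (b - 2),
        |Real.cos (Real.pi * (((R : ℝ) ^ j * t - (R : ℝ) ^ j' * t) * (1 / (S : ℝ) ^ k)))| ≤
      2 * ((P - p : ℕ) : ℝ) + 8 * ((P - p : ℕ) : ℝ) * ((P - p : ℕ) : ℝ) ^ (1 - α) +
        2 * ((P - p : ℕ) : ℝ) * (((Finset.Icc (p + 1) P).filter
          (fun j => (S : ℝ) ^ (b - 1) < 4 * ((R : ℝ) ^ j * |(t : ℝ)|))).card : ℝ) := by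
  set D := P - p with hD
  set Top := (Finset.Icc (p + 1) P).filter
    (fun j => (S : ℝ) ^ (b - 1) < 4 * ((R : ℝ) ^ j * |(t : ℝ)|)) with hTop
  set f : ℕ → ℕ → ℝ := fun n n' => ∏ k ∈ Finset.Icc (K + 1) (b - 2),
    |Real.cos (Real.pi * (((R : ℝ) ^ (p + 1 + n) * t - (R : ℝ) ^ (p + 1 + n') * t) *
      (1 / (S : ℝ) ^ k)))| with hf
  have hf0 : ∀ n n', 0 ≤ f n n' := fun n n' => Finset.prod_nonneg fun _ _ => abs_nonneg _
  have hf1 : ∀ n n', f n n' ≤ 1 := fun n n' =>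
    Finset.prod_le_one (fun _ _ => abs_nonneg _) fun _ _ => Real.abs_cos_le_one _
  have hfs : ∀ n n', f n n' = f n' n := by
    intro n n'
    refine Finset.prod_congr rfl fun k _ => ?_
    rw [← Real.cos_neg]
    congr 2; ring
  have hre : ∀ g : ℕ → ℝ, ∑ j ∈ Finset.Icc (p + 1) P, g j =
      ∑ n ∈ Finset.range D, g (p + 1 + n) := by
    intro g
    rw [← Finset.Ico_succ_right_eq_Icc, Finset.sum_Ico_eq_sum_range, Nat.succ_eq_succ,
      show P.succ - (p + 1) = D by omega]
  rw [hre]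
  simp only [hre]
  refine (sum_sum_le_of_symm hf0 hfs D).trans ?_
  have hinner : ∀ g ∈ Finset.range D, ∑ n ∈ Finset.range (D - g), f (n + g) n ≤
      (if g = 0 then (D : ℝ) else 0) + (4 * (D : ℝ) ^ (1 - α) + Top.card) := by
    intro g hg
    rw [Finset.mem_range] at hg
    have hDα : 0 ≤ (D : ℝ) ^ (1 - α) := by positivity
    split_ifs with hg0
    · subst hg0
      have : ∑ n ∈ Finset.range (D - 0), f (n + 0) n ≤ ∑ n ∈ Finset.range (D - 0), (1 : ℝ) :=
        Finset.sum_le_sum fun n _ => hf1 _ _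
      simp at this ⊢
      linarith [(Nat.cast_nonneg Top.card : (0 : ℝ) ≤ _)]
    · rw [zero_add]
      have hg1 : 1 ≤ g := by omega
      -- The difference of the frequencies at j = p+1+n+g and j' = p+1+n is ±R^n l, and l ≥ R^(p+1)
      -- ≥ S^K is what the cosine estimate asks for.
      set l : ℕ := R ^ (p + 1) * (R ^ g - 1) * t.natAbs with hl
      have hRg : 2 ≤ R ^ g := (hR.trans_eq (pow_one R).symm).trans (Nat.pow_le_pow_right (by omega) hg1)
      have htn : 1 ≤ t.natAbs := Int.natAbs_pos.2 ht
      have hl0 : R ^ (p + 1) ≤ l := by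
        rw [hl, mul_assoc]
        exact Nat.le_mul_of_pos_right _ (Nat.mul_pos (by omega) htn)
      have hlR : (l : ℝ) = (R : ℝ) ^ (p + 1) * ((R : ℝ) ^ g - 1) * |(t : ℝ)| := by
        rw [hl]; push_cast [Nat.one_le_pow g R (by omega)]
        congr 1
        rw [Nat.cast_natAbs]; push_cast; rfl
      have hterm : ∀ n ∈ Finset.range (D - g), f (n + g) n ≤
          2 * cosProd S ((R : ℝ) ^ n * ((l : ℝ) / (S : ℝ) ^ K)) +
            (if p + 1 + (n + g) ∈ Top then 1 else 0) := by
        intro n hn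
        rw [Finset.mem_range] at hn
        have hc0 := cosProd_nonneg S ((R : ℝ) ^ n * ((l : ℝ) / (S : ℝ) ^ K))
        have hfeq : f (n + g) n = ∏ k ∈ Finset.Icc (K + 1) (b - 2),
            |Real.cos (Real.pi * ((R : ℝ) ^ n * l) / (S : ℝ) ^ k)| := by
          refine Finset.prod_congr rfl fun k _ => ?_
          rw [hlR]
          rcases abs_choice (t : ℝ) with h | h <;> rw [h]
          · congr 2; ring
          · rw [← Real.cos_neg]; congr 2; ring
        split_ifs with hmem
        · linarith [hf1 (n + g) n]
        · rw [add_zero, hfeq]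
          have hnot : ¬ ((S : ℝ) ^ (b - 1) < 4 * ((R : ℝ) ^ (p + 1 + (n + g)) * |(t : ℝ)|)) := by
            intro hc
            exact hmem (Finset.mem_filter.2 ⟨Finset.mem_Icc.2 ⟨by omega, by omega⟩, hc⟩)
          have := prod_abs_cos_le hS (x := (R : ℝ) ^ n * l) (by positivity) K b (by
            refine le_trans ?_ (not_lt.1 hnot)
            rw [hlR]
            have h1 : (R : ℝ) ^ n * ((R : ℝ) ^ (p + 1) * ((R : ℝ) ^ g - 1) * |(t : ℝ)|) =
              (R : ℝ) ^ (p + 1 + (n + g)) * |(t : ℝ)| - (R : ℝ) ^ (p + 1 + n) * |(t : ℝ)| := by ring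
            rw [h1]
            have : 0 ≤ (R : ℝ) ^ (p + 1 + n) * |(t : ℝ)| := by positivity
            linarith)
          rwa [mul_div_assoc] at this
      refine (Finset.sum_le_sum hterm).trans ?_
      rw [Finset.sum_add_distrib, ← Finset.mul_sum]
      have h1 := hα.sum_cosProd_le hS (K := K) (l := l) ((by positivity : 0 < R ^ (p + 1)).trans_le hl0)
        (hK.trans hl0) (D - g)
      have h2 : ((D - g : ℕ) : ℝ) ^ (1 - α) ≤ (D : ℝ) ^ (1 - α) :=
        Real.rpow_le_rpow (by positivity) (by exact_mod_cast Nat.sub_le D g) (by linarith)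
      have h3 : ∑ n ∈ Finset.range (D - g), (if p + 1 + (n + g) ∈ Top then (1 : ℝ) else 0) ≤
          Top.card := by
        rw [← Finset.sum_filter, Finset.sum_const, nsmul_eq_mul, mul_one]
        exact_mod_cast Finset.card_le_card_of_injOn (fun n => p + 1 + (n + g))
          (fun n hn => by simpa using (Finset.mem_filter.1 hn).2)
          (fun a _ b _ hab => by simpa using hab)
      linarith
  have hsum := Finset.sum_le_sum hinner
  rw [Finset.sum_add_distrib, Finset.sum_const, Finset.card_range, nsmul_eq_mul,
    Finset.sum_ite_eq'] at hsum
  have h4 : (if 0 ∈ Finset.range D then (D : ℝ) else 0) ≤ D := by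
    split_ifs
    · exact le_rfl
    · positivity
  nlinarith

theorem natLog_two_le (x : ℕ) : (Nat.log 2 x : ℝ) ≤ 2 * Real.log x := by
  have h1 := Real.natLog_le_logb x 2
  have h0 : 0 ≤ Real.log x := Real.log_natCast_nonneg x
  have h2 := Real.log_two_gt_d9
  refine h1.trans ?_
  rw [Real.logb, Nat.cast_ofNat, div_le_iff₀ (by linarith)]
  nlinarith

/-- Both blocks end at the scale e^⟨m+1⟩, so R^P < S^(b+1). Hence 4 R^j |t| can exceed S^(b-1) only
for j within log₂(4mS²) of the top index P. -/
theorem card_filter_lt_le {c : ℝ} {R S m p : ℕ} (hR : 2 ≤ R) (hS : 2 ≤ S) {t : ℤ}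
    (htm : |(t : ℝ)| ≤ m) :
    ((Finset.Icc (p + 1) (bracketBase c (m + 1) R)).filter (fun j =>
      (S : ℝ) ^ (bracketBase c (m + 1) S - 1) < 4 * ((R : ℝ) ^ j * |(t : ℝ)|))).card ≤
      Nat.log 2 (4 * m * S ^ 2) + 1 := by
  set P := bracketBase c (m + 1) R
  set b := bracketBase c (m + 1) S with hb
  set v := Nat.log 2 (4 * m * S ^ 2)
  have hsub : (Finset.Icc (p + 1) P).filter (fun j =>
      (S : ℝ) ^ (b - 1) < 4 * ((R : ℝ) ^ j * |(t : ℝ)|)) ⊆ Finset.Icc (P - v) P := by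
    intro j hj
    rw [Finset.mem_filter, Finset.mem_Icc] at hj
    obtain ⟨⟨_, hjP⟩, hj⟩ := hj
    rw [Finset.mem_Icc]
    refine ⟨?_, hjP⟩
    have hS1 : (1 : ℝ) ≤ S := by exact_mod_cast (by omega : 1 ≤ S)
    have h1 : (R : ℝ) ^ P < (S : ℝ) ^ (b + 1) :=
      (pow_bracketBase_le hR (m + 1)).trans_lt (exp_lt_pow_bracketBase_succ hS (m + 1))
    have h2 : (S : ℝ) ^ (b + 1) ≤ (S : ℝ) ^ 2 * (S : ℝ) ^ (b - 1) := by
      rw [← pow_add]; exact pow_le_pow_right₀ hS1 (by omega)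
    have h3 : (R : ℝ) ^ P < (4 * m * (S : ℝ) ^ 2) * (R : ℝ) ^ j := by
      have h4 : (R : ℝ) ^ j * |(t : ℝ)| ≤ (R : ℝ) ^ j * m := by gcongr
      have h5 : (S : ℝ) ^ 2 * (S : ℝ) ^ (b - 1) ≤ (S : ℝ) ^ 2 * (4 * ((R : ℝ) ^ j * m)) := by
        gcongr; linarith
      nlinarith
    have h6 : R ^ P < (4 * m * S ^ 2) * R ^ j := by exact_mod_cast h3
    have h7 : R ^ (P - j) < 4 * m * S ^ 2 := by
      have e : R ^ P = R ^ (P - j) * R ^ j := by rw [← pow_add]; congr 1; omega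
      rw [e] at h6
      exact lt_of_mul_lt_mul_right h6 (Nat.zero_le _)
    have h8 : 2 ^ (P - j) ≤ 4 * m * S ^ 2 := (Nat.pow_le_pow_left hR _).trans h7.le
    have h9 : P - j ≤ v := Nat.le_log_of_pow_le (by norm_num) h8
    omega
  refine (Finset.card_le_card hsub).trans ?_
  rw [Nat.card_Icc]; omega

/-! ### Stability of block sums under a small change of the point -/

theorem sum_min_two_le (v n : ℕ) :
    ∑ u ∈ Finset.range n, min (2 : ℝ) (2 ^ v * (1 / 2) ^ u) ≤ 2 * v + 2 := by
  have h1 : ∀ k, ∑ u ∈ Finset.range (v + k), min (2 : ℝ) (2 ^ v * (1 / 2) ^ u) ≤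
      2 * v + 2 - 2 * (1 / 2) ^ k := by
    intro k
    induction k with
    | zero =>
      have : ∑ u ∈ Finset.range (v + 0), min (2 : ℝ) (2 ^ v * (1 / 2) ^ u) ≤
          ∑ u ∈ Finset.range (v + 0), (2 : ℝ) := Finset.sum_le_sum fun u _ => min_le_left _ _
      simp at this ⊢
      linarith
    | succ k ih =>
      rw [← add_assoc, Finset.sum_range_succ]
      have h2 : min (2 : ℝ) (2 ^ v * (1 / 2) ^ (v + k)) ≤ (1 / 2) ^ k := by
        refine (min_le_right _ _).trans (le_of_eq ?_)
        rw [pow_add, ← mul_assoc, ← mul_pow]; norm_num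
      rw [pow_succ]; linarith
  have h0 : ∀ u, 0 ≤ min (2 : ℝ) (2 ^ v * (1 / 2) ^ u) := fun u => by positivity
  calc _ ≤ ∑ u ∈ Finset.range (v + n), min (2 : ℝ) (2 ^ v * (1 / 2) ^ u) :=
        Finset.sum_le_sum_of_subset_of_nonneg (Finset.range_subset_range.2 (by omega))
          fun u _ _ => h0 u
    _ ≤ _ := h1 n
    _ ≤ _ := by have : (0 : ℝ) < (1 / 2) ^ n := by positivity
                linarith

/-- The sum over the block `⟨m; R⟩ < j ≤ ⟨m + 1; R⟩` of `e(R ^ j t x)`. -/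
noncomputable def blockSum (c : ℝ) (m R : ℕ) (t : ℤ) (x : ℝ) : ℂ :=
  ∑ j ∈ Finset.Icc (bracketBase c m R + 1) (bracketBase c (m + 1) R), ee ((R : ℝ) ^ j * (t : ℝ) * x)

theorem Aprime_eq (c : ℝ) (m₀ r : ℕ → ℕ) (m : ℕ) (x : ℝ) : Aprime c m₀ r m x =
    ∑ t ∈ (Finset.Icc (-(m : ℤ)) (m : ℤ)).erase 0,
      ∑ i ∈ (Finset.Icc 1 m).filter (fun i => m₀ (r i) ≤ m), ‖blockSum c m (r i) t x‖ ^ 2 := rfl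

/-- The term at distance u below the top index changes by at most 2^v/2^u, and trivially by at most
2, so essentially only v terms matter. -/
theorem norm_blockSum_sub_le {c : ℝ} {m R v : ℕ} (hR : 2 ≤ R) {t : ℤ} {x y : ℝ}
    (h : 2 * Real.pi * (|(t : ℝ)| * |x - y|) * Real.exp (bracket c (m + 1)) ≤ 2 ^ v) :
    ‖blockSum c m R t x - blockSum c m R t y‖ ≤ 2 * v + 2 := by
  set P := bracketBase c (m + 1) R with hP
  rw [blockSum, blockSum, ← Finset.sum_sub_distrib]
  refine (norm_sum_le _ _).trans ?_
  have hterm : ∀ j ∈ Finset.Icc (bracketBase c m R + 1) P,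
      ‖ee ((R : ℝ) ^ j * (t : ℝ) * x) - ee ((R : ℝ) ^ j * (t : ℝ) * y)‖ ≤
        min (2 : ℝ) (2 ^ v * (1 / 2) ^ (P - j)) := by
    intro j hj
    rw [Finset.mem_Icc] at hj
    refine le_min (norm_ee_sub_ee_le_two _ _) ((norm_ee_sub_ee_le _ _).trans ?_)
    have h1 : (R : ℝ) ^ j ≤ Real.exp (bracket c (m + 1)) * (1 / 2) ^ (P - j) := by
      have h2 : (R : ℝ) ^ j * (R : ℝ) ^ (P - j) ≤ Real.exp (bracket c (m + 1)) := by
        rw [← pow_add, show j + (P - j) = P by omega]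
        exact pow_bracketBase_le hR (m + 1)
      have h3 : (2 : ℝ) ^ (P - j) ≤ (R : ℝ) ^ (P - j) := by
        have : (2 : ℝ) ≤ R := by exact_mod_cast hR
        gcongr
      rw [one_div, inv_pow, ← div_eq_mul_inv, le_div_iff₀ (by positivity)]
      refine le_trans ?_ h2
      gcongr
    have h4 : (R : ℝ) ^ j * (t : ℝ) * x - (R : ℝ) ^ j * (t : ℝ) * y =
        (R : ℝ) ^ j * ((t : ℝ) * (x - y)) := by ring
    rw [h4, abs_mul, abs_mul, abs_of_pos (by positivity : 0 < (R : ℝ) ^ j)]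
    calc 2 * Real.pi * ((R : ℝ) ^ j * (|(t : ℝ)| * |x - y|))
        ≤ 2 * Real.pi * ((Real.exp (bracket c (m + 1)) * (1 / 2) ^ (P - j)) *
          (|(t : ℝ)| * |x - y|)) := by gcongr
      _ = (2 * Real.pi * (|(t : ℝ)| * |x - y|) * Real.exp (bracket c (m + 1))) *
          (1 / 2) ^ (P - j) := by ring
      _ ≤ _ := by gcongr
  refine (Finset.sum_le_sum hterm).trans ?_
  calc _ ≤ ∑ j ∈ Finset.range (P + 1), min (2 : ℝ) (2 ^ v * (1 / 2) ^ (P - j)) := by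
        refine Finset.sum_le_sum_of_subset_of_nonneg (fun j hj => ?_) fun j _ _ => by positivity
        rw [Finset.mem_Icc] at hj; rw [Finset.mem_range]; omega
    _ = ∑ u ∈ Finset.range (P + 1), min (2 : ℝ) (2 ^ v * (1 / 2) ^ u) := by
        rw [← Finset.sum_range_reflect]
        refine Finset.sum_congr rfl fun j hj => ?_
        rw [Finset.mem_range] at hj
        congr 3; omega
    _ ≤ _ := sum_min_two_le v _

theorem norm_blockSum_le {c : ℝ} (hc : 0 < c) {m R : ℕ} (hR : 2 ≤ R) (t : ℤ) (x : ℝ) :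
    ‖blockSum c m R t x‖ ≤ 3 * gap c m := by
  refine (norm_sum_le _ _).trans ?_
  simp only [norm_ee, Finset.sum_const, Nat.card_Icc, nsmul_eq_mul, mul_one]
  refine le_trans (le_of_eq ?_) (bracketBase_sub_le hc hR m)
  norm_cast
  omega

/-! ### The cancellation estimate -/

/-- Applied with L₁ = 1 + log m and L₂ = log s_1. If L₁ dominates, √g · g ≤ g^(2-β) as β ≤ 1/2. If
L₂ dominates, write T = T^β T^(1-β): the first factor is bounded because L₂^β ≤ 10, the second by
the trivial bound T ≤ B g. No dependence on s_1 remains. -/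
theorem mul_gap_le {A B C₁ L₁ L₂ T g β : ℝ} (hA : 1 ≤ A) (hB : 1 ≤ B) (hC₁ : 0 < C₁) (hg : 1 ≤ g)
    (hβ : 0 < β) (hβ1 : β ≤ 1 / 2) (hT : 0 ≤ T) (hL₂ : 0 ≤ L₂) (hT1 : T ≤ A * (L₁ + L₂))
    (hT2 : T ≤ B * g) (h1 : L₁ ≤ C₁ * Real.sqrt g) (h2 : L₂ ^ β ≤ 10) :
    T * g ≤ (2 * A * C₁ + 20 * A * B) * g ^ (2 - β) := by
  have hg0 : 0 < g := by linarith
  have hgβ : 0 < g ^ (2 - β) := by positivity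
  rcases le_total L₂ L₁ with h | h
  · have h3 : T ≤ 2 * A * C₁ * Real.sqrt g := by nlinarith
    have h4 : Real.sqrt g * g ≤ g ^ (2 - β) := by
      rw [Real.sqrt_eq_rpow]
      calc g ^ (1 / 2 : ℝ) * g = g ^ (1 / 2 + 1 : ℝ) := by rw [Real.rpow_add hg0, Real.rpow_one]
        _ ≤ _ := Real.rpow_le_rpow_of_exponent_le hg (by linarith)
    calc T * g ≤ 2 * A * C₁ * Real.sqrt g * g := by gcongr
      _ = 2 * A * C₁ * (Real.sqrt g * g) := by ring
      _ ≤ 2 * A * C₁ * g ^ (2 - β) := by gcongr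
      _ ≤ _ := by gcongr; linarith [show 0 ≤ 20 * A * B by positivity]
  · have h3 : T ≤ 2 * A * L₂ := by nlinarith
    have h4 : T ^ β ≤ 20 * A := by
      calc T ^ β ≤ (2 * A * L₂) ^ β := Real.rpow_le_rpow hT h3 hβ.le
        _ = (2 * A) ^ β * L₂ ^ β := Real.mul_rpow (by linarith) hL₂
        _ ≤ (2 * A) ^ (1 : ℝ) * 10 := by
          gcongr
          · linarith
          · linarith
        _ = 20 * A := by rw [Real.rpow_one]; ring
    have h5 : T ^ (1 - β) ≤ B * g ^ (1 - β) := by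
      calc T ^ (1 - β) ≤ (B * g) ^ (1 - β) := Real.rpow_le_rpow hT hT2 (by linarith)
        _ = B ^ (1 - β) * g ^ (1 - β) := Real.mul_rpow (by linarith) hg0.le
        _ ≤ B ^ (1 : ℝ) * g ^ (1 - β) := by gcongr; linarith
        _ = _ := by rw [Real.rpow_one]
    have h6 : T = T ^ β * T ^ (1 - β) := by
      rw [← Real.rpow_add_of_nonneg hT hβ.le (by linarith)]; simp
    have h7 : g ^ (1 - β) * g = g ^ (2 - β) := by
      rw [show (2 - β) = (1 - β) + 1 by ring, Real.rpow_add hg0, Real.rpow_one]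
    calc T * g = T ^ β * T ^ (1 - β) * g := by rw [← h6]
      _ ≤ (20 * A) * (B * g ^ (1 - β)) * g := by gcongr
      _ = 20 * A * B * g ^ (2 - β) := by rw [← h7]; ring
      _ ≤ _ := by gcongr; linarith [show 0 ≤ 2 * A * C₁ by positivity]

theorem sum_sum_Aprime_le {m : ℕ} {J : Finset ℕ} (hJ : J ⊆ Finset.Icc 1 m) {f : ℤ → ℕ → ℝ} {B : ℝ}
    (hB : 0 ≤ B) (h : ∀ t ∈ (Finset.Icc (-(m : ℤ)) (m : ℤ)).erase 0, ∀ i ∈ J, f t i ≤ B) :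
    ∑ t ∈ (Finset.Icc (-(m : ℤ)) (m : ℤ)).erase 0, ∑ i ∈ J, f t i ≤ 2 * (m : ℝ) ^ 2 * B := by
  have h1 : ∀ t ∈ (Finset.Icc (-(m : ℤ)) (m : ℤ)).erase 0, ∑ i ∈ J, f t i ≤ m * B := by
    intro t ht
    refine (Finset.sum_le_card_nsmul _ _ B (h t ht)).trans ?_
    rw [nsmul_eq_mul]
    gcongr
    simpa using Finset.card_le_card hJ
  refine (Finset.sum_le_card_nsmul _ _ _ h1).trans ?_
  have h2 : ((Finset.Icc (-(m : ℤ)) (m : ℤ)).erase 0).card = 2 * m := by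
    rw [Finset.card_erase_of_mem (by simp), Int.card_Icc]; omega
  rw [h2, nsmul_eq_mul]
  push_cast
  exact le_of_eq (by ring)

/-- The minimum of `A'_m` on the candidates is at most its mean. -/
theorem IsRun.two_pow_mul_Aprime_le {c : ℝ} {m₀ : ℕ → ℕ} {r s : ℕ → ℕ} {ξ : ℕ → ℝ}
    (h : IsRun c m₀ r s ξ) {m : ℕ} (hm : 1 ≤ m) :
    2 ^ (digitRange c s m).card * Aprime c m₀ r m (ξ m) ≤
      ∑ t ∈ (Finset.Icc (-(m : ℤ)) (m : ℤ)).erase 0,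
        ∑ i ∈ (Finset.Icc 1 m).filter (fun i => m₀ (r i) ≤ m),
          ∑ T ∈ (digitRange c s m).powerset,
            ‖blockSum c m (r i) t (candidate c s m (ξ (m - 1)) T)‖ ^ 2 := by
  -- The mean is over digit sets rather than over elements of `sigma`, so injectivity of `candidate`
  -- is not needed.
  have h1 := Finset.card_nsmul_le_sum (digitRange c s m).powerset
    (fun T => Aprime c m₀ r m (candidate c s m (ξ (m - 1)) T)) (Aprime c m₀ r m (ξ m))
    fun T hT => (h.step m hm).1.2 _ (candidate_mem_sigma _ hT)
  rw [Finset.card_powerset, nsmul_eq_mul] at h1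
  push_cast at h1
  refine h1.trans (le_of_eq ?_)
  simp only [Aprime_eq]
  rw [Finset.sum_comm]
  exact Finset.sum_congr rfl fun t _ => Finset.sum_comm

theorem sum_powerset_blockSum_le {c : ℝ} (hc : 0 < c) {s : ℕ → ℕ} {m R : ℕ} (hR : 2 ≤ R)
    (hS : 3 ≤ s m) {α : ℝ} (hα : IsCosineConstant R (s m) α) (hα1 : α < 1 / 2)
    {t : ℤ} (ht : t ≠ 0) (htm : |(t : ℝ)| ≤ m) (y : ℝ) :
    ∑ T ∈ (digitRange c s m).powerset, ‖blockSum c m R t (candidate c s m y T)‖ ^ 2 ≤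
      2 ^ (digitRange c s m).card * (6 * gap c m + 24 * gap c m * (3 * gap c m) ^ (1 - α) +
        6 * (gap c m * min (Nat.log 2 (4 * m * s m ^ 2) + 1 : ℝ) (3 * gap c m))) := by
  set S := s m with hSdef
  set P := bracketBase c (m + 1) R
  set p := bracketBase c m R with hp
  have hK : S ^ bracketBase c m S ≤ R ^ (p + 1) := by
    have : (S : ℝ) ^ bracketBase c m S ≤ (R : ℝ) ^ (p + 1) :=
      (pow_bracketBase_le (by omega) m).trans (exp_lt_pow_bracketBase_succ hR m).le
    exact_mod_cast this
  have h1 := sum_powerset_norm_sq_le (digitRange c s m) (Finset.Icc (p + 1) P)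
    (fun j => (R : ℝ) ^ j * (t : ℝ)) (eta c s m y) (fun k => 1 / (S : ℝ) ^ k)
  refine h1.trans ?_
  gcongr
  refine (sum_sum_prod_abs_cos_le hR (by omega : 2 ≤ S) hα hα1 ht hK).trans ?_
  have hD := bracketBase_sub_le hc hR m
  have hg := gap_nonneg hc m
  have hT1 := card_filter_lt_le (c := c) (m := m) (p := p) hR (by omega : 2 ≤ S) htm
  have hT2 := Finset.card_filter_le (Finset.Icc (p + 1) P)
    (fun j => (S : ℝ) ^ (bracketBase c (m + 1) S - 1) < 4 * ((R : ℝ) ^ j * |(t : ℝ)|))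
  rw [Nat.card_Icc, show P + 1 - (p + 1) = P - p by omega] at hT2
  set Tc := ((Finset.Icc (p + 1) P).filter
    (fun j => (S : ℝ) ^ (bracketBase c (m + 1) S - 1) < 4 * ((R : ℝ) ^ j * |(t : ℝ)|))).card
  have hT3 : (Tc : ℝ) ≤ min (Nat.log 2 (4 * m * S ^ 2) + 1 : ℝ) (3 * gap c m) := by
    refine le_min (by exact_mod_cast hT1) (le_trans (by exact_mod_cast hT2) hD)
  have hD0 : (0 : ℝ) ≤ ((P - p : ℕ) : ℝ) := Nat.cast_nonneg _
  have hD' : ((P - p : ℕ) : ℝ) ^ (1 - α) ≤ (3 * gap c m) ^ (1 - α) :=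
    Real.rpow_le_rpow hD0 hD (by linarith)
  have e1 : 8 * ((P - p : ℕ) : ℝ) * ((P - p : ℕ) : ℝ) ^ (1 - α) ≤
      8 * (3 * gap c m) * (3 * gap c m) ^ (1 - α) := by gcongr
  have e2 : 2 * ((P - p : ℕ) : ℝ) * (Tc : ℝ) ≤
      2 * (3 * gap c m) * min (Nat.log 2 (4 * m * S ^ 2) + 1 : ℝ) (3 * gap c m) := by gcongr
  linarith

set_option maxHeartbeats 1000000 in
/-- The cancellation estimate, with a constant that depends only on `c` and `C`. -/
theorem exists_Aprime_le {c : ℝ} (hc : 0 < c) (hc1 : c < 1) (C : ℝ) :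
    ∃ δ : ℝ, 0 < δ ∧ ∀ (s : ℕ → ℕ) (a : ℕ → ℕ → ℝ) (κ : ℝ) (m₀ : ℕ → ℕ) (ξ : ℕ → ℝ) (ξc : ℝ),
      IsAuxSeq s → IsCosineConstants a → 0 < κ →
      (∀ r, 2 ≤ r → ∀ m, 1 ≤ m → m₀ r ≤ m → ¬ MultDep r (repAux κ a s m)) →
      IsRun c m₀ (repBases κ a s) (repAux κ a s) ξ → (∀ m, ξ m ≤ ξc) →
      (∀ m, ξc - ξ m ≤ C * s 1 * (((m + 1 : ℕ) : ℝ) * Real.exp (-(bracket c (m + 1) : ℝ)))) →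
      ∀ m, 1 ≤ m → Aprime c m₀ (repBases κ a s) m ξc ≤
        δ * (m : ℝ) ^ 2 * gap c m ^ (2 - beta a (repBases κ a s) (repAux κ a s) m) := by
  obtain ⟨C₁, hC₁, hlog⟩ := exists_one_add_log_le hc hc1
  obtain ⟨C', hC'⟩ := exists_nat_ge (max C 1)
  have hC'C : C ≤ C' := (le_max_left _ _).trans hC'
  have hC'1 : (1 : ℝ) ≤ C' := (le_max_right _ _).trans hC'
  have hlogC' : 0 ≤ Real.log (14 * C') := Real.log_nonneg (by linarith)
  set A : ℝ := 12 + 4 * Real.log (14 * C') with hA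
  have hA1 : 1 ≤ A := by linarith
  set X : ℝ := 2 * A * C₁ + 20 * A * 6 with hX
  have hX0 : 0 < X := by positivity
  refine ⟨4 * (78 + 6 * X) + 24 * X, by positivity, ?_⟩
  intro s a κ m₀ ξ ξc hs ha hκ hm₀ hξ hle hdist m hm
  set r := repBases κ a s with hr
  set S := repAux κ a s with hS
  set β := beta a r S m with hβ
  set g := gap c m with hg
  have hr2 : ∀ i, 1 ≤ i → 2 ≤ r i := fun i hi => two_le_repBases hκ ha hs hi
  have hS3 : 3 ≤ S m := three_le_repAux hκ ha hs hm
  have hβ0 : 0 < β := beta_pos ha hr2 (fun i hi =>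
    le_trans (by norm_num) (three_le_repAux hκ ha hs hi)) m
  have hβ1 : β ≤ 1 / 2 := beta_le_half _ _ _ _
  have hm1 : (1 : ℝ) ≤ m := by exact_mod_cast hm
  rcases gap_eq_zero_or_one_le hc m with hg0 | hg1
  · have hz : ∀ i, 1 ≤ i → ∀ t, ‖blockSum c m (r i) t ξc‖ ^ 2 ≤ 0 := by
      intro i hi t
      have := norm_blockSum_le hc (m := m) (hr2 i hi) t ξc
      rw [hg0, mul_zero] at this
      rw [le_antisymm this (norm_nonneg _)]; norm_num
    rw [Aprime_eq]
    refine (sum_sum_Aprime_le (Finset.filter_subset _ _) le_rfl (B := 0) fun t _ i hi => ?_).trans ?_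
    · exact hz i (Finset.mem_Icc.1 (Finset.mem_filter.1 hi).1).1 t
    · rw [hg, hg0]; simp only [mul_zero]; positivity
  rw [← hg] at hg1
  have hg0 : 0 < g := by linarith
  have hs1 : 3 ≤ s 1 := hs.two_lt 1 le_rfl
  have hs1R : (3 : ℝ) ≤ s 1 := by exact_mod_cast hs1
  have hL2 : 0 ≤ Real.log (s 1) := Real.log_natCast_nonneg _
  have hLm : 0 ≤ Real.log m := Real.log_natCast_nonneg _
  have hSm : S m ≤ m * s 1 := repAux_le_mul hκ ha hs hm
  set L₁ : ℝ := 1 + Real.log m with hL₁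
  set L₂ : ℝ := Real.log (s 1) with hL₂
  have hlog1 : L₁ ≤ C₁ * Real.sqrt g := hlog m hm hg1
  have hgg : g ≤ g ^ (2 - β) := by
    calc g = g ^ (1 : ℝ) := (Real.rpow_one g).symm
      _ ≤ _ := Real.rpow_le_rpow_of_exponent_le hg1 (by linarith)
  set G := g ^ (2 - β) with hG
  have hG0 : 0 < G := by positivity
  set J := (Finset.Icc 1 m).filter (fun i => m₀ (r i) ≤ m) with hJ
  have hJm : J ⊆ Finset.Icc 1 m := Finset.filter_subset _ _
  have hindep : ∀ i ∈ J, ¬ MultDep (r i) (S m) := by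
    intro i hi
    have := Finset.mem_filter.1 hi
    exact hm₀ _ (hr2 i (Finset.mem_Icc.1 this.1).1) m hm this.2
  -- A member i of J supplies the independent pair that `log_rpow_beta_le` requires. T stands for
  -- the exceptional count and, later, for the change of a block sum.
  have hkey : ∀ i ∈ J, ∀ T : ℝ, 0 ≤ T → T ≤ A * (L₁ + L₂) → T ≤ 6 * g → T * g ≤ X * G := by
    intro i hi T hT hT1 hT2
    have hi' := Finset.mem_Icc.1 (hJm hi)
    have h2 : L₂ ^ β ≤ 10 := log_rpow_beta_le hκ ha hs hi'.1 hi'.2 (hindep i hi)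
    exact mul_gap_le hA1 (by norm_num) hC₁ hg1 hβ0 hβ1 hT hL2 hT1 hT2 hlog1 h2
  have ht : ∀ t ∈ (Finset.Icc (-(m : ℤ)) (m : ℤ)).erase 0, t ≠ 0 ∧ |(t : ℝ)| ≤ m := by
    intro t ht
    rw [Finset.mem_erase, Finset.mem_Icc] at ht
    refine ⟨ht.1, abs_le.2 ⟨?_, ?_⟩⟩
    · exact_mod_cast ht.2.1
    · exact_mod_cast ht.2.2
  -- the mean over the candidates
  have hmean : Aprime c m₀ r m (ξ m) ≤ 2 * (m : ℝ) ^ 2 * ((78 + 6 * X) * G) := by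
    have h1 := hξ.two_pow_mul_Aprime_le hm
    have h2 : ∀ t ∈ (Finset.Icc (-(m : ℤ)) (m : ℤ)).erase 0, ∀ i ∈ J,
        ∑ T ∈ (digitRange c S m).powerset,
          ‖blockSum c m (r i) t (candidate c S m (ξ (m - 1)) T)‖ ^ 2 ≤
        2 ^ (digitRange c S m).card * ((78 + 6 * X) * G) := by
      intro t htt i hi
      have hi' := Finset.mem_Icc.1 (hJm hi)
      have hα := ha (r i) (S m) (hr2 i hi'.1) (by omega) (hindep i hi)
      have hβα : β ≤ a (r i) (S m) := beta_le hi'.1 hi'.2 hm le_rfl (hindep i hi)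
      refine (sum_powerset_blockSum_le hc (hr2 i hi'.1) hS3 hα.1 hα.2 (ht t htt).1 (ht t htt).2
        _).trans ?_
      gcongr
      rw [← hg]
      set T : ℝ := min (Nat.log 2 (4 * m * S m ^ 2) + 1 : ℝ) (3 * g) with hT
      have hT0 : 0 ≤ T := le_min (by positivity) (by positivity)
      have hTA : T ≤ A * (L₁ + L₂) := by
        refine (min_le_left _ _).trans ?_
        have h3 := natLog_two_le (4 * m * S m ^ 2)
        have h4 : Real.log ((4 * m * S m ^ 2 : ℕ) : ℝ) ≤ 2 + 3 * Real.log m + 2 * L₂ := by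
          have h5 : ((4 * m * S m ^ 2 : ℕ) : ℝ) ≤ 4 * (m : ℝ) ^ 3 * (s 1 : ℝ) ^ 2 := by
            have h6 : 4 * m * S m ^ 2 ≤ 4 * m * (m * s 1) ^ 2 := by gcongr
            calc ((4 * m * S m ^ 2 : ℕ) : ℝ) ≤ ((4 * m * (m * s 1) ^ 2 : ℕ) : ℝ) := by
                  exact_mod_cast h6
              _ = _ := by push_cast; ring
          have hSpos : 0 < S m := by omega
          have h7 := Real.log_le_log (by positivity) h5
          rw [Real.log_mul (by positivity) (by positivity), Real.log_mul (by norm_num)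
            (by positivity), Real.log_pow, Real.log_pow] at h7
          have h8 : Real.log 4 ≤ 2 := by
            rw [show (4 : ℝ) = 2 ^ 2 by norm_num, Real.log_pow]
            have := Real.log_two_lt_d9
            push_cast; linarith
          push_cast at h7 ⊢
          linarith
        nlinarith
      have hTX := hkey i hi T hT0 hTA ((min_le_right _ _).trans (by linarith))
      have hpow : (3 * g) ^ (1 - a (r i) (S m)) * g ≤ 3 * G := by
        have h9 : (3 * g) ^ (1 - a (r i) (S m)) ≤ 3 * g ^ (1 - β) := by
          calc (3 * g) ^ (1 - a (r i) (S m)) ≤ (3 * g) ^ (1 - β) :=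
                Real.rpow_le_rpow_of_exponent_le (by linarith) (by linarith)
            _ = 3 ^ (1 - β) * g ^ (1 - β) := Real.mul_rpow (by norm_num) hg0.le
            _ ≤ 3 ^ (1 : ℝ) * g ^ (1 - β) := by gcongr <;> linarith
            _ = _ := by rw [Real.rpow_one]
        have h10 : g ^ (1 - β) * g = G := by
          rw [hG, show (2 - β) = (1 - β) + 1 by ring, Real.rpow_add hg0, Real.rpow_one]
        calc _ ≤ 3 * g ^ (1 - β) * g := by gcongr
          _ = _ := by rw [← h10]; ring
      nlinarith
    have h3 := h1.trans (sum_sum_Aprime_le hJm (by positivity) h2)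
    have h4 : (0 : ℝ) < 2 ^ (digitRange c S m).card := by positivity
    refine le_of_mul_le_mul_left (h3.trans (le_of_eq (by ring))) h4
  -- the passage to the limit
  have hdiff : ∀ t ∈ (Finset.Icc (-(m : ℤ)) (m : ℤ)).erase 0, ∀ i ∈ J,
      ‖blockSum c m (r i) t ξc - blockSum c m (r i) t (ξ m)‖ ^ 2 ≤ 6 * X * G := by
    intro t htt i hi
    have hi' := Finset.mem_Icc.1 (hJm hi)
    set T := ‖blockSum c m (r i) t ξc - blockSum c m (r i) t (ξ m)‖ with hT
    have hT0 : 0 ≤ T := norm_nonneg _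
    have hT6 : T ≤ 6 * g := by
      refine (norm_sub_le _ _).trans ?_
      have h1 := norm_blockSum_le hc (m := m) (hr2 i hi'.1) t ξc
      have h2 := norm_blockSum_le hc (m := m) (hr2 i hi'.1) t (ξ m)
      rw [← hg] at h1 h2
      linarith
    have hTA : T ≤ A * (L₁ + L₂) := by
      -- W bounds 2π |t| |ξ_c - ξ_m| e^⟨m+1⟩, using π ≤ 3.5, |t| ≤ m and m + 1 ≤ 2m; 14 = 2 · 3.5 ·
      -- 2.
      set W : ℕ := 14 * C' * m * m * s 1 with hW
      set v := Nat.log 2 W + 1 with hv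
      have hWv : (W : ℝ) ≤ 2 ^ v := by
        exact_mod_cast (Nat.lt_pow_succ_log_self (by norm_num) W).le
      have habs : |ξc - ξ m| ≤ C * s 1 * (((m + 1 : ℕ) : ℝ) * Real.exp (-(bracket c (m + 1) : ℝ))) := by
        rw [abs_of_nonneg (by linarith [hle m])]; exact hdist m
      have h1 : 2 * Real.pi * (|(t : ℝ)| * |ξc - ξ m|) * Real.exp (bracket c (m + 1)) ≤ 2 ^ v := by
        refine le_trans ?_ hWv
        calc 2 * Real.pi * (|(t : ℝ)| * |ξc - ξ m|) * Real.exp (bracket c (m + 1))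
            ≤ 2 * (3.5) * (m * (C' * s 1 * ((2 * m) *
              Real.exp (-(bracket c (m + 1) : ℝ))))) * Real.exp (bracket c (m + 1)) := by
              gcongr
              · linarith [Real.pi_lt_d2]
              · exact (ht t htt).2
              · refine habs.trans ?_
                gcongr
                push_cast; linarith
          _ = 14 * C' * m * m * s 1 * (Real.exp (-(bracket c (m + 1) : ℝ)) *
              Real.exp (bracket c (m + 1))) := by ring
          _ = W := by rw [← Real.exp_add, neg_add_cancel, Real.exp_zero, hW]; push_cast; ring
      have h2 := norm_blockSum_sub_le (c := c) (m := m) (hr2 i hi'.1) h1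
      have h3 := natLog_two_le W
      have h4 : Real.log W = Real.log (14 * C') + Real.log m + Real.log m + L₂ := by
        rw [hW]; push_cast
        rw [Real.log_mul (by positivity) (by positivity), Real.log_mul (by positivity)
          (by positivity), Real.log_mul (by positivity) (by positivity)]
      refine h2.trans ?_
      rw [hv]; push_cast
      rw [h4] at h3
      have h5 : A * (L₁ + L₂) = 12 + 12 * Real.log m + 12 * L₂ + 4 * Real.log (14 * C') +
          4 * (Real.log (14 * C') * Real.log m) + 4 * (Real.log (14 * C') * L₂) := by
        rw [hA, hL₁]; ring
      have h6 := mul_nonneg hlogC' hLm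
      have h7 := mul_nonneg hlogC' hL2
      rw [h5]; linarith
    have := hkey i hi T hT0 hTA hT6
    nlinarith
  have hstep : Aprime c m₀ r m ξc ≤ 2 * Aprime c m₀ r m (ξ m) +
      2 * ∑ t ∈ (Finset.Icc (-(m : ℤ)) (m : ℤ)).erase 0, ∑ i ∈ J,
        ‖blockSum c m (r i) t ξc - blockSum c m (r i) t (ξ m)‖ ^ 2 := by
    rw [Aprime_eq, Aprime_eq, Finset.mul_sum, Finset.mul_sum, ← Finset.sum_add_distrib]
    refine Finset.sum_le_sum fun t _ => ?_
    rw [Finset.mul_sum, Finset.mul_sum, ← Finset.sum_add_distrib]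
    refine Finset.sum_le_sum fun i _ => ?_
    set u := blockSum c m (r i) t ξc
    set w := blockSum c m (r i) t (ξ m)
    have h1 : ‖u‖ ≤ ‖w‖ + ‖u - w‖ := by
      calc ‖u‖ = ‖w + (u - w)‖ := by congr 1; ring
        _ ≤ _ := norm_add_le _ _
    have h2 : ‖u‖ ^ 2 ≤ (‖w‖ + ‖u - w‖) ^ 2 := by gcongr
    nlinarith [sq_nonneg (‖w‖ - ‖u - w‖)]
  have h5 := sum_sum_Aprime_le hJm (by positivity) hdiff
  calc Aprime c m₀ r m ξc ≤ 2 * (2 * (m : ℝ) ^ 2 * ((78 + 6 * X) * G)) +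
        2 * (2 * (m : ℝ) ^ 2 * (6 * X * G)) := by linarith
    _ = _ := by ring

/-! ### A power of the Fejér kernel and an upper bound for the number of points in an interval -/

theorem ee_eq_one_iff (y : ℝ) : ee y = 1 ↔ ∃ n : ℤ, y = n := by
  constructor
  · intro h
    rw [ee, Complex.exp_eq_one_iff] at h
    obtain ⟨n, hn⟩ := h
    refine ⟨n, ?_⟩
    have h2 : (2 * Real.pi * Complex.I : ℂ) ≠ 0 := Complex.two_pi_I_ne_zero
    have h3 : (y : ℂ) = n := mul_left_cancel₀ h2 (by rw [hn]; ring)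
    exact_mod_cast h3
  · rintro ⟨n, rfl⟩; exact ee_int n

theorem ee_add_int (y : ℝ) (n : ℤ) : ee (y + n) = ee y := by rw [ee_add, ee_int, mul_one]

theorem four_mul_abs_le_norm_ee_sub_one {y : ℝ} (hy : |y| ≤ 1 / 2) : 4 * |y| ≤ ‖ee y - 1‖ := by
  have h1 : ‖ee y - 1‖ = 2 * |Real.sin (Real.pi * y)| := by
    have h2 : ee (y + 1 / 2) = - ee y := by
      rw [ee_add]
      have : ee (1 / 2) = -1 := by
        rw [ee_eq, show (2 * Real.pi * (1 / 2) : ℝ) = Real.pi by ring, Complex.exp_pi_mul_I]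
      rw [this]; ring
    have h3 := norm_one_add_ee (y + 1 / 2)
    rw [h2, show Real.pi * (y + 1 / 2) = Real.pi * y + Real.pi / 2 by ring,
      Real.cos_add_pi_div_two, abs_neg] at h3
    rw [← h3, ← norm_neg]; congr 1; ring
  have h4 : 2 * |y| ≤ |Real.sin (Real.pi * y)| := by
    have hpi := Real.pi_pos
    have h5 := Real.mul_le_sin (x := Real.pi * |y|) (by positivity) (by nlinarith)
    have h6 : 2 / Real.pi * (Real.pi * |y|) = 2 * |y| := by field_simp
    rw [h6] at h5
    refine h5.trans ?_
    rcases abs_cases y with ⟨h, _⟩ | ⟨h, _⟩ <;> rw [h]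
    · exact le_abs_self _
    · rw [mul_neg, Real.sin_neg]; exact neg_le_abs _
  rw [h1]; linarith

/-- The `P`-th power of `n` times the Fejér kernel. -/
noncomputable def fejerPow (n P : ℕ) (y : ℝ) : ℝ := ‖(∑ j ∈ Finset.range n, ee y ^ j) ^ P‖ ^ 2

/-- The number of pairs of `P`-tuples of integers below `n` with equal sums. -/
def energy (n P : ℕ) : ℕ :=
  ((Finset.univ : Finset ((Fin P → Fin n) × (Fin P → Fin n))).filter
    (fun f => ∑ i, (f.1 i : ℕ) = ∑ i, (f.2 i : ℕ))).card

theorem fejerPow_nonneg (n P : ℕ) (y : ℝ) : 0 ≤ fejerPow n P y := by unfold fejerPow; positivity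

theorem fejerPow_add_int (n P : ℕ) (y : ℝ) (k : ℤ) : fejerPow n P (y + k) = fejerPow n P y := by
  rw [fejerPow, ee_add_int, fejerPow]

theorem fejerPow_zero (n P : ℕ) : fejerPow n P 0 = (n : ℝ) ^ (2 * P) := by
  rw [fejerPow, ee_zero]; simp [← pow_mul, mul_comm]

theorem fejerPow_eq (n P : ℕ) (y : ℝ) : (fejerPow n P y : ℂ) =
    ∑ f : (Fin P → Fin n) × (Fin P → Fin n),
      ee (((∑ i, (f.1 i : ℕ) : ℕ) - (∑ i, (f.2 i : ℕ) : ℕ) : ℤ) * y) := by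
  have h : (∑ j ∈ Finset.range n, ee y ^ j) ^ P =
      ∑ f : Fin P → Fin n, ee ((∑ i, (f i : ℕ) : ℕ) * y) := by
    rw [Finset.sum_range, Fintype.sum_pow]
    refine Finset.sum_congr rfl fun f _ => ?_
    rw [ee_nat_mul, Finset.prod_pow_eq_pow_sum]
  rw [fejerPow, h, norm_sq_sum_ee, Fintype.sum_prod_type]
  refine Finset.sum_congr rfl fun f _ => Finset.sum_congr rfl fun f' _ => ?_
  congr 1; push_cast; ring

theorem fejerPow_le {n P : ℕ} {y w : ℝ} (hw : 0 < w) (hy : |y| ≤ 1 / 2) (hwy : w < |y|) :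
    fejerPow n P y ≤ (1 / (2 * w)) ^ (2 * P) := by
  have h4 := four_mul_abs_le_norm_ee_sub_one hy
  have hpos : 0 < ‖ee y - 1‖ := by linarith
  have h1 : ‖∑ j ∈ Finset.range n, ee y ^ j‖ ≤ 1 / (2 * w) := by
    have h2 : ‖∑ j ∈ Finset.range n, ee y ^ j‖ * ‖ee y - 1‖ ≤ 2 := by
      rw [← norm_mul, geom_sum_mul]
      refine (norm_sub_le _ _).trans ?_
      rw [norm_pow, norm_ee]; norm_num
    rw [le_div_iff₀ (by positivity)]
    nlinarith [norm_nonneg (∑ j ∈ Finset.range n, ee y ^ j)]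
  rw [fejerPow, norm_pow, ← pow_mul, mul_comm P 2]
  gcongr

theorem sum_ee_grid {L : ℕ} (hL : 0 < L) {d : ℤ} (hd : |d| < L) (x : ℝ) (k₀ : ℤ) :
    ∑ i ∈ Finset.range L, ee (d * (x - ((k₀ + i : ℤ) : ℝ) / L)) = if d = 0 then (L : ℂ) else 0 := by
  have hL0 : (L : ℝ) ≠ 0 := by positivity
  split_ifs with h0
  · subst h0; simp [ee_zero]
  · set z := ee (-(d / L : ℝ)) with hz
    have hterm : ∀ i : ℕ, ee (d * (x - ((k₀ + i : ℤ) : ℝ) / L)) =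
        ee (d * (x - (k₀ : ℝ) / L)) * z ^ i := by
      intro i
      rw [hz, ← ee_nat_mul, ← ee_add]; congr 1; push_cast; ring
    simp only [hterm]
    rw [← Finset.mul_sum]
    have hz1 : z ≠ 1 := by
      intro h
      obtain ⟨k, hk⟩ := (ee_eq_one_iff _).1 h
      have h1 : (-d : ℝ) = k * L := by rw [← hk]; field_simp
      have h2 : -d = k * L := by exact_mod_cast h1
      have h3 : (L : ℤ) ∣ d := by
        rw [← dvd_neg, h2]; exact dvd_mul_left _ _
      exact h0 (Int.eq_zero_of_abs_lt_dvd h3 hd)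
    have hzL : z ^ L = 1 := by
      rw [hz, ← ee_nat_mul, show (L : ℝ) * -(d / L : ℝ) = ((-d : ℤ) : ℝ) by push_cast; field_simp]
      exact ee_int _
    have h5 := geom_sum_mul z L
    rw [hzL, sub_self] at h5
    rw [(mul_eq_zero.1 h5).resolve_right (sub_ne_zero.2 hz1), mul_zero]

theorem abs_sum_sub_sum_lt {n P : ℕ} (hn : 1 ≤ n) (hP : 1 ≤ P) (f f' : Fin P → Fin n) :
    |((∑ i, (f i : ℕ) : ℕ) - (∑ i, (f' i : ℕ) : ℕ) : ℤ)| < ((P * n : ℕ) : ℤ) := by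
  have h : ∀ f : Fin P → Fin n, ∑ i, (f i : ℕ) < P * n := by
    intro f
    have h1 : ∑ i, (f i : ℕ) ≤ ∑ i : Fin P, (n - 1) :=
      Finset.sum_le_sum fun i _ => by have := (f i).isLt; omega
    rw [Finset.sum_const, Finset.card_univ, Fintype.card_fin, smul_eq_mul] at h1
    have h2 : P * (n - 1) < P * n := Nat.mul_lt_mul_of_pos_left (by omega) hP
    omega
  have h1 := h f
  have h2 := h f'
  rw [abs_lt]; constructor <;> omega

/-- The kernel is a trigonometric polynomial of degree less than Pn, so summing over Pn equidistant
points isolates its constant coefficient, the energy. This replaces integration of the kernel. -/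
theorem sum_fejerPow_grid {n P : ℕ} (hn : 1 ≤ n) (hP : 1 ≤ P) (x : ℝ) (k₀ : ℤ) :
    ∑ i ∈ Finset.range (P * n), fejerPow n P (x - ((k₀ + i : ℤ) : ℝ) / ((P * n : ℕ) : ℝ)) =
      ((P * n : ℕ) : ℝ) * energy n P := by
  have hL : 0 < P * n := by positivity
  have : ((∑ i ∈ Finset.range (P * n),
      fejerPow n P (x - ((k₀ + i : ℤ) : ℝ) / ((P * n : ℕ) : ℝ)) : ℝ) : ℂ) =
      (((P * n : ℕ) : ℝ) * energy n P : ℝ) := by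
    rw [Complex.ofReal_sum]
    simp only [fejerPow_eq]
    rw [Finset.sum_comm]
    simp only [sum_ee_grid hL (abs_sum_sub_sum_lt hn hP _ _)]
    rw [← Finset.sum_filter, Finset.sum_const, energy, nsmul_eq_mul, mul_comm]
    simp only [sub_eq_zero, Nat.cast_inj]
    push_cast; rfl
  exact_mod_cast this

/-- The single grid point 0 already contributes the kernel's value n^(2P) at its peak. -/
theorem pow_le_mul_energy {n P : ℕ} (hn : 1 ≤ n) (hP : 1 ≤ P) :
    (n : ℝ) ^ (2 * P) ≤ ((P * n : ℕ) : ℝ) * energy n P := by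
  rw [← sum_fejerPow_grid hn hP 0 0, ← fejerPow_zero]
  have h0 : 0 ∈ Finset.range (P * n) := Finset.mem_range.2 (by positivity)
  refine le_trans (le_of_eq ?_) (Finset.single_le_sum (fun i _ => fejerPow_nonneg _ _ _) h0)
  simp

/-- Pairs of tuples with equal sums give the main term; each of the at most n^(2P) other pairs gives
a nontrivial frequency, bounded by B. -/
theorem sum_fejerPow_le {ι : Type*} {n P : ℕ} (hn : 1 ≤ n) (hP : 1 ≤ P) (J : Finset ι) (x : ι → ℝ)
    {B : ℝ} (hB : ∀ t : ℤ, t ≠ 0 → |t| < ((P * n : ℕ) : ℤ) → ‖∑ j ∈ J, ee (t * x j)‖ ≤ B) (hB0 : 0 ≤ B)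
    (θ : ℝ) : ∑ j ∈ J, fejerPow n P (x j - θ) ≤ J.card * energy n P + (n : ℝ) ^ (2 * P) * B := by
  have h0 : 0 ≤ ∑ j ∈ J, fejerPow n P (x j - θ) := Finset.sum_nonneg fun _ _ => fejerPow_nonneg _ _ _
  rw [← Real.norm_of_nonneg h0, ← Complex.norm_real, Complex.ofReal_sum]
  simp only [fejerPow_eq]
  rw [Finset.sum_comm]
  refine (norm_sum_le _ _).trans ?_
  have hterm : ∀ f ∈ (Finset.univ : Finset ((Fin P → Fin n) × (Fin P → Fin n))),
      ‖∑ j ∈ J, ee (((∑ i, (f.1 i : ℕ) : ℕ) - (∑ i, (f.2 i : ℕ) : ℕ) : ℤ) * (x j - θ))‖ ≤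
      (if ∑ i, (f.1 i : ℕ) = ∑ i, (f.2 i : ℕ) then (J.card : ℝ) else 0) + B := by
    intro f _
    set d : ℤ := ((∑ i, (f.1 i : ℕ) : ℕ) - (∑ i, (f.2 i : ℕ) : ℕ) : ℤ) with hd
    split_ifs with h
    · refine (norm_sum_le _ _).trans ?_
      simp [norm_ee, hB0]
    · have hd0 : d ≠ 0 := by rw [hd, sub_ne_zero]; exact_mod_cast h
      have h1 : ∀ j, ee (d * (x j - θ)) = ee (-(d * θ)) * ee (d * x j) := fun j => by
        rw [← ee_add]; congr 1; ring
      simp only [h1]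
      rw [← Finset.mul_sum, norm_mul, norm_ee, one_mul, zero_add]
      exact hB d hd0 (abs_sum_sub_sum_lt hn hP _ _)
  refine (Finset.sum_le_sum hterm).trans (le_of_eq ?_)
  rw [Finset.sum_add_distrib, ← Finset.sum_filter, Finset.sum_const, Finset.sum_const, energy,
    Finset.card_univ, Fintype.card_prod, Fintype.card_fun, Fintype.card_fin, Fintype.card_fin]
  simp only [nsmul_eq_mul]
  push_cast
  ring

open Classical in
/-- If all nontrivial exponential sums of frequency less than `P n` are at most `B`, an interval
contains at most the expected number of points, up to an explicit error. -/
theorem card_filter_fract_le {ι : Type*} {n P : ℕ} (hn : 1 ≤ n) (hP : 1 ≤ P) (J : Finset ι)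
    (x : ι → ℝ) {B : ℝ} (hB0 : 0 ≤ B)
    (hB : ∀ t : ℤ, t ≠ 0 → |t| < ((P * n : ℕ) : ℤ) → ‖∑ j ∈ J, ee (t * x j)‖ ≤ B)
    {w : ℝ} (hw : 1 / (n : ℝ) ≤ w) {α β : ℝ} (hαβ : α ≤ β) :
    ((J.filter (fun j => Int.fract (x j) ∈ Set.Icc α β)).card : ℝ) ≤
      (β - α) * J.card + (((P * n : ℕ) : ℝ) * (1 / (2 * (n * w))) ^ (2 * P) + 3 * w) * J.card +
        (β - α + 3 * w) * ((P * n : ℕ) : ℝ) * B := by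
  set L : ℕ := P * n with hL
  have hn0 : (0 : ℝ) < n := by exact_mod_cast hn
  have hw0 : 0 < w := lt_of_lt_of_le (by positivity) hw
  have hL0 : 0 < L := by positivity
  have hLR : (0 : ℝ) < L := by exact_mod_cast hL0
  have hnL : (n : ℝ) ≤ L := by exact_mod_cast Nat.le_mul_of_pos_left n hP
  set E : ℝ := (energy n P : ℝ) with hE
  have hLE := pow_le_mul_energy hn hP
  rw [← hL, ← hE] at hLE
  have hnP : (0 : ℝ) < (n : ℝ) ^ (2 * P) := by positivity
  have hE0 : 0 < E := by
    by_contra! h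
    nlinarith
  -- The grid points within w of the interval. Every sample point of the interval collects almost
  -- the full grid mass L E from them; double counting then bounds the number of such points.
  set A : Finset ℤ := Finset.Icc ⌈L * (α - w)⌉ ⌊L * (β + w)⌋ with hA
  set Y := J.filter (fun j => Int.fract (x j) ∈ Set.Icc α β) with hY
  have hAcard : (A.card : ℝ) ≤ L * (β - α + 3 * w) := by
    have h1 : (A.card : ℝ) ≤ L * (β + w) - L * (α - w) + 1 := by
      rw [hA, Int.card_Icc]
      have hf := Int.floor_le ((L : ℝ) * (β + w))
      have hc := Int.le_ceil ((L : ℝ) * (α - w))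
      have h2 : (0 : ℝ) ≤ L * (β + w) - L * (α - w) + 1 := by
        have : 0 ≤ (L : ℝ) * ((β + w) - (α - w)) := mul_nonneg hLR.le (by linarith)
        linarith
      have h3 : (((⌊(L : ℝ) * (β + w)⌋ + 1 - ⌈(L : ℝ) * (α - w)⌉).toNat : ℤ) : ℝ) ≤
          L * (β + w) - L * (α - w) + 1 := by
        rw [Int.toNat_eq_max]
        push_cast
        exact max_le (by linarith) h2
      exact_mod_cast h3
    have h4 : 1 ≤ L * w := by
      rw [div_le_iff₀ hn0] at hw
      nlinarith
    nlinarith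
  have hlower : ∀ j ∈ Y, L * E - L * (1 / (2 * w)) ^ (2 * P) ≤
      ∑ k ∈ A, fejerPow n P (x j - (k : ℝ) / L) := by
    intro j hj
    have hj' := (Finset.mem_filter.1 hj).2
    set y := Int.fract (x j) with hy
    have hxy : ∀ k : ℤ, fejerPow n P (x j - (k : ℝ) / L) = fejerPow n P (y - (k : ℝ) / L) := by
      intro k
      rw [← fejerPow_add_int n P (y - (k : ℝ) / L) ⌊x j⌋]
      congr 1
      rw [hy, Int.fract]; ring
    simp only [hxy]
    -- Starts a full period of grid points within distance 1/2 of y, the range where the kernel's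
    -- decay bound applies.
    set k₀ : ℤ := ⌈L * (y - 1 / 2)⌉ with hk₀
    have hgrid := sum_fejerPow_grid hn hP y k₀
    rw [← hL, ← hE] at hgrid
    have hk1 := Int.le_ceil ((L : ℝ) * (y - 1 / 2))
    have hk2 := Int.ceil_lt_add_one ((L : ℝ) * (y - 1 / 2))
    rw [← hk₀] at hk1 hk2
    have hterm : ∀ i ∈ Finset.range L, fejerPow n P (y - ((k₀ + i : ℤ) : ℝ) / L) ≤
        (1 / (2 * w)) ^ (2 * P) +
          (if k₀ + i ∈ A then fejerPow n P (y - ((k₀ + i : ℤ) : ℝ) / L) else 0) := by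
      intro i hi
      rw [Finset.mem_range] at hi
      have hpos : 0 ≤ (1 / (2 * w)) ^ (2 * P) := by positivity
      split_ifs with hiA
      · linarith
      · rw [add_zero]
        set k : ℤ := k₀ + i with hk
        have hi' : (i : ℝ) + 1 ≤ L := by exact_mod_cast hi
        have hkR : (k : ℝ) = k₀ + i := by rw [hk]; push_cast; rfl
        have e : y - (k : ℝ) / L = (L * y - k) / L := by field_simp
        refine fejerPow_le hw0 ?_ ?_
        · rw [e, abs_div, abs_of_pos hLR, div_le_iff₀ hLR, abs_le, hkR]
          have : (0 : ℝ) ≤ i := Nat.cast_nonneg i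
          constructor <;> linarith
        · by_contra! hc
          apply hiA
          rw [e, abs_div, abs_of_pos hLR, div_le_iff₀ hLR, abs_le] at hc
          have hα : L * α ≤ L * y := by have := hj'.1; gcongr
          have hβ : L * y ≤ L * β := by have := hj'.2; gcongr
          rw [hA, Finset.mem_Icc, Int.ceil_le, Int.le_floor]
          constructor <;> linarith
    have h1 := Finset.sum_le_sum hterm
    rw [hgrid, Finset.sum_add_distrib, Finset.sum_const, Finset.card_range, nsmul_eq_mul,
      ← Finset.sum_filter] at h1
    have h2 : ∑ i ∈ (Finset.range L).filter (fun i : ℕ => k₀ + (i : ℤ) ∈ A),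
        fejerPow n P (y - ((k₀ + i : ℤ) : ℝ) / L) ≤ ∑ k ∈ A, fejerPow n P (y - (k : ℝ) / L) := by
      rw [← Finset.sum_image (f := fun k : ℤ => fejerPow n P (y - (k : ℝ) / L))
        (g := fun i : ℕ => k₀ + (i : ℤ)) (fun a _ b _ h => by simpa using h)]
      refine Finset.sum_le_sum_of_subset_of_nonneg ?_ fun k _ _ => fejerPow_nonneg _ _ _
      intro k hk
      obtain ⟨i, hi, rfl⟩ := Finset.mem_image.1 hk
      exact (Finset.mem_filter.1 hi).2
    linarith
  have hmain : (Y.card : ℝ) * (L * E - L * (1 / (2 * w)) ^ (2 * P)) ≤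
      A.card * (J.card * E + (n : ℝ) ^ (2 * P) * B) := by
    calc (Y.card : ℝ) * (L * E - L * (1 / (2 * w)) ^ (2 * P))
        ≤ ∑ j ∈ Y, ∑ k ∈ A, fejerPow n P (x j - (k : ℝ) / L) := by
          rw [← nsmul_eq_mul]; exact Finset.card_nsmul_le_sum _ _ _ hlower
      _ ≤ ∑ j ∈ J, ∑ k ∈ A, fejerPow n P (x j - (k : ℝ) / L) :=
          Finset.sum_le_sum_of_subset_of_nonneg (Finset.filter_subset _ _)
            fun j _ _ => Finset.sum_nonneg fun k _ => fejerPow_nonneg _ _ _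
      _ = ∑ k ∈ A, ∑ j ∈ J, fejerPow n P (x j - (k : ℝ) / L) := Finset.sum_comm
      _ ≤ _ := by
          rw [← nsmul_eq_mul]
          exact Finset.sum_le_card_nsmul _ _ _ fun k _ => sum_fejerPow_le hn hP J x hB hB0 _
  have hYJ : (Y.card : ℝ) ≤ J.card := by exact_mod_cast Finset.card_filter_le _ _
  have hJ0 : (0 : ℝ) ≤ J.card := Nat.cast_nonneg _
  have hτ : L * (1 / (2 * w)) ^ (2 * P) ≤ L * (1 / (2 * (n * w))) ^ (2 * P) * (L * E) := by
    have h1 : (1 / (2 * w)) ^ (2 * P) = (1 / (2 * (n * w))) ^ (2 * P) * (n : ℝ) ^ (2 * P) := by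
      rw [← mul_pow]; congr 1; field_simp
    rw [h1, mul_assoc]
    gcongr
  have hLE0 : 0 < L * E := by positivity
  refine le_of_mul_le_mul_right ?_ hLE0
  have hs : 0 ≤ β - α + 3 * w := by linarith
  have e1 : (Y.card : ℝ) * (L * (1 / (2 * w)) ^ (2 * P)) ≤
      J.card * (L * (1 / (2 * (n * w))) ^ (2 * P) * (L * E)) := by gcongr
  have e2 : (A.card : ℝ) * (J.card * E + (n : ℝ) ^ (2 * P) * B) ≤
      L * (β - α + 3 * w) * (J.card * E + (L * E) * B) := by gcongr
  have e3 : L * (β - α + 3 * w) * (J.card * E + (L * E) * B) =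
      ((β - α + 3 * w) * J.card + (β - α + 3 * w) * L * B) * (L * E) := by ring
  nlinarith

/-! ### From one-sided bounds for closed intervals to discrepancy and normality -/

open Classical in
-- The lower bound comes from the upper bounds for the two complementary intervals [0, α] and [β,
-- 1], hence 2E; overlaps at the end points only help.
theorem abs_card_div_sub_volume_le {x : ℕ → ℝ} {N : ℕ} (hN : 1 ≤ N) {E : ℝ}
    (h : ∀ α β : ℝ, 0 ≤ α → α ≤ β → β ≤ 1 →
      (((Finset.Icc 1 N).filter (fun n => Int.fract (x n) ∈ Set.Icc α β)).card : ℝ) ≤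
        (β - α) * N + E) (hE : 0 ≤ E)
    {I : Set ℝ} (hI : I ⊆ Set.Ico 0 1) (hIc : I.OrdConnected) :
    |(((Finset.Icc 1 N).filter (fun n => Int.fract (x n) ∈ I)).card : ℝ) / N
      - MeasureTheory.volume.real I| ≤ 2 * E / N := by
  have hN0 : (0 : ℝ) < N := by exact_mod_cast hN
  rcases I.eq_empty_or_nonempty with rfl | hne
  · simp; positivity
  have hbb : BddBelow I := ⟨0, fun y hy => (hI hy).1⟩
  have hba : BddAbove I := ⟨1, fun y hy => (hI hy).2.le⟩
  set α := sInf I with hα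
  set β := sSup I with hβ
  have hα0 : 0 ≤ α := le_csInf hne fun y hy => (hI hy).1
  have hβ1 : β ≤ 1 := csSup_le hne fun y hy => (hI hy).2.le
  have hαβ : α ≤ β := csInf_le_csSup hne hbb hba
  have hsub1 : I ⊆ Set.Icc α β := fun y hy => ⟨csInf_le hbb hy, le_csSup hba hy⟩
  have hsub2 : Set.Ioo α β ⊆ I := by
    intro y hy
    obtain ⟨u, hu, huy⟩ := exists_lt_of_csInf_lt hne hy.1
    obtain ⟨v, hv, hyv⟩ := exists_lt_of_lt_csSup hne hy.2
    exact hIc.out hu hv ⟨huy.le, hyv.le⟩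
  have hvol : MeasureTheory.volume.real I = β - α := by
    refine le_antisymm ?_ ?_
    · calc MeasureTheory.volume.real I ≤ MeasureTheory.volume.real (Set.Icc α β) :=
            MeasureTheory.measureReal_mono hsub1 (by simp)
        _ = β - α := Real.volume_real_Icc_of_le hαβ
    · calc β - α = MeasureTheory.volume.real (Set.Ioo α β) := (Real.volume_real_Ioo_of_le hαβ).symm
        _ ≤ _ := MeasureTheory.measureReal_mono hsub2
            ((MeasureTheory.measure_mono hsub1).trans_lt (by simp)).ne
  set cI := ((Finset.Icc 1 N).filter (fun n => Int.fract (x n) ∈ I)).card with hcI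
  have hup : (cI : ℝ) ≤ (β - α) * N + E := by
    refine le_trans ?_ (h α β hα0 hαβ hβ1)
    exact_mod_cast Finset.card_le_card (Finset.monotone_filter_right _ fun n _ hn => hsub1 hn)
  have hlow : (N : ℝ) ≤ cI + (((α - 0) * N + E) + ((1 - β) * N + E)) := by
    have h1 := h 0 α le_rfl hα0 (hαβ.trans hβ1)
    have h2 := h β 1 (hα0.trans hαβ) hβ1 le_rfl
    have h3 : Finset.Icc 1 N ⊆ (Finset.Icc 1 N).filter (fun n => Int.fract (x n) ∈ I) ∪
        ((Finset.Icc 1 N).filter (fun n => Int.fract (x n) ∈ Set.Icc 0 α) ∪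
          (Finset.Icc 1 N).filter (fun n => Int.fract (x n) ∈ Set.Icc β 1)) := by
      intro n hn
      simp only [Finset.mem_union, Finset.mem_filter]
      rcases le_or_gt (Int.fract (x n)) α with h4 | h4
      · exact Or.inr (Or.inl ⟨hn, Int.fract_nonneg _, h4⟩)
      rcases le_or_gt β (Int.fract (x n)) with h5 | h5
      · exact Or.inr (Or.inr ⟨hn, h5, (Int.fract_lt_one _).le⟩)
      · exact Or.inl ⟨hn, hsub2 ⟨h4, h5⟩⟩
    have h4 := (Finset.card_le_card h3).trans
      ((Finset.card_union_le _ _).trans (Nat.add_le_add_left (Finset.card_union_le _ _) _))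
    rw [Nat.card_Icc, Nat.add_sub_cancel] at h4
    have h5 : (N : ℝ) ≤ cI + ((((Finset.Icc 1 N).filter
        (fun n => Int.fract (x n) ∈ Set.Icc 0 α)).card : ℝ) +
        (((Finset.Icc 1 N).filter (fun n => Int.fract (x n) ∈ Set.Icc β 1)).card : ℝ)) := by
      exact_mod_cast h4
    linarith
  rw [hvol, abs_le, div_sub' hN0.ne', neg_le, ← neg_div]
  constructor <;> (gcongr; linarith)

theorem digit_eq (b : ℕ) (x : ℝ) (n i k : ℕ) (hb : 2 ≤ b) (hik : i < k) :
    digit b x (n + i) =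
      ((⌊(b : ℝ) ^ k * Int.fract ((b : ℝ) ^ n * x)⌋₊ / b ^ (k - 1 - i) % b : ℕ) : ℤ) := by
  set y := Int.fract ((b : ℝ) ^ n * x) with hy
  set f := ⌊(b : ℝ) ^ n * x⌋ with hf
  have hb0 : (b : ℝ) ≠ 0 := by positivity
  have hy0 : 0 ≤ y := Int.fract_nonneg _
  have h1 : (b : ℝ) ^ (n + i + 1) * x = (((b : ℤ) * ((b : ℤ) ^ i * f) : ℤ) : ℝ) + (b : ℝ) ^ (i + 1) * y := by
    have : (b : ℝ) ^ n * x = f + y := (Int.floor_add_fract _).symm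
    push_cast
    calc (b : ℝ) ^ (n + i + 1) * x = (b : ℝ) ^ (i + 1) * ((b : ℝ) ^ n * x) := by ring
      _ = _ := by rw [this]; ring
  have h2 : (b : ℝ) ^ (i + 1) * y = ((b : ℝ) ^ k * y) / ((b ^ (k - 1 - i) : ℕ) : ℝ) := by
    have e : k = i + 1 + (k - 1 - i) := by omega
    set t := k - 1 - i
    rw [e, pow_add (b : ℝ) (i + 1) t]; push_cast; field_simp
  rw [digit, h1, Int.floor_intCast_add, Int.add_comm, Int.add_mul_emod_self_left,
    ← Int.natCast_floor_eq_floor (by positivity), h2, Nat.floor_div_natCast]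
  push_cast; rfl

/-- The block is read off from ⌊b^k {b^n x}⌋. Its first digit is the most significant one, whereas
`finFunctionFinEquiv` puts the least significant first, hence `Fin.rev`. -/
theorem forall_digit_eq_iff {b : ℕ} (hb : 2 ≤ b) (x : ℝ) (k : ℕ) (w : Fin k → Fin b) (n : ℕ) :
    (∀ i : Fin k, digit b x (n + i) = ((w i : ℕ) : ℤ)) ↔
      Int.fract ((b : ℝ) ^ n * x) ∈
        Set.Ico (((finFunctionFinEquiv (fun i => w i.rev) : Fin (b ^ k)) : ℕ) / (b : ℝ) ^ k : ℝ)
          ((((finFunctionFinEquiv (fun i => w i.rev) : Fin (b ^ k)) : ℕ) + 1) / (b : ℝ) ^ k) := by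
  set y := Int.fract ((b : ℝ) ^ n * x) with hy
  set v : Fin (b ^ k) := finFunctionFinEquiv (fun i => w i.rev) with hv
  have hbk : (0 : ℝ) < (b : ℝ) ^ k := by positivity
  have hy0 : 0 ≤ y := Int.fract_nonneg _
  have hVlt : ⌊(b : ℝ) ^ k * y⌋₊ < b ^ k := by
    rw [Nat.floor_lt (by positivity)]
    push_cast
    have := Int.fract_lt_one ((b : ℝ) ^ n * x)
    nlinarith
  set V : Fin (b ^ k) := ⟨⌊(b : ℝ) ^ k * y⌋₊, hVlt⟩ with hV
  have h1 : (∀ i : Fin k, digit b x (n + i) = ((w i : ℕ) : ℤ)) ↔ V = v := by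
    have h2 : V = v ↔ finFunctionFinEquiv.symm V = fun i => w i.rev := by
      rw [hv, Equiv.symm_apply_eq]
    rw [h2, funext_iff]
    have h3 : ∀ i : Fin k, ((finFunctionFinEquiv.symm V i : Fin b) : ℕ) =
        ⌊(b : ℝ) ^ k * y⌋₊ / b ^ (i : ℕ) % b := fun i => rfl
    simp only [Fin.ext_iff, h3]
    have h4 : ∀ i : Fin k, digit b x (n + i) =
        ((⌊(b : ℝ) ^ k * y⌋₊ / b ^ ((i.rev : Fin k) : ℕ) % b : ℕ) : ℤ) := by
      intro i
      rw [digit_eq b x n i k hb i.isLt, Fin.val_rev]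
      congr 4; omega
    simp only [h4, Nat.cast_inj]
    constructor
    · intro h i
      have := h i.rev
      rwa [Fin.rev_rev] at this
    · intro h i
      have := h i.rev
      rwa [Fin.rev_rev] at this
  rw [h1, Fin.ext_iff, Set.mem_Ico, div_le_iff₀ hbk, lt_div_iff₀ hbk, mul_comm y,
    ← Nat.floor_eq_iff (by positivity)]

theorem isNormal_of_tendsto {b : ℕ} (hb : 2 ≤ b) {x : ℝ}
    (h : ∀ I : Set ℝ, I ⊆ Set.Ico 0 1 → I.OrdConnected → ∀ [DecidablePred fun n : ℕ =>
        Int.fract ((b : ℝ) ^ n * x) ∈ I],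
      Tendsto (fun N : ℕ => (((Finset.Icc 1 N).filter
        (fun n => Int.fract ((b : ℝ) ^ n * x) ∈ I)).card : ℝ) / N) atTop
        (𝓝 (MeasureTheory.volume.real I))) : IsNormal b x := by
  classical
  intro k _ w
  set v : Fin (b ^ k) := finFunctionFinEquiv (fun i => w i.rev) with hv
  set I : Set ℝ := Set.Ico ((v : ℕ) / (b : ℝ) ^ k : ℝ) (((v : ℕ) + 1) / (b : ℝ) ^ k) with hI
  have hbk : (0 : ℝ) < (b : ℝ) ^ k := by positivity
  have hI1 : I ⊆ Set.Ico 0 1 := by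
    refine Set.Ico_subset_Ico (by positivity) ?_
    rw [div_le_one hbk]
    exact_mod_cast v.isLt
  have hvol : MeasureTheory.volume.real I = 1 / (b : ℝ) ^ k := by
    rw [hI, Real.volume_real_Ico_of_le (by gcongr; linarith)]; ring
  have hlim := h I hI1 Set.ordConnected_Ico
  rw [hvol] at hlim
  -- Normality counts n = 0, ..., N - 1 and the discrepancy n = 1, ..., N; the counts differ by at
  -- most 1.
  have hdiff : Tendsto (fun N : ℕ => (((Finset.range N).filter
        (fun n => ∀ i : Fin k, digit b x (n + i) = ((w i : ℕ) : ℤ))).card : ℝ) / N -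
      (((Finset.Icc 1 N).filter (fun n => Int.fract ((b : ℝ) ^ n * x) ∈ I)).card : ℝ) / N)
      atTop (𝓝 0) := by
    refine squeeze_zero_norm (fun N => ?_) tendsto_one_div_atTop_nhds_zero_nat
    rw [← sub_div, norm_div, Real.norm_natCast]
    gcongr
    have e1 : (Finset.range N).filter
        (fun n => ∀ i : Fin k, digit b x (n + i) = ((w i : ℕ) : ℤ)) =
        (Finset.range N).filter (fun n => Int.fract ((b : ℝ) ^ n * x) ∈ I) :=
      Finset.filter_congr fun n _ => forall_digit_eq_iff hb x k w n
    rw [e1]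
    set p : ℕ → Prop := fun n => Int.fract ((b : ℝ) ^ n * x) ∈ I
    have c1 : (Finset.range N).filter p ⊆ insert 0 ((Finset.Icc 1 N).filter p) := by
      intro n hn
      rw [Finset.mem_filter, Finset.mem_range] at hn
      rw [Finset.mem_insert, Finset.mem_filter, Finset.mem_Icc]
      by_cases h0 : n = 0
      · exact Or.inl h0
      · exact Or.inr ⟨⟨by omega, by omega⟩, hn.2⟩
    have c2 : (Finset.Icc 1 N).filter p ⊆ insert N ((Finset.range N).filter p) := by
      intro n hn
      rw [Finset.mem_filter, Finset.mem_Icc] at hn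
      rw [Finset.mem_insert, Finset.mem_filter, Finset.mem_range]
      by_cases h0 : n = N
      · exact Or.inl h0
      · exact Or.inr ⟨by omega, hn.2⟩
    have d1 : (((Finset.range N).filter p).card : ℝ) ≤ ((Finset.Icc 1 N).filter p).card + 1 := by
      exact_mod_cast (Finset.card_le_card c1).trans (Finset.card_insert_le _ _)
    have d2 : (((Finset.Icc 1 N).filter p).card : ℝ) ≤ ((Finset.range N).filter p).card + 1 := by
      exact_mod_cast (Finset.card_le_card c2).trans (Finset.card_insert_le _ _)
    rw [Real.norm_eq_abs, abs_le]
    constructor <;> linarith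
  have := hdiff.add hlim
  rw [zero_add] at this
  refine (this.congr fun N => ?_)
  rw [sub_add_cancel]

/-- An upper bound for all closed intervals yields the discrepancy estimate and normality. -/
theorem discrepancy_isBigO_and_isNormal {b : ℕ} (hb : 2 ≤ b) {x A C : ℝ} (hA : 0 < A) (hC : 0 ≤ C)
    {N₀ : ℕ} (h : ∀ N, N₀ ≤ N → ∀ α β : ℝ, 0 ≤ α → α ≤ β → β ≤ 1 →
      ∀ [DecidablePred fun n : ℕ => Int.fract ((b : ℝ) ^ n * x) ∈ Set.Icc α β],
      (((Finset.Icc 1 N).filter (fun n => Int.fract ((b : ℝ) ^ n * x) ∈ Set.Icc α β)).card : ℝ) ≤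
        (β - α) * N + C * (N / Real.log N ^ A)) :
    IsNormal b x ∧ (fun N : ℕ => discrepancy (fun n => (b : ℝ) ^ n * x) N) =O[atTop]
      (fun N : ℕ => Real.log (Real.log N) / Real.log N ^ A) := by
  classical
  have hloc : ∀ N, max 2 N₀ ≤ N → ∀ I : Set ℝ, I ⊆ Set.Ico 0 1 → I.OrdConnected →
      |(((Finset.Icc 1 N).filter (fun n => Int.fract ((b : ℝ) ^ n * x) ∈ I)).card : ℝ) / N
        - MeasureTheory.volume.real I| ≤ 2 * C / Real.log N ^ A := by
    intro N hN I hI hIc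
    have hN2 : 2 ≤ N := (le_max_left _ _).trans hN
    have hN0 : (0 : ℝ) < N := by positivity
    have hlog : 0 < Real.log N := Real.log_pos (by exact_mod_cast (by omega : 1 < N))
    have := abs_card_div_sub_volume_le (x := fun n => (b : ℝ) ^ n * x) (N := N) (by omega)
      (E := C * (N / Real.log N ^ A))
      (fun α β h0 h1 h2 => by convert h N ((le_max_right _ _).trans hN) α β h0 h1 h2)
      (by positivity) hI hIc
    convert this using 1
    field_simp
  have hlogtop : Tendsto (fun N : ℕ => Real.log N) atTop atTop :=
    Real.tendsto_log_atTop.comp tendsto_natCast_atTop_atTop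
  constructor
  · refine isNormal_of_tendsto hb fun I hI hIc _ => ?_
    rw [tendsto_iff_norm_sub_tendsto_zero]
    have hz : Tendsto (fun N : ℕ => 2 * C / Real.log N ^ A) atTop (𝓝 0) :=
      Tendsto.const_div_atTop ((tendsto_rpow_atTop hA).comp hlogtop) _
    refine squeeze_zero' (Eventually.of_forall fun N => norm_nonneg _) ?_ hz
    filter_upwards [eventually_ge_atTop (max 2 N₀)] with N hN
    have := hloc N hN I hI hIc
    rw [Real.norm_eq_abs]
    convert this
  · refine IsBigO.of_bound (2 * C) ?_
    have hll : Tendsto (fun N : ℕ => Real.log (Real.log N)) atTop atTop :=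
      Real.tendsto_log_atTop.comp hlogtop
    filter_upwards [eventually_ge_atTop (max 2 N₀), hll.eventually_ge_atTop 1] with N hN hN1
    have hN2 : 2 ≤ N := (le_max_left _ _).trans hN
    have hlog : 0 < Real.log N := Real.log_pos (by exact_mod_cast (by omega : 1 < N))
    have h0 : 0 ≤ discrepancy (fun n => (b : ℝ) ^ n * x) N :=
      Real.sSup_nonneg (by rintro _ ⟨I, _, _, rfl⟩; exact abs_nonneg _)
    have h1 : discrepancy (fun n => (b : ℝ) ^ n * x) N ≤ 2 * C / Real.log N ^ A := by
      refine Real.sSup_le ?_ (by positivity)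
      rintro _ ⟨I, hI, hIc, rfl⟩
      convert hloc N hN I hI hIc
    rw [Real.norm_of_nonneg h0, Real.norm_of_nonneg (by positivity)]
    -- The bound so far has no iterated logarithm; that factor is inserted since it is eventually at
    -- least 1.
    refine h1.trans ?_
    rw [mul_div_assoc']
    exact div_le_div_of_nonneg_right (le_mul_of_one_le_right (by positivity) hN1) (by positivity)

/-! ### Counting block by block -/

/-- One term of A'_m is at most the whole sum, so a block sum is at most √δ m g^(1-β/2). Here
g^(β/2) ≥ exp((b₁/4) m^(c-κ)) for large m, which outgrows every power of m because κ < c. -/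
theorem exists_mul_norm_blockSum_le {c κ : ℝ} (hc : 0 < c) (hc1 : c < 1) (hκc : κ < c)
    {m₀ r : ℕ → ℕ} {x b₁ δ : ℝ} {β : ℕ → ℝ} (hb₁ : 0 < b₁) (hδ : 0 < δ)
    (hβ : ∀ m : ℕ, 1 ≤ m → b₁ / (m : ℝ) ^ κ ≤ β m)
    (hA : ∀ m : ℕ, 1 ≤ m → Aprime c m₀ r m x ≤ δ * (m : ℝ) ^ 2 * gap c m ^ (2 - β m))
    {i : ℕ} (hi : 1 ≤ i) :
    ∃ (C : ℝ) (M : ℕ), 0 < C ∧ 1 ≤ M ∧ ∀ m, M ≤ m → ∀ t : ℤ, t ≠ 0 → |t| ≤ m →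
      m * ‖blockSum c m (r i) t x‖ ≤ C * ((m : ℝ) ^ (c - 1) * gap c m) := by
  obtain ⟨M₁, hM₁, hgap⟩ := exists_exp_le_gap hc hc1
  obtain ⟨C₁, hC₁, hexp⟩ := exists_rpow_le_exp (show 0 < c - κ by linarith)
    (show 0 < b₁ / 4 by linarith) (3 - c)
  refine ⟨Real.sqrt δ * C₁, max M₁ (max i (m₀ (r i))), by positivity, hM₁.trans (le_max_left _ _),
    fun m hm t ht htm => ?_⟩
  have hm1 : M₁ ≤ m := (le_max_left _ _).trans hm
  have hmi : i ≤ m := (le_max_left _ _).trans ((le_max_right _ _).trans hm)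
  have hmr : m₀ (r i) ≤ m := (le_max_right _ _).trans ((le_max_right _ _).trans hm)
  have hm1' : 1 ≤ m := hM₁.trans hm1
  have hmR : (1 : ℝ) ≤ m := by exact_mod_cast hm1'
  have hm0 : (0 : ℝ) < m := by linarith
  have hg1 := hgap m hm1
  have hg0 : 0 < gap c m := (Real.exp_pos _).trans_le hg1
  set y := ‖blockSum c m (r i) t x‖ with hy
  have h1 : y ^ 2 ≤ δ * (m : ℝ) ^ 2 * gap c m ^ (2 - β m) := by
    refine le_trans ?_ (hA m hm1')
    rw [Aprime_eq]
    have hin : ‖blockSum c m (r i) t x‖ ^ 2 ≤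
        ∑ i ∈ (Finset.Icc 1 m).filter (fun i => m₀ (r i) ≤ m), ‖blockSum c m (r i) t x‖ ^ 2 :=
      Finset.single_le_sum (f := fun i => ‖blockSum c m (r i) t x‖ ^ 2)
        (fun _ _ => by positivity)
        (Finset.mem_filter.2 ⟨Finset.mem_Icc.2 ⟨hi, hmi⟩, hmr⟩)
    refine hin.trans (Finset.single_le_sum (f := fun t => ∑ i ∈ (Finset.Icc 1 m).filter
        (fun i => m₀ (r i) ≤ m), ‖blockSum c m (r i) t x‖ ^ 2)
      (fun _ _ => Finset.sum_nonneg fun _ _ => by positivity) ?_)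
    rw [Finset.mem_erase, Finset.mem_Icc]
    exact ⟨ht, abs_le.1 htm⟩
  have hgβ : gap c m ^ (-β m) ≤ Real.exp (-(b₁ / 4 * (m : ℝ) ^ (c - κ))) ^ 2 := by
    have h2 : 0 ≤ b₁ / (m : ℝ) ^ κ := by positivity
    have h3 : Real.exp ((m : ℝ) ^ c / 2) ^ (b₁ / (m : ℝ) ^ κ) ≤ gap c m ^ (β m) := by
      calc _ ≤ gap c m ^ (b₁ / (m : ℝ) ^ κ) := Real.rpow_le_rpow (Real.exp_pos _).le hg1 h2
        _ ≤ _ := Real.rpow_le_rpow_of_exponent_le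
            ((Real.one_le_exp (by positivity)).trans hg1) (hβ m hm1')
    rw [Real.rpow_neg hg0.le, ← Real.exp_nat_mul]
    have h4 : Real.exp ((2 : ℕ) * -(b₁ / 4 * (m : ℝ) ^ (c - κ))) =
        (Real.exp ((m : ℝ) ^ c / 2) ^ (b₁ / (m : ℝ) ^ κ))⁻¹ := by
      rw [← Real.exp_mul, ← Real.exp_neg, Real.rpow_sub hm0]
      congr 1; push_cast; ring
    rw [h4]
    exact inv_anti₀ (by positivity) h3
  set F := Real.exp (b₁ / 4 * (m : ℝ) ^ (c - κ)) with hF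
  have hF0 : 0 < F := Real.exp_pos _
  rw [Real.exp_neg, ← hF] at hgβ
  have h5 : (m : ℝ) ^ (3 - c) ≤ C₁ * F := hexp m hmR
  have h6 : (m : ℝ) ^ 2 = (m : ℝ) ^ (3 - c) * (m : ℝ) ^ (c - 1) := by
    rw [← Real.rpow_add hm0, ← Real.rpow_natCast]; congr 1; push_cast; ring
  have h7 : y ^ 2 ≤ (Real.sqrt δ * m * (gap c m * F⁻¹)) ^ 2 := by
    refine h1.trans ?_
    rw [mul_pow, mul_pow, mul_pow, Real.sq_sqrt hδ.le, sub_eq_add_neg, Real.rpow_add hg0]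
    have : gap c m ^ (2 : ℝ) = gap c m ^ 2 := by norm_cast
    rw [this]
    gcongr
  have h8 : y ≤ Real.sqrt δ * m * (gap c m * F⁻¹) :=
    le_of_sq_le_sq h7 (by positivity)
  calc m * y ≤ m * (Real.sqrt δ * m * (gap c m * F⁻¹)) := by gcongr
    _ = Real.sqrt δ * gap c m * F⁻¹ * (m : ℝ) ^ 2 := by ring
    _ = Real.sqrt δ * gap c m * F⁻¹ * ((m : ℝ) ^ (3 - c) * (m : ℝ) ^ (c - 1)) := by rw [h6]
    _ ≤ Real.sqrt δ * gap c m * F⁻¹ * ((C₁ * F) * (m : ℝ) ^ (c - 1)) := by gcongr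
    _ = _ := by field_simp

open Classical in
/-- The number of points of a block in an interval. -/
theorem exists_card_block_le {c : ℝ} (hc : 0 < c) (hc1 : c < 1) {R : ℕ} (hR : 2 ≤ R) {x C : ℝ}
    (hC : 0 < C) {M : ℕ} (hM : 1 ≤ M) (h : ∀ m, M ≤ m → ∀ t : ℤ, t ≠ 0 → |t| ≤ m →
      m * ‖blockSum c m R t x‖ ≤ C * ((m : ℝ) ^ (c - 1) * gap c m)) :
    ∃ (C' : ℝ) (M' : ℕ), 0 < C' ∧ 1 ≤ M' ∧ ∀ m, M' ≤ m → ∀ α β : ℝ, 0 ≤ α → α ≤ β → β ≤ 1 →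
      (((Finset.Icc (bracketBase c m R + 1) (bracketBase c (m + 1) R)).filter
        (fun j => Int.fract ((R : ℝ) ^ j * x) ∈ Set.Icc α β)).card : ℝ) ≤
        (β - α) * ((bracketBase c (m + 1) R : ℝ) - bracketBase c m R) +
          C' * ((m : ℝ) ^ (c - 1) * gap c m) := by
  -- With n = ⌊m/P⌋ all frequencies stay below Pn ≤ m, as A'_m requires. For the width w = n^(c-1)
  -- the kernel tail is governed by (nw)^(-2P) = n^(-2cP) ≤ n^(-2), which is where P ≥ 1/c enters.
  obtain ⟨P, hP⟩ := exists_nat_ge (1 / c)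
  have hP1 : 1 ≤ P := by
    by_contra! h0
    have : P = 0 := by omega
    rw [this] at hP
    have : 0 < 1 / c := by positivity
    push_cast at hP; linarith
  have hP1R : (1 : ℝ) ≤ P := by exact_mod_cast hP1
  have hPc : 1 ≤ P * c := by rwa [div_le_iff₀ hc] at hP
  refine ⟨(P + 3) * (2 * P) * 3 + 4 * C, max M P, by positivity, hM.trans (le_max_left _ _),
    fun m hm α β hα hαβ hβ => ?_⟩
  have hmM : M ≤ m := (le_max_left _ _).trans hm
  have hmP : P ≤ m := (le_max_right _ _).trans hm
  have hm1 : 1 ≤ m := hP1.trans hmP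
  have hm0 : (0 : ℝ) < m := by exact_mod_cast hm1
  set n := m / P with hn
  have hn1 : 1 ≤ n := (Nat.one_le_div_iff hP1).2 hmP
  have hn1R : (1 : ℝ) ≤ n := by exact_mod_cast hn1
  have hn0 : (0 : ℝ) < n := by linarith
  have hPn : P * n ≤ m := Nat.mul_div_le m P
  have hmn : (m : ℝ) ≤ 2 * P * n := by
    have h1 : m < n * P + P := Nat.lt_div_mul_add hP1
    have h2 : m ≤ 2 * P * n := by nlinarith
    exact_mod_cast h2
  set w := (n : ℝ) ^ (c - 1) with hw
  have hw1 : w ≤ 1 := Real.rpow_le_one_of_one_le_of_nonpos hn1R (by linarith)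
  have hw0 : 0 < w := by positivity
  have hwn : 1 / (n : ℝ) ≤ w := by
    rw [one_div, ← Real.rpow_neg_one]
    exact Real.rpow_le_rpow_of_exponent_le hn1R (by linarith)
  have hwm : w ≤ 2 * P * (m : ℝ) ^ (c - 1) := by
    have h1 : (2 * P * n : ℝ) ^ (c - 1) ≤ (m : ℝ) ^ (c - 1) :=
      Real.rpow_le_rpow_of_nonpos hm0 hmn (by linarith)
    rw [Real.mul_rpow (by positivity) hn0.le] at h1
    have h2 : (2 * P : ℝ) ^ (-1 : ℝ) ≤ (2 * P : ℝ) ^ (c - 1) :=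
      Real.rpow_le_rpow_of_exponent_le (by linarith) (by linarith)
    rw [Real.rpow_neg_one] at h2
    calc w = 2 * P * ((2 * P : ℝ)⁻¹ * w) := by field_simp
      _ ≤ 2 * P * ((2 * P : ℝ) ^ (c - 1) * w) := by gcongr
      _ ≤ _ := by gcongr
  have hτ : ((P * n : ℕ) : ℝ) * (1 / (2 * (n * w))) ^ (2 * P) ≤ P * w := by
    have h1 : (n : ℝ) * w = (n : ℝ) ^ c := by
      rw [hw, Real.rpow_sub_one hn0.ne']; field_simp
    have h2 : (n : ℝ) ^ 2 ≤ (2 * (n : ℝ) ^ c) ^ (2 * P) := by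
      calc (n : ℝ) ^ 2 = (n : ℝ) ^ (2 : ℝ) := by norm_cast
        _ ≤ (n : ℝ) ^ (c * ((2 * P : ℕ) : ℝ)) :=
          Real.rpow_le_rpow_of_exponent_le hn1R (by push_cast; linarith)
        _ = ((n : ℝ) ^ c) ^ (2 * P) := by rw [Real.rpow_mul hn0.le, Real.rpow_natCast]
        _ ≤ _ := by
          have : 0 < (n : ℝ) ^ c := by positivity
          gcongr; linarith
    rw [h1, one_div, inv_pow]
    calc ((P * n : ℕ) : ℝ) * ((2 * (n : ℝ) ^ c) ^ (2 * P))⁻¹ ≤ ((P * n : ℕ) : ℝ) * ((n : ℝ) ^ 2)⁻¹ := by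
          gcongr
      _ = P * (1 / n) := by push_cast; field_simp
      _ ≤ _ := by gcongr
  set J := Finset.Icc (bracketBase c m R + 1) (bracketBase c (m + 1) R) with hJ
  have hmono := bracketBase_mono hc hR (Nat.le_succ m)
  have hJc : (J.card : ℝ) = (bracketBase c (m + 1) R : ℝ) - bracketBase c m R := by
    rw [hJ, Nat.card_Icc, Nat.add_sub_add_right, Nat.cast_sub hmono]
  have hJg : (J.card : ℝ) ≤ 3 * gap c m := by
    have := bracketBase_sub_le hc hR m
    rw [Nat.cast_sub hmono] at this
    rw [hJc]; exact this
  have hg := gap_nonneg hc m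
  set B := C * ((m : ℝ) ^ (c - 1) * gap c m) / m with hB
  have hB0 : 0 ≤ B := by positivity
  have hsum : ∀ t : ℤ, t ≠ 0 → |t| < ((P * n : ℕ) : ℤ) →
      ‖∑ j ∈ J, ee (t * ((R : ℝ) ^ j * x))‖ ≤ B := by
    intro t ht htn
    have h1 := h m hmM t ht (htn.le.trans (by exact_mod_cast hPn))
    rw [hB, le_div_iff₀ hm0, mul_comm]
    refine le_trans (le_of_eq ?_) h1
    rw [blockSum]
    congr 2
    refine Finset.sum_congr rfl fun j _ => ?_
    congr 1; ring
  have hmain := card_filter_fract_le hn1 hP1 J (fun j => (R : ℝ) ^ j * x) hB0 hsum hwn hαβ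
  refine hmain.trans ?_
  rw [← hJc]
  have hJ0 : (0 : ℝ) ≤ J.card := Nat.cast_nonneg _
  have e1 : (((P * n : ℕ) : ℝ) * (1 / (2 * (n * w))) ^ (2 * P) + 3 * w) * J.card ≤
      (P + 3) * (2 * P * (m : ℝ) ^ (c - 1)) * (3 * gap c m) := by
    calc _ ≤ (P * w + 3 * w) * J.card := by gcongr
      _ = (P + 3) * w * J.card := by ring
      _ ≤ _ := by gcongr
  have e2 : (β - α + 3 * w) * ((P * n : ℕ) : ℝ) * B ≤ 4 * (C * ((m : ℝ) ^ (c - 1) * gap c m)) := by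
    have h1 : ((P * n : ℕ) : ℝ) ≤ m := by exact_mod_cast hPn
    calc (β - α + 3 * w) * ((P * n : ℕ) : ℝ) * B ≤ 4 * m * B := by
          gcongr; linarith
      _ = _ := by rw [hB]; field_simp
  linarith

/-- Above m/2 the weight is at most 2 m^(c-1) and the gaps telescope. Below, everything is at most
⟨h⟩ with h ≤ 3m/4, smaller than ⟨m⟩ by more than any power of m. -/
theorem exists_sum_rpow_mul_gap_le {c : ℝ} (hc : 0 < c) (hc1 : c < 1) :
    ∃ C : ℝ, 0 < C ∧ ∀ M m : ℕ, 1 ≤ M → 2 ≤ m →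
      ∑ k ∈ Finset.Ico M m, (k : ℝ) ^ (c - 1) * gap c k ≤ C * ((m : ℝ) ^ (c - 1) * bracket c m) := by
  have hθ : (3 / 4 : ℝ) ^ c < 1 := Real.rpow_lt_one (by norm_num) (by norm_num) hc
  obtain ⟨C, hC, hexp⟩ := exists_rpow_le_exp hc (show 0 < 1 - (3 / 4 : ℝ) ^ c by linarith) (1 - c)
  refine ⟨2 * C + 2, by positivity, fun M m hM hm => ?_⟩
  have hm0 : (0 : ℝ) < m := by positivity
  have hm1 : (1 : ℝ) ≤ m := by exact_mod_cast (by omega : 1 ≤ m)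
  set h := (m + 1) / 2 with hh
  have hh1 : 1 ≤ h := by omega
  have htel : ∀ a b : ℕ, a ≤ b → ∑ k ∈ Finset.Ico a b, gap c k = (bracket c b : ℝ) - bracket c a := by
    intro a b hab
    exact Finset.sum_Ico_sub (fun k => (bracket c k : ℝ)) hab
  have hnn : ∀ k : ℕ, 0 ≤ (k : ℝ) ^ (c - 1) * gap c k := fun k =>
    mul_nonneg (by positivity) (gap_nonneg hc k)
  have s1 : ∑ k ∈ Finset.Ico 1 h, (k : ℝ) ^ (c - 1) * gap c k ≤ bracket c h := by
    calc _ ≤ ∑ k ∈ Finset.Ico 1 h, gap c k := by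
          refine Finset.sum_le_sum fun k hk => ?_
          have hk1 : (1 : ℝ) ≤ k := by exact_mod_cast (Finset.mem_Ico.1 hk).1
          exact mul_le_of_le_one_left (gap_nonneg hc k)
            (Real.rpow_le_one_of_one_le_of_nonpos hk1 (by linarith))
      _ = (bracket c h : ℝ) - bracket c 1 := htel 1 h hh1
      _ ≤ _ := by linarith [(Nat.cast_nonneg (bracket c 1) : (0 : ℝ) ≤ _)]
  have s2 : ∑ k ∈ Finset.Ico h m, (k : ℝ) ^ (c - 1) * gap c k ≤
      2 * (m : ℝ) ^ (c - 1) * bracket c m := by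
    have hk : ∀ k ∈ Finset.Ico h m, (k : ℝ) ^ (c - 1) * gap c k ≤ 2 * (m : ℝ) ^ (c - 1) * gap c k := by
      intro k hk
      have hk1 := (Finset.mem_Ico.1 hk).1
      have h1 : (m : ℝ) / 2 ≤ k := by
        have : m ≤ 2 * k := by omega
        have : (m : ℝ) ≤ 2 * k := by exact_mod_cast this
        linarith
      have h2 : (k : ℝ) ^ (c - 1) ≤ ((m : ℝ) / 2) ^ (c - 1) :=
        Real.rpow_le_rpow_of_nonpos (by positivity) h1 (by linarith)
      have h3 : ((m : ℝ) / 2) ^ (c - 1) ≤ 2 * (m : ℝ) ^ (c - 1) := by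
        rw [Real.div_rpow hm0.le (by norm_num), div_le_iff₀ (by positivity)]
        have h4 : (2 : ℝ) ^ (-1 : ℝ) ≤ 2 ^ (c - 1) :=
          Real.rpow_le_rpow_of_exponent_le (by norm_num) (by linarith)
        rw [Real.rpow_neg_one] at h4
        have : 0 < (m : ℝ) ^ (c - 1) := by positivity
        nlinarith
      exact mul_le_mul_of_nonneg_right (h2.trans h3) (gap_nonneg hc k)
    refine (Finset.sum_le_sum hk).trans ?_
    rw [← Finset.mul_sum, htel h m (by omega)]
    gcongr
    linarith [(Nat.cast_nonneg (bracket c h) : (0 : ℝ) ≤ _)]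
  have s3 : (bracket c h : ℝ) ≤ 2 * C * ((m : ℝ) ^ (c - 1) * bracket c m) := by
    have h1 : (h : ℝ) ≤ 3 / 4 * m := by
      have : 4 * h ≤ 3 * m := by omega
      have : 4 * (h : ℝ) ≤ 3 * m := by exact_mod_cast this
      linarith
    have h2 : (h : ℝ) ^ c ≤ (3 / 4) ^ c * (m : ℝ) ^ c := by
      rw [← Real.mul_rpow (by norm_num) hm0.le]
      exact Real.rpow_le_rpow (by positivity) h1 hc.le
    have h3 := hexp m hm1
    have h4 := exp_le_two_mul_bracket c m
    have h5 : (m : ℝ) ^ (1 - c) * (m : ℝ) ^ (c - 1) = 1 := by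
      rw [← Real.rpow_add hm0]; simp
    calc (bracket c h : ℝ) ≤ Real.exp ((h : ℝ) ^ c) := bracket_le_exp c h
      _ ≤ Real.exp ((3 / 4) ^ c * (m : ℝ) ^ c) := Real.exp_le_exp.2 h2
      _ = Real.exp ((3 / 4) ^ c * (m : ℝ) ^ c) * ((m : ℝ) ^ (1 - c) * (m : ℝ) ^ (c - 1)) := by
        rw [h5, mul_one]
      _ ≤ Real.exp ((3 / 4) ^ c * (m : ℝ) ^ c) *
          ((C * Real.exp ((1 - (3 / 4) ^ c) * (m : ℝ) ^ c)) * (m : ℝ) ^ (c - 1)) := by gcongr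
      _ = C * (m : ℝ) ^ (c - 1) * (Real.exp ((3 / 4) ^ c * (m : ℝ) ^ c) *
          Real.exp ((1 - (3 / 4) ^ c) * (m : ℝ) ^ c)) := by ring
      _ = C * (m : ℝ) ^ (c - 1) * Real.exp ((m : ℝ) ^ c) := by
        rw [← Real.exp_add]; congr 2; ring
      _ ≤ C * (m : ℝ) ^ (c - 1) * (2 * bracket c m) := by gcongr
      _ = _ := by ring
  calc ∑ k ∈ Finset.Ico M m, (k : ℝ) ^ (c - 1) * gap c k
      ≤ ∑ k ∈ Finset.Ico 1 m, (k : ℝ) ^ (c - 1) * gap c k :=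
        Finset.sum_le_sum_of_subset_of_nonneg (Finset.Ico_subset_Ico hM le_rfl) fun k _ _ => hnn k
    _ = ∑ k ∈ Finset.Ico 1 h, (k : ℝ) ^ (c - 1) * gap c k +
        ∑ k ∈ Finset.Ico h m, (k : ℝ) ^ (c - 1) * gap c k :=
        (Finset.sum_Ico_consecutive _ hh1 (by omega)).symm
    _ ≤ _ := by linarith

theorem exists_one_le_rpow_mul_bracket {c : ℝ} (hc : 0 < c) :
    ∃ C : ℝ, 0 < C ∧ ∀ m : ℕ, 1 ≤ m → 1 ≤ C * ((m : ℝ) ^ (c - 1) * bracket c m) := by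
  obtain ⟨C, hC, h⟩ := exists_rpow_le_exp hc one_pos (1 - c)
  refine ⟨2 * C, by positivity, fun m hm => ?_⟩
  have hm1 : (1 : ℝ) ≤ m := by exact_mod_cast hm
  have hm0 : (0 : ℝ) < m := by linarith
  have h5 := h m hm1
  rw [one_mul] at h5
  have h2 := exp_le_two_mul_bracket c m
  have h6 : (m : ℝ) ^ (1 - c) * (m : ℝ) ^ (c - 1) = 1 := by
    rw [← Real.rpow_add hm0]; simp
  calc (1 : ℝ) = (m : ℝ) ^ (1 - c) * (m : ℝ) ^ (c - 1) := h6.symm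
    _ ≤ (C * (2 * bracket c m)) * (m : ℝ) ^ (c - 1) := by
      gcongr
      exact h5.trans (by gcongr)
    _ = _ := by ring

theorem tendsto_bracketBase {c : ℝ} (hc : 0 < c) {R : ℕ} (hR : 2 ≤ R) :
    Tendsto (fun m => bracketBase c m R) atTop atTop := by
  have hlog : 0 < Real.log R := Real.log_pos (by exact_mod_cast (by omega : 1 < R))
  refine tendsto_nat_floor_atTop.comp (Tendsto.atTop_div_const hlog ?_)
  refine tendsto_natCast_atTop_atTop.comp (tendsto_nat_floor_atTop.comp ?_)
  exact Real.tendsto_exp_atTop.comp ((tendsto_rpow_atTop hc).comp tendsto_natCast_atTop_atTop)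

theorem exists_bracketBase_le_lt {c : ℝ} (hc : 0 < c) {R : ℕ} (hR : 2 ≤ R) {M N : ℕ}
    (hN : bracketBase c M R ≤ N) :
    ∃ m, M ≤ m ∧ bracketBase c m R ≤ N ∧ N < bracketBase c (m + 1) R := by
  classical
  have hex : ∃ m, N < bracketBase c (m + 1) R := by
    obtain ⟨m, hm⟩ := ((tendsto_bracketBase hc hR).eventually_gt_atTop N).exists
    exact ⟨m, hm.trans_le (bracketBase_mono hc hR (Nat.le_succ m))⟩
  refine ⟨Nat.find hex, ?_, ?_, Nat.find_spec hex⟩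
  · rw [Nat.le_find_iff]
    intro m hm
    exact not_lt.2 ((bracketBase_mono hc hR hm).trans hN)
  · by_contra! h
    rcases Nat.eq_zero_or_pos (Nat.find hex) with h0 | h0
    · rw [h0] at h
      exact absurd (h.trans_le (bracketBase_mono hc hR (Nat.zero_le M))) (not_lt.2 hN)
    · have := Nat.find_min hex (m := Nat.find hex - 1) (by omega)
      rw [Nat.sub_add_cancel h0] at this
      exact this h

/-- N lies below the end of block m, so log N ≤ 4 m^c; raising this to the power (1-c)/c produces
m^(1-c), the source of the exponent A. -/
theorem rpow_le_log_rpow {c : ℝ} (hc : 0 < c) (hc1 : c < 1) {R : ℕ} (hR : 2 ≤ R) {m N : ℕ}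
    (hm : 1 ≤ m) (hN : 2 ≤ N) (hNm : N < bracketBase c (m + 1) R) :
    (m : ℝ) ^ (c - 1) ≤ 4 ^ ((1 - c) / c) / Real.log N ^ ((1 - c) / c) := by
  have hm1 : (1 : ℝ) ≤ m := by exact_mod_cast hm
  have hm0 : (0 : ℝ) < m := by linarith
  have hN0 : (0 : ℝ) < N := by positivity
  have hlogN : 0 < Real.log N := Real.log_pos (by exact_mod_cast (by omega : 1 < N))
  have hlog2 : Real.log 2 ≤ Real.log R := Real.log_le_log (by norm_num) (by exact_mod_cast hR)
  have hl2 := Real.log_two_gt_d9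
  have hA : 0 < (1 - c) / c := div_pos (by linarith) hc
  have h1 : (N : ℝ) ≤ 2 * Real.exp (((m + 1 : ℕ) : ℝ) ^ c) := by
    have h2 : (bracketBase c (m + 1) R : ℝ) ≤ bracket c (m + 1) / Real.log R :=
      Nat.floor_le (div_nonneg (Nat.cast_nonneg _) (by linarith))
    have h3 : (bracket c (m + 1) : ℝ) / Real.log R ≤ 2 * bracket c (m + 1) := by
      rw [div_le_iff₀ (by linarith)]
      nlinarith [(Nat.cast_nonneg (bracket c (m + 1)) : (0 : ℝ) ≤ _)]
    have h4 := bracket_le_exp c (m + 1)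
    have h5 : (N : ℝ) ≤ bracketBase c (m + 1) R := by exact_mod_cast hNm.le
    linarith
  have h2 : Real.log N ≤ 4 * (m : ℝ) ^ c := by
    have h3 := Real.log_le_log hN0 h1
    rw [Real.log_mul (by norm_num) (Real.exp_pos _).ne', Real.log_exp] at h3
    have h4 := rpow_succ_sub_le hc hc1 hm
    have h5 : (m : ℝ) ^ (c - 1) ≤ 1 := Real.rpow_le_one_of_one_le_of_nonpos hm1 (by linarith)
    have h6 : (1 : ℝ) ≤ (m : ℝ) ^ c := Real.one_le_rpow hm1 hc.le
    linarith [Real.log_two_lt_d9]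
  rw [le_div_iff₀ (by positivity)]
  have h3 : Real.log N ^ ((1 - c) / c) ≤ 4 ^ ((1 - c) / c) * (m : ℝ) ^ (1 - c) := by
    calc Real.log N ^ ((1 - c) / c) ≤ (4 * (m : ℝ) ^ c) ^ ((1 - c) / c) :=
          Real.rpow_le_rpow hlogN.le h2 hA.le
      _ = 4 ^ ((1 - c) / c) * (m : ℝ) ^ (1 - c) := by
          rw [Real.mul_rpow (by norm_num) (by positivity), ← Real.rpow_mul hm0.le]
          congr 2; field_simp
  calc (m : ℝ) ^ (c - 1) * Real.log N ^ ((1 - c) / c)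
      ≤ (m : ℝ) ^ (c - 1) * (4 ^ ((1 - c) / c) * (m : ℝ) ^ (1 - c)) := by gcongr
    _ = 4 ^ ((1 - c) / c) * ((m : ℝ) ^ (c - 1) * (m : ℝ) ^ (1 - c)) := by ring
    _ = _ := by rw [← Real.rpow_add hm0]; simp

open Classical in
theorem exists_card_filter_fract_le {c : ℝ} (hc : 0 < c) (hc1 : c < 1) {R : ℕ} (hR : 2 ≤ R)
    {x C : ℝ} (hC : 0 < C) {M : ℕ} (hM : 1 ≤ M)
    (h : ∀ m, M ≤ m → ∀ α β : ℝ, 0 ≤ α → α ≤ β → β ≤ 1 →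
      (((Finset.Icc (bracketBase c m R + 1) (bracketBase c (m + 1) R)).filter
        (fun j => Int.fract ((R : ℝ) ^ j * x) ∈ Set.Icc α β)).card : ℝ) ≤
        (β - α) * ((bracketBase c (m + 1) R : ℝ) - bracketBase c m R) +
          C * ((m : ℝ) ^ (c - 1) * gap c m)) :
    ∃ (C' : ℝ) (N₀ : ℕ), 0 < C' ∧ ∀ N, N₀ ≤ N → ∀ α β : ℝ, 0 ≤ α → α ≤ β → β ≤ 1 →
      (((Finset.Icc 1 N).filter (fun n => Int.fract ((R : ℝ) ^ n * x) ∈ Set.Icc α β)).card : ℝ) ≤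
        (β - α) * N + C' * (N / Real.log N ^ ((1 - c) / c)) := by
  obtain ⟨C₁, hC₁, hsum⟩ := exists_sum_rpow_mul_gap_le hc hc1
  obtain ⟨C₂, hC₂, hone⟩ := exists_one_le_rpow_mul_bracket hc
  obtain ⟨C₃, hC₃, hgap⟩ := exists_gap_le hc hc1
  have hlogR : 0 < Real.log R := Real.log_pos (by exact_mod_cast (by omega : 1 < R))
  obtain ⟨M₁, hM₁⟩ := ((tendsto_bracketBase hc hR).eventually_ge_atTop 2).exists
  set M' := max 2 (max M M₁) with hM'
  set K : ℝ := C * C₁ + C₂ * bracketBase c M R + 3 * C₃ with hK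
  refine ⟨K * (2 * Real.log R) * 4 ^ ((1 - c) / c), bracketBase c M' R, by positivity,
    fun N hN α β hα hαβ hβ => ?_⟩
  obtain ⟨m, hM'm, hmN, hNm⟩ := exists_bracketBase_le_lt hc hR hN
  have hm2 : 2 ≤ m := (le_max_left _ _).trans hM'm
  have hMm : M ≤ m := (le_max_left _ _).trans ((le_max_right _ _).trans hM'm)
  have hM₁m : M₁ ≤ m := (le_max_right _ _).trans ((le_max_right _ _).trans hM'm)
  have hb2 : 2 ≤ bracketBase c m R := hM₁.trans (bracketBase_mono hc hR hM₁m)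
  have hN2 : 2 ≤ N := hb2.trans hmN
  have hm1 : (1 : ℝ) ≤ m := by exact_mod_cast (by omega : 1 ≤ m)
  set p : ℕ → Prop := fun n => Int.fract ((R : ℝ) ^ n * x) ∈ Set.Icc α β with hp
  have hsplit : ∀ a b : ℕ, a ≤ b → ((Finset.Icc 1 b).filter p).card ≤
      ((Finset.Icc 1 a).filter p).card + ((Finset.Icc (a + 1) b).filter p).card := by
    intro a b hab
    refine le_trans (Finset.card_le_card ?_) (Finset.card_union_le _ _)
    intro n hn
    rw [Finset.mem_filter, Finset.mem_Icc] at hn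
    rw [Finset.mem_union, Finset.mem_filter, Finset.mem_filter, Finset.mem_Icc, Finset.mem_Icc]
    rcases le_or_gt n a with h1 | h1
    · exact Or.inl ⟨⟨hn.1.1, h1⟩, hn.2⟩
    · exact Or.inr ⟨⟨h1, hn.1.2⟩, hn.2⟩
  have hblocks : ∀ k, M ≤ k → (((Finset.Icc 1 (bracketBase c k R)).filter p).card : ℝ) ≤
      (β - α) * bracketBase c k R + bracketBase c M R +
        C * ∑ i ∈ Finset.Ico M k, (i : ℝ) ^ (c - 1) * gap c i := by
    intro k hk
    induction k, hk using Nat.le_induction with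
    | base =>
      have h1 := Finset.card_filter_le (Finset.Icc 1 (bracketBase c M R)) p
      rw [Nat.card_Icc, Nat.add_sub_cancel] at h1
      have h2 : (((Finset.Icc 1 (bracketBase c M R)).filter p).card : ℝ) ≤ bracketBase c M R := by
        exact_mod_cast h1
      have h3 : 0 ≤ (β - α) * (bracketBase c M R : ℝ) :=
        mul_nonneg (by linarith) (Nat.cast_nonneg _)
      simp only [Finset.Ico_self, Finset.sum_empty]
      linarith
    | succ k hk ih =>
      have h1 := hsplit _ _ (bracketBase_mono hc hR (Nat.le_succ k))
      have h1' : (((Finset.Icc 1 (bracketBase c (k + 1) R)).filter p).card : ℝ) ≤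
        ((Finset.Icc 1 (bracketBase c k R)).filter p).card +
        ((Finset.Icc (bracketBase c k R + 1) (bracketBase c (k + 1) R)).filter p).card := by
        exact_mod_cast h1
      have h2 := h k hk α β hα hαβ hβ
      rw [Finset.sum_Ico_succ_top hk]
      linarith
  -- The incomplete last block is counted trivially: its length is already of the admissible order
  -- m^(c-1)⟨m⟩.
  have hfin : (((Finset.Icc 1 N).filter p).card : ℝ) ≤
      ((Finset.Icc 1 (bracketBase c m R)).filter p).card + 3 * gap c m := by
    have h1 := hsplit _ _ hmN
    have h2 := Finset.card_filter_le (Finset.Icc (bracketBase c m R + 1) N) p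
    rw [Nat.card_Icc] at h2
    have h3 : N + 1 - (bracketBase c m R + 1) ≤ bracketBase c (m + 1) R - bracketBase c m R := by
      omega
    have h4 := bracketBase_sub_le hc hR m
    have h5 : (((Finset.Icc 1 N).filter p).card : ℝ) ≤
      ((Finset.Icc 1 (bracketBase c m R)).filter p).card +
        ((bracketBase c (m + 1) R - bracketBase c m R : ℕ) : ℝ) := by
      exact_mod_cast h1.trans (Nat.add_le_add_left (h2.trans h3) _)
    linarith
  set Z := (m : ℝ) ^ (c - 1) * bracket c m with hZ
  have hZ0 : 0 ≤ Z := by positivity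
  have h1 := hblocks m hMm
  have h2 := hsum M m hM hm2
  have h3 := hone m (by omega)
  have h4 := hgap m (by omega)
  have hKZ : (((Finset.Icc 1 N).filter p).card : ℝ) ≤ (β - α) * N + K * Z := by
    have e1 : (bracketBase c M R : ℝ) ≤ C₂ * bracketBase c M R * Z := by
      have : (0 : ℝ) ≤ bracketBase c M R := Nat.cast_nonneg _
      nlinarith
    have e2 : C * ∑ i ∈ Finset.Ico M m, (i : ℝ) ^ (c - 1) * gap c i ≤ C * (C₁ * Z) := by gcongr
    have e3 : (β - α) * (bracketBase c m R : ℝ) ≤ (β - α) * N := by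
      have : (bracketBase c m R : ℝ) ≤ N := by exact_mod_cast hmN
      have : 0 ≤ β - α := by linarith
      gcongr
    have e4 : K * Z = C * (C₁ * Z) + C₂ * bracketBase c M R * Z + 3 * (C₃ * Z) := by rw [hK]; ring
    linarith
  refine hKZ.trans ?_
  have hbr : (bracket c m : ℝ) ≤ 2 * Real.log R * N := by
    have e1 : bracket c m / Real.log R < (bracketBase c m R : ℝ) + 1 := Nat.lt_floor_add_one _
    rw [div_lt_iff₀ hlogR] at e1
    have e2 : (bracketBase c m R : ℝ) + 1 ≤ 2 * N := by
      have : bracketBase c m R + 1 ≤ 2 * N := by omega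
      exact_mod_cast this
    nlinarith
  have hrp := rpow_le_log_rpow hc hc1 hR (by omega : 1 ≤ m) hN2 hNm
  have hlogN : 0 < Real.log N := Real.log_pos (by exact_mod_cast (by omega : 1 < N))
  have hZle : Z ≤ (4 ^ ((1 - c) / c) / Real.log N ^ ((1 - c) / c)) * (2 * Real.log R * N) := by
    rw [hZ]; gcongr
  have hK0 : 0 ≤ K := by positivity
  have hKle : K * Z ≤ K * ((4 ^ ((1 - c) / c) / Real.log N ^ ((1 - c) / c)) *
      (2 * Real.log R * N)) := by gcongr
  refine (add_le_add_right hKle _).trans (le_of_eq ?_)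
  ring

end Schmidt

/-! ### Assembly of the theorem -/

theorem mainTheorem2 :
    (∃ a : ℕ → ℕ → ℝ, Schmidt.IsCosineConstants a) ∧
    ∀ c : ℝ, 0 < c → c < 1 →
    ∃ δ : ℝ, 0 < δ ∧
    ∀ (s : ℕ → ℕ) (_ : Schmidt.IsAuxSeq s)
      (a : ℕ → ℕ → ℝ) (_ : Schmidt.IsCosineConstants a)
      (κ : ℝ) (_ : 0 < κ)
      (m₀ : ℕ → ℕ) (_ : ∀ r, 2 ≤ r → ∀ m, 1 ≤ m → m₀ r ≤ m →
        ¬ Schmidt.MultDep r (Schmidt.repAux κ a s m)),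
    -- the algorithm has exactly one run `ξ_0, ξ_1, …`, and it converges to a number `ξ_c`
    ∃ ξ : ℕ → ℝ,
      Schmidt.IsRun c m₀ (Schmidt.repBases κ a s) (Schmidt.repAux κ a s) ξ ∧
      (∀ ξ' : ℕ → ℝ,
        Schmidt.IsRun c m₀ (Schmidt.repBases κ a s) (Schmidt.repAux κ a s) ξ' → ξ' = ξ) ∧
    ∃ ξc : ℝ, Tendsto ξ atTop (𝓝 ξc) ∧
      -- the approximations to `ξ_c`
      (∀ m, ξ m ≤ ξc) ∧
      (StrictMonoOn s (Set.Ici 1) → ∀ᶠ m : ℕ in atTop,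
        ξc < ξ m + (Schmidt.repAux κ a s m : ℝ) ^
          (-(Schmidt.bracketBase c (m + 1) (Schmidt.repAux κ a s m) : ℤ) + 2)) ∧
      -- the cancellation estimate
      (∀ m, 1 ≤ m →
        Schmidt.Aprime c m₀ (Schmidt.repBases κ a s) m ξc ≤
          δ * (m : ℝ) ^ 2 *
            ((Schmidt.bracket c (m + 1) : ℝ) - (Schmidt.bracket c m : ℝ)) ^
              (2 - Schmidt.beta a (Schmidt.repBases κ a s) (Schmidt.repAux κ a s) m)) ∧
      -- absolute normality and the discrepancy bound
      (κ < c →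
        Schmidt.IsAbsolutelyNormal ξc ∧
        ∀ r : ℕ, 2 ≤ r →
          (fun N : ℕ => Schmidt.discrepancy (fun n => (r : ℝ) ^ n * ξc) N) =O[atTop]
            (fun N : ℕ => Real.log (Real.log N) / Real.log N ^ ((1 - c) / c))) := by
  refine ⟨Schmidt.exists_isCosineConstants, fun c hc hc1 => ?_⟩
  obtain ⟨C, _, hlim⟩ := Schmidt.exists_run_limit hc hc1
  obtain ⟨δ, hδ, hA⟩ := Schmidt.exists_Aprime_le hc hc1 C
  refine ⟨δ, hδ, fun s hs a ha κ hκ m₀ hm₀ => ?_⟩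
  obtain ⟨ξ, hξ⟩ := Schmidt.exists_isRun c m₀ (Schmidt.repBases κ a s) (Schmidt.repAux κ a s)
  obtain ⟨ξc, htend, hle, hdist⟩ := hlim m₀ _ _ (s 1) ξ hξ
    (fun m hm => Schmidt.three_le_repAux hκ ha hs hm) (fun m hm => Schmidt.repAux_le_mul hκ ha hs hm)
  have hAm := hA s a κ m₀ ξ ξc hs ha hκ hm₀ hξ hle hdist
  refine ⟨ξ, hξ, fun ξ' h' => hξ.unique h', ξc, htend, hle,
    fun hmono => Schmidt.eventually_limit_lt hc hc1 hκ ha hs hξ hdist hmono, hAm, fun hκc => ?_⟩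
  have key : ∀ b : ℕ, 2 ≤ b → Schmidt.IsNormal b ξc ∧
      (fun N : ℕ => Schmidt.discrepancy (fun n => (b : ℝ) ^ n * ξc) N) =O[atTop]
        (fun N : ℕ => Real.log (Real.log N) / Real.log N ^ ((1 - c) / c)) := by
    intro b hb
    -- Base b has index b - 1 among all bases, and φ attains this value.
    obtain ⟨i, hi, hφ⟩ := Schmidt.exists_phi_eq_of_one_le hκ ha hs (show 1 ≤ b - 1 by omega)
    have hbi : Schmidt.repBases κ a s i = b := by
      rw [Schmidt.repBases, hφ, Schmidt.bases]; omega
    have hb₁ : 0 < Schmidt.beta a Schmidt.bases s 1 :=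
      Schmidt.beta_pos ha (fun i => Schmidt.two_le_bases) (fun i hi => (hs.two_lt i hi).le) 1
    obtain ⟨C₁, M₁, hC₁, hM₁, h₁⟩ := Schmidt.exists_mul_norm_blockSum_le hc hc1 hκc hb₁ hδ
      (fun m hm => Schmidt.le_beta_rep hκ ha hs hm) hAm hi
    rw [hbi] at h₁
    obtain ⟨C₂, M₂, hC₂, hM₂, h₂⟩ := Schmidt.exists_card_block_le hc hc1 hb hC₁ hM₁ h₁
    obtain ⟨C₃, N₀, hC₃, h₃⟩ := Schmidt.exists_card_filter_fract_le hc hc1 hb hC₂ hM₂ h₂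
    refine Schmidt.discrepancy_isBigO_and_isNormal hb (div_pos (by linarith) hc) hC₃.le
      (N₀ := N₀) fun N hN α β hα hαβ hβ _ => ?_
    convert h₃ N hN α β hα hαβ hβ
  exact ⟨fun b hb => (key b hb).1, fun b hb => (key b hb).2⟩
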